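/- For $N\ge 1$ let $J$ be a random matrix with probability density proportional to $\exp[-\mathrm{Tr}(JJ^\dagger)]$ with respect to the flat Lebesgue measure on the independent complex matrix entries, in one of three matrix spaces: class $\mathrm A$, all complex $N\times N$ matrices; class $\mathrm{AI}^\dagger$, complex symmetric $N\times N$ matrices; class $\mathrm{AII}^\dagger$, complex self-dual $2N\times 2N$ matrices $J=\begin{pmatrix}A&B\\ C&A^T\end{pmatrix}$ with $A,B,C\in\mathbb C^{N\times N}$, $B^T=-B$, $C^T=-C$. Let $d_N$ be the matrix dimension ($d_N=N$ for $\mathrm A$ and $\mathrm{AI}^\dagger$, $d_N=2N$ for $\mathrm{AII}^\dagger$), let $s=1$ for $\mathrm A$ and $s=1/\sqrt2$ for $\mathrm{AI}^\dagger$, $\mathrm{AII}^\dagger$, and let $$D_N(z,w^*)=\big\langle\det[z\mathbf 1_{d_N}-J]\,\det[w^*\mathbf 1_{d_N}-J^*]\big\rangle ,$$ where $J^*$ is the entrywise complex conjugate of $J$ and $\langle\cdot\rangle$ is the average over the ensemble. Let $\mathrm{erfc}(z)=\frac{2}{\sqrt\pi}\int_z^\infty e^{-t^2}dt$, $\mathrm{erfi}(z)=\frac{2}{\sqrt\pi}\int_0^z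 e^{t^2}dt$, and let $T(x,ib)=\frac{i}{2\pi}\int_0^b\frac{e^{-x^2(1-u^2)/2}}{1-u^2}du$, $-1<b<1$, be Owen's $T$-function at an imaginary second argument, all as entire functions of $z$ or $x$. Let $z_0,\chi,\eta\in\mathbb C$ with $|z_0|=1$, and set $y=(z_0^*\chi+z_0\eta^*)/\sqrt2$ and $$z=\sqrt{d_N}\,s z_0+s\chi,\qquad w^*=\sqrt{d_N}\,s z_0^*+s\eta^*,$$ so that $zw^*=s^2(d_N+\sqrt{2d_N}\,y+\chi\eta^*)$. Then $$D^{\mathrm A}_{\rm edge}:=\lim_{N\to\infty}e^{-zw^*}\frac{D_N^{\mathrm A}(z,w^*)}{D_N^{\mathrm A}(0,0)}=\tfrac12\,\mathrm{erfc}(y),$$ $$D^{\mathrm{AI}^\dagger}_{\rm edge}:=\lim_{N\to\infty}\sqrt N\,e^{-2zw^*}\frac{D_N^{\mathrm{AI}^\dagger}(z,w^*)}{D_N^{\mathrm{AI}^\dagger}(0,0)}=\frac{1}{\sqrt{2\pi}}e^{-y^2}-\frac{y}{\sqrt2}\,\mathrm{erfc}(y),$$ $$D^{\mathrm{AII}^\dagger}_{\rm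 edge}:=\lim_{N\to\infty}\frac{1}{\sqrt{2N}}\,e^{-2zw^*}\frac{D_N^{\mathrm{AII}^\dagger}(z,w^*)}{D_N^{\mathrm{AII}^\dagger}(0,0)}=\Big(-\frac{\sqrt\pi}{4}\,\mathrm{erfc}(y)\,\mathrm{erfi}\big(y/\sqrt2\big)-i\sqrt\pi\,T\big(\sqrt2\,y,i/\sqrt2\big)\Big)e^{-y^2/2}.$$ For real $y$ the tails are, where $f\sim g$ means $f/g\to1$: as $y\to+\infty$, $$D^{\mathrm A}_{\rm edge}\sim\frac{e^{-y^2}}{2\sqrt\pi\,y},\qquad D^{\mathrm{AI}^\dagger}_{\rm edge}\sim\frac{e^{-y^2}}{\sqrt{8\pi}\,y^2},\qquad D^{\mathrm{AII}^\dagger}_{\rm edge}\sim\frac{e^{-y^2}}{\sqrt{8\pi}\,y^2},$$ and as $y\to-\infty$, $$D^{\mathrm A}_{\rm edge}-1\sim\frac{e^{-y^2}}{2\sqrt\pi\,y},\qquad D^{\mathrm{AI}^\dagger}_{\rm edge}+\sqrt2\,y\sim\frac{e^{-y^2}}{\sqrt{8\pi}\,y^2},\qquad D^{\mathrm{AII}^\dagger}_{\rm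 edge}+\frac{1}{\sqrt2\,y}\sim-\frac{1}{\sqrt2\,y^3}.$$ -/

import Mathlib

open Filter Topology Asymptotics MeasureTheory
open scoped Matrix ComplexConjugate

noncomputable section

/-- The Gaussian weight `exp(-Tr (J Jᴴ))`. The trace is real, so taking its real part loses
nothing. -/
def gaussWeight {n : Type*} [Fintype n] (J : Matrix n n ℂ) : ℝ :=
  Real.exp (-(J * Jᴴ).trace.re)

/-- The average of the observable `O` over the Gaussian ensemble of the matrices `emb e`. The
parameter space `E` lists the independent complex matrix entries and carries their flat Lebesgue
measure `volume`; the integral is divided by the partition function. -/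
def gaussAverage {n E : Type*} [Fintype n] [MeasureSpace E] (emb : E → Matrix n n ℂ)
    (O : Matrix n n ℂ → ℂ) : ℂ :=
  (∫ e : E, O (emb e) * (gaussWeight (emb e) : ℂ)) / ((∫ e : E, gaussWeight (emb e) : ℝ) : ℂ)

/-- The expectation of a pair of characteristic polynomials
`D(z, v) = ⟨det (z - J) det (v - J*)⟩`, where `J*` is the entrywise complex conjugate of `J`;
the second argument `v` is the number usually written `w*`. -/
def charPair {n E : Type*} [Fintype n] [DecidableEq n] [MeasureSpace E] (emb : E → Matrix n n ℂ)
    (z v : ℂ) : ℂ :=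
  gaussAverage emb fun J => (z • (1 : Matrix n n ℂ) - J).det * (v • (1 : Matrix n n ℂ) - J.map conj).det

/-- Class A: all complex `N × N` matrices, with `N ^ 2` independent entries. -/
def ginibreMatrix (N : ℕ) (a : Fin N → Fin N → ℂ) : Matrix (Fin N) (Fin N) ℂ :=
  Matrix.of a

/-- Class AI-dagger: the complex symmetric `N × N` matrix with given entries on and above the
diagonal, with `N (N + 1) / 2` independent entries. -/
def symmetricMatrix (N : ℕ) (a : {p : Fin N × Fin N // p.1 ≤ p.2} → ℂ) :
    Matrix (Fin N) (Fin N) ℂ :=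
  Matrix.of fun i j => if h : i ≤ j then a ⟨(i, j), h⟩ else a ⟨(j, i), (lt_of_not_ge h).le⟩

/-- The complex antisymmetric `N × N` matrix with given entries above the diagonal. -/
def antisymmetricMatrix (N : ℕ) (b : {p : Fin N × Fin N // p.1 < p.2} → ℂ) :
    Matrix (Fin N) (Fin N) ℂ :=
  Matrix.of fun i j =>
    if h : i < j then b ⟨(i, j), h⟩ else if h' : j < i then -b ⟨(j, i), h'⟩ else 0

/-- Class AII-dagger: the complex self-dual `2N × 2N` matrix with blocks `A, B, C, Aᵀ`, where `A` is
an arbitrary and `B, C` are antisymmetric complex `N × N` matrices; these are `2 N ^ 2 - N`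
independent entries. -/
def selfDualMatrix (N : ℕ)
    (abc : (Fin N → Fin N → ℂ) × ({p : Fin N × Fin N // p.1 < p.2} → ℂ) ×
      ({p : Fin N × Fin N // p.1 < p.2} → ℂ)) :
    Matrix (Fin N ⊕ Fin N) (Fin N ⊕ Fin N) ℂ :=
  Matrix.fromBlocks (Matrix.of abc.1) (antisymmetricMatrix N abc.2.1)
    (antisymmetricMatrix N abc.2.2) (Matrix.of abc.1)ᵀ

/-- The point `√d s z₀ + s χ` near the edge point `√d s z₀`. -/
def edgePoint (d : ℕ) (s : ℝ) (z₀ χ : ℂ) : ℂ :=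
  (Real.sqrt d : ℂ) * s * z₀ + s * χ

/-- The edge variable `y = (z₀* χ + z₀ η*) / √2`. -/
def edgeVar (z₀ χ η : ℂ) : ℂ :=
  (conj z₀ * χ + z₀ * conj η) / (Real.sqrt 2 : ℂ)

/-- The complementary error function `(2 / √π) ∫_z^∞ exp (-t²) dt` of a complex argument, with
the integral along the ray from `z` parallel to the positive real axis. -/
def erfcC (z : ℂ) : ℂ :=
  2 / (Real.sqrt Real.pi : ℂ) * ∫ t in Set.Ioi (0 : ℝ), Complex.exp (-(z + t) ^ 2)

/-- The imaginary error function `(2 / √π) ∫_0^z exp (s²) ds` of a complex argument, with the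
integral along the segment from `0` to `z`. -/
def erfiC (z : ℂ) : ℂ :=
  2 / (Real.sqrt Real.pi : ℂ) * ∫ s in (0 : ℝ)..1, z * Complex.exp ((s * z) ^ 2)

/-- Owen's T-function `T(x, i b)` at an imaginary second argument, for `-1 < b < 1`; it is entire
in the complex variable `x`. -/
def owenTI (x : ℂ) (b : ℝ) : ℂ :=
  Complex.I / (2 * Real.pi) *
    ∫ u in (0 : ℝ)..b, Complex.exp (-(x ^ 2 * (1 - u ^ 2)) / 2) / (1 - u ^ 2)

/-- The edge limit in class A. -/
def edgeA (y : ℂ) : ℂ :=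
  1 / 2 * erfcC y

/-- The edge limit in class AI-dagger. -/
def edgeAI (y : ℂ) : ℂ :=
  1 / (Real.sqrt (2 * Real.pi) : ℂ) * Complex.exp (-y ^ 2) - y / (Real.sqrt 2 : ℂ) * erfcC y

/-- The edge limit in class AII-dagger. -/
def edgeAII (y : ℂ) : ℂ :=
  (-((Real.sqrt Real.pi : ℂ) / 4) * erfcC y * erfiC (y / (Real.sqrt 2 : ℂ))
    - Complex.I * (Real.sqrt Real.pi : ℂ) * owenTI ((Real.sqrt 2 : ℂ) * y) (1 / Real.sqrt 2))
    * Complex.exp (-y ^ 2 / 2)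

end

/-! ### Second derivatives of determinants under a derivation. -/

section MatrixDerivation

variable {k R n : Type*} [CommRing k] [CommRing R] [Algebra k R]

/-! The average over a matrix of growing size is traded for a Gaussian average over one or two
complex dual variables, whose edge asymptotics follow from Laplace's method.

Duality. Write `Z = z - J` and `V = v - J†`. A polynomial `f` in the entries `x` of `J`, the dual
variables `q` and all their conjugates is chosen so that `f = det Z * det V` at `q = 0`, `f` is
explicit at `x = 0`, and the Gaussian generators `∑ σ ∂∂̄` in `x` and in `q` agree on `f`. Moving
the variances linearly from `x` to `q` leaves the expectation constant (`wick_eq_of_heat_eq`), so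
the average over `J` equals the average of `f(0, q)`. For classes A and AI† take `f = det (Z V + ∑
|q_k|²)` with one, respectively two, dual variables. For AII† take a square root of `det (P² + 2 (a
+ b) P + (a - b)²)`, where `P = Z V`, `a = |q₀|²`, `b = |q₁|²`. It is a polynomial because it is a
quotient of Pfaffians. Agreement of the generators is checked with Jacobi's formula and the
completeness relation of the basis matrices (`IsFlipFrame`). Everything is multiplied by
determinants, so that adjugates replace inverses and the computation stays in a polynomial ring,
where the nonzero factor is cancelled at the end.

Edge limit. Each `|q_k|²` is exponentially distributed, which gives real integrals of `(X + s) ^ n *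
exp (-s)` with `X = n + √(2n) y + O(1)`. Put `s = √(2n) q` and `X + s = n (1 + w)`. The integrand
becomes `((1 + w) exp (-w)) ^ n`, up to constants controlled by Stirling's formula, and tends to
`exp (-(y + q)²)` under an integrable bound. The limits are half-line integrals of this Gaussian
with weight `1`, `q` or Dawson's function of `q`. The last one is matched with the erfc, erfi and
Owen expression because both, times `exp (y² / 2)`, have the same derivative and the same value at
`0`.

Tails. On the right only the behaviour of the weight at `q = 0` matters, and `q` and Dawson's
function agree there to first order. On the left A and AI† follow by reflection, and AII† by
comparing its differential equation with the one satisfied by the truncated expansion. -/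

theorem Derivation.map_prod {ι : Type*} [DecidableEq ι] (D : Derivation k R R) (s : Finset ι)
    (f : ι → R) : D (∏ i ∈ s, f i) = ∑ i ∈ s, (∏ j ∈ s.erase i, f j) * D (f i) := by
  induction s using Finset.induction_on with
  | empty => simp
  | insert a s ha ih =>
    rw [Finset.prod_insert ha, Derivation.leibniz, ih, Finset.sum_insert ha,
      Finset.erase_insert ha, smul_eq_mul, smul_eq_mul, Finset.mul_sum, add_comm]
    congr 1
    refine Finset.sum_congr rfl fun i hi => ?_
    rw [Finset.erase_insert_of_ne (by rintro rfl; exact ha hi),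
      Finset.prod_insert (fun h => ha (Finset.mem_of_mem_erase h)), mul_assoc]

theorem Matrix.map_derivation_add (D : Derivation k R R) (M N : Matrix n n R) :
    (M + N).map D = M.map D + N.map D := by
  ext i j; simp

theorem Matrix.map_derivation_smul (D : Derivation k R R) (r : R) (M : Matrix n n R) :
    (r • M).map D = r • M.map D + D r • M := by
  ext i j; simp [mul_comm]

theorem Matrix.map_derivation_one [DecidableEq n] (D : Derivation k R R) :
    (1 : Matrix n n R).map D = 0 := by
  ext i j
  by_cases h : i = j <;> simp [h]

variable [Fintype n]

theorem Matrix.map_derivation_mul (D : Derivation k R R) (M N : Matrix n n R) :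
    (M * N).map D = M.map D * N + M * N.map D := by
  ext i j
  simp only [Matrix.map_apply, Matrix.mul_apply, Matrix.add_apply, map_sum, Derivation.leibniz,
    smul_eq_mul, Finset.sum_add_distrib]
  rw [add_comm]
  congr 1
  exact Finset.sum_congr rfl fun _ _ => mul_comm _ _

theorem Derivation.map_trace (D : Derivation k R R) (M : Matrix n n R) :
    D M.trace = (M.map D).trace := by
  simp [Matrix.trace]

variable [DecidableEq n]

/-- Jacobi's formula: the Leibniz rule replaces one column at a time by its derivative, and Cramer's
rule expresses the resulting determinants through the adjugate. -/
theorem Derivation.map_det (D : Derivation k R R) (M : Matrix n n R) :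
    D M.det = (M.adjugate * M.map D).trace := by
  have h : D M.det = ∑ i, (M.updateCol i fun j => D (M j i)).det := by
    simp only [Matrix.det_apply, map_sum]
    rw [Finset.sum_comm]
    refine Finset.sum_congr rfl fun σ _ => ?_
    rw [← Finset.smul_sum, Units.smul_def, Units.smul_def, map_zsmul, Derivation.map_prod]
    congr 1
    refine Finset.sum_congr rfl fun i _ => ?_
    rw [← Finset.mul_prod_erase _ _ (Finset.mem_univ i), mul_comm]
    congr 1
    · simp
    · refine Finset.prod_congr rfl fun j hj => ?_
      rw [Matrix.updateCol_ne (Finset.ne_of_mem_erase hj)]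
  rw [h, Matrix.trace]
  refine Finset.sum_congr rfl fun i _ => ?_
  rw [← Matrix.cramer_apply, Matrix.cramer_eq_adjugate_mulVec, Matrix.diag_apply, Matrix.mul_apply]
  rfl

/-- The second derivative of a determinant. -/
theorem Derivation.det_mul_map_map_det (D D' : Derivation k R R) (M : Matrix n n R) :
    M.det * D' (D M.det) = (M.adjugate * M.map D').trace * (M.adjugate * M.map D).trace
      - (M.adjugate * M.map D' * M.adjugate * M.map D).trace
      + M.det * (M.adjugate * (M.map D).map D').trace := by
  -- The derivative of the adjugate comes from differentiating `M * adj M = det M • 1` and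
  -- multiplying by `adj M` on the left; the scaling by `det M` avoids inverting `M`.
  have h : M.det • M.adjugate.map D' = (M.adjugate * M.map D').trace • M.adjugate
      - M.adjugate * M.map D' * M.adjugate := by
    have h1 : (M * M.adjugate).map D' = (M.adjugate * M.map D').trace • 1 := by
      rw [Matrix.mul_adjugate, Matrix.map_derivation_smul, Matrix.map_derivation_one,
        D'.map_det]
      simp
    rw [Matrix.map_derivation_mul] at h1
    have h2 : M * M.adjugate.map D' = (M.adjugate * M.map D').trace • 1
        - M.map D' * M.adjugate := by
      rw [← h1]; abel
    calc M.det • M.adjugate.map D' = M.adjugate * (M * M.adjugate.map D') := by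
          rw [← mul_assoc, Matrix.adjugate_mul]; simp
      _ = _ := by
          rw [h2, mul_sub, Matrix.mul_smul, mul_one, mul_assoc]
  rw [D.map_det, D'.map_trace, Matrix.map_derivation_mul, Matrix.trace_add, mul_add,
    ← smul_eq_mul, ← Matrix.trace_smul, ← Matrix.smul_mul, h, sub_mul, Matrix.trace_sub,
    Matrix.smul_mul, Matrix.trace_smul, smul_eq_mul]

/-- The second derivative of a square root of a determinant. -/
theorem Derivation.det_mul_map_map_sqrt_det (D D' : Derivation k R R) (M : Matrix n n R) (φ : R)
    (hφ : φ ^ 2 = M.det) :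
    4 * (M.det * φ * D' (D φ)) = (M.adjugate * M.map D').trace * (M.adjugate * M.map D).trace
      - 2 * (M.adjugate * M.map D' * M.adjugate * M.map D).trace
      + 2 * (M.det * (M.adjugate * (M.map D).map D').trace) := by
  have h := Derivation.det_mul_map_map_det D D' M
  -- Differentiating `φ² = det M` once gives the first derivatives of `φ`, and twice gives `h3`.
  have h1 : 2 * (φ * D φ) = (M.adjugate * M.map D).trace := by
    rw [← D.map_det, ← hφ, pow_two, Derivation.leibniz, smul_eq_mul]; ring
  have h2 : 2 * (φ * D' φ) = (M.adjugate * M.map D').trace := by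
    rw [← D'.map_det, ← hφ, pow_two, Derivation.leibniz, smul_eq_mul]; ring
  have h3 : D' (D M.det) = 2 * (D' φ * D φ) + 2 * (φ * D' (D φ)) := by
    rw [← hφ, pow_two, Derivation.leibniz, smul_eq_mul, map_add, Derivation.leibniz, smul_eq_mul,
      smul_eq_mul]; ring
  rw [h3, ← h1, ← h2] at h
  rw [← h1, ← h2]
  have h4 : M.det = φ ^ 2 := hφ.symm
  rw [h4] at h ⊢
  linear_combination 2 * h

end MatrixDerivation

/-! ### Gaussian expectation of polynomials and its heat equation. -/

section Wick

open MvPolynomial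

variable {I : Type*} [Fintype I]

/-- The moment of the monomial with exponents `m` under independent centred complex Gaussian
variables with variances `σ e`; the variables `inl e` and `inr e` stand for a Gaussian variable and
its complex conjugate. -/
noncomputable def wickMoment (σ : I → ℂ) (m : I ⊕ I →₀ ℕ) : ℂ :=
  ∏ e, if m (.inl e) = m (.inr e) then ((m (.inl e)).factorial : ℂ) * σ e ^ m (.inl e) else 0

/-- The expectation of a polynomial in complex Gaussian variables and their conjugates. -/
noncomputable def wick (σ : I → ℂ) : MvPolynomial (I ⊕ I) ℂ →ₗ[ℂ] ℂ :=
  (basisMonomials (I ⊕ I) ℂ).constr ℂ (wickMoment σ)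

theorem wick_monomial (σ : I → ℂ) (m : I ⊕ I →₀ ℕ) (c : ℂ) :
    wick σ (monomial m c) = c * wickMoment σ m := by
  have h : monomial m c = c • basisMonomials (I ⊕ I) ℂ m := by
    simp [smul_monomial]
  rw [h, map_smul, wick, Module.Basis.constr_basis, smul_eq_mul]

/-- The generator `∑ e, σ e ∂_e ∂̄_e` of the Gaussian semigroup. -/
noncomputable def heat (σ : I → ℂ) (f : MvPolynomial (I ⊕ I) ℂ) : MvPolynomial (I ⊕ I) ℂ :=
  ∑ e, C (σ e) * pderiv (.inr e) (pderiv (.inl e) f)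

/-- Applying `∂_e ∂̄_e` lowers both exponents at `e` and multiplies by them. Since `p² (p - 1)! = p!
p`, this is the derivative of the `e`-th moment factor in `σ e`. If an exponent is `0`, the
truncated subtraction is harmless, as the prefactor vanishes. -/
theorem wick_pderiv_pderiv_monomial [DecidableEq I] (σ : I → ℂ) (m : I ⊕ I →₀ ℕ) (c : ℂ) (e : I) :
    wick σ (pderiv (.inr e) (pderiv (.inl e) (monomial m c))) =
      c * ((∏ e' ∈ Finset.univ.erase e, if m (.inl e') = m (.inr e') then
        ((m (.inl e')).factorial : ℂ) * σ e' ^ m (.inl e') else 0) *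
        (if m (.inl e) = m (.inr e) then ((m (.inl e)).factorial : ℂ) *
          (m (.inl e) * σ e ^ (m (.inl e) - 1)) else 0)) := by
  rw [pderiv_monomial, pderiv_monomial, wick_monomial, wickMoment,
    ← Finset.mul_prod_erase _ _ (Finset.mem_univ e)]
  have h1 : ∀ e' ∈ Finset.univ.erase e,
      (m - Finsupp.single (Sum.inl e) 1 - Finsupp.single (Sum.inr e) 1 : I ⊕ I →₀ ℕ) (.inl e') = m (.inl e') ∧
      (m - Finsupp.single (Sum.inl e) 1 - Finsupp.single (Sum.inr e) 1 : I ⊕ I →₀ ℕ) (.inr e') = m (.inr e') := by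
    intro e' he'
    have := Finset.ne_of_mem_erase he'
    simp [this]
  rw [Finset.prod_congr rfl fun e' he' => by rw [(h1 e' he').1, (h1 e' he').2]]
  have h2 : (m - Finsupp.single (Sum.inl e) 1 - Finsupp.single (Sum.inr e) 1 : I ⊕ I →₀ ℕ) (.inl e)
      = m (.inl e) - 1 := by simp
  have h3 : (m - Finsupp.single (Sum.inl e) 1 - Finsupp.single (Sum.inr e) 1 : I ⊕ I →₀ ℕ) (.inr e)
      = m (.inr e) - 1 := by simp
  have h4 : (m - Finsupp.single (Sum.inl e) 1 : I ⊕ I →₀ ℕ) (.inr e) = m (.inr e) := by simp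
  rw [h2, h3, h4]
  generalize m (.inl e) = p
  generalize m (.inr e) = q
  rcases p with _ | p
  · simp
  rcases q with _ | q
  · simp
  by_cases hpq : p = q
  · subst hpq
    simp only [Nat.add_sub_cancel, if_true, Nat.factorial_succ]
    push_cast
    ring
  · simp [hpq]

theorem hasDerivAt_wick [DecidableEq I] (σ τ : I → ℂ) (f : MvPolynomial (I ⊕ I) ℂ) (t : ℂ) :
    HasDerivAt (fun t => wick (fun e => σ e + t * τ e) f)
      (wick (fun e => σ e + t * τ e) (heat τ f)) t := by
  induction f using MvPolynomial.induction_on' with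
  | monomial m c =>
    simp only [heat, map_sum, ← smul_eq_C_mul, map_smul, wick_pderiv_pderiv_monomial]
    simp only [wick_monomial, wickMoment]
    have h : ∀ e ∈ Finset.univ, HasDerivAt (fun t : ℂ => if m (.inl e) = m (.inr e) then
        ((m (.inl e)).factorial : ℂ) * (σ e + t * τ e) ^ m (.inl e) else 0)
        (τ e * if m (.inl e) = m (.inr e) then ((m (.inl e)).factorial : ℂ) *
          (m (.inl e) * (σ e + t * τ e) ^ (m (.inl e) - 1)) else 0) t := by
      intro e _
      split_ifs
      · have := ((((hasDerivAt_id t).mul_const (τ e)).const_add (σ e)).pow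
          (m (.inl e))).const_mul ((m (.inl e)).factorial : ℂ)
        refine HasDerivAt.congr_deriv this ?_
        simp only [id]; ring
      · simpa using hasDerivAt_const t (0 : ℂ)
    refine ((HasDerivAt.fun_finsetProd h).const_mul c).congr_deriv ?_
    rw [Finset.mul_sum]
    refine Finset.sum_congr rfl fun e _ => ?_
    simp only [smul_eq_mul]; ring
  | add p q hp hq =>
    have : heat τ (p + q) = heat τ p + heat τ q := by
      simp [heat, mul_add, Finset.sum_add_distrib]
    simp only [this, map_add]
    exact hp.add hq

/-- A polynomial on which two Gaussian generators agree has the same expectation under the two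
Gaussian laws. -/
theorem wick_eq_of_heat_eq (σ τ : I → ℂ) (f : MvPolynomial (I ⊕ I) ℂ)
    (h : heat σ f = heat τ f) : wick σ f = wick τ f := by
  classical
  -- Along the segment from `σ` to `τ` the derivative is the expectation of `heat τ f - heat σ f =
  -- 0`.
  have hd : ∀ t, HasDerivAt (fun t => wick (fun e => σ e + t * (τ e - σ e)) f) 0 t := by
    intro t
    have := hasDerivAt_wick σ (fun e => τ e - σ e) f t
    have h0 : heat (fun e => τ e - σ e) f = 0 := by
      simp only [heat, map_sub, sub_mul, Finset.sum_sub_distrib] at h ⊢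
      rw [h, sub_self]
    rwa [h0, map_zero] at this
  have := is_const_of_deriv_eq_zero (fun t => (hd t).differentiableAt) (fun t => (hd t).deriv) 0 1
  simpa using this

/-- Variables of variance zero can be set to zero. -/
theorem wick_aeval_zero (σ : I → ℂ) (S : Set I) [DecidablePred (· ∈ S)] (hS : ∀ e ∈ S, σ e = 0)
    (f : MvPolynomial (I ⊕ I) ℂ) :
    wick σ (aeval (fun i => if Sum.elim id id i ∈ S then 0 else X i :
      I ⊕ I → MvPolynomial (I ⊕ I) ℂ) f) = wick σ f := by
  induction f using MvPolynomial.induction_on' with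
  | monomial m c =>
    -- A monomial that contains a variable of variance zero has moment zero, and any other monomial
    -- is fixed by the substitution.
    by_cases hm : ∃ i, Sum.elim id id i ∈ S ∧ m i ≠ 0
    · obtain ⟨i, hi, hmi⟩ := hm
      have h1 : aeval (fun i => if Sum.elim id id i ∈ S then 0 else X i :
          I ⊕ I → MvPolynomial (I ⊕ I) ℂ) (monomial m c) = 0 := by
        rw [aeval_monomial, Finsupp.prod_fintype _ _ (by simp),
          Finset.prod_eq_zero (Finset.mem_univ i) (by simp [hi, hmi]), mul_zero]
      rw [h1, map_zero, wick_monomial, wickMoment,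
        Finset.prod_eq_zero (Finset.mem_univ (Sum.elim id id i)), mul_zero]
      rw [hS _ hi]
      have h0 : ∀ a b : ℕ, a ≠ 0 ∨ b ≠ 0 →
          (if a = b then (a.factorial : ℂ) * 0 ^ a else 0) = 0 := by
        rintro a b hab
        split_ifs with h
        · subst h
          simp [or_self_iff.1 hab]
        · rfl
      rcases i with e | e
      · exact h0 _ _ (.inl hmi)
      · exact h0 _ _ (.inr hmi)
    · push Not at hm
      congr 1
      rw [aeval_monomial, monomial_eq]
      congr 1
      refine Finsupp.prod_congr fun i hi => ?_
      rw [if_neg fun h => Finsupp.mem_support_iff.1 hi (hm i h)]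
  | add p q hp hq => rw [map_add, map_add, map_add, hp, hq]

end Wick

/-! ### Gaussian integrals over the matrix entries as Wick expectations. -/

section GaussianMoments

theorem integral_norm_pow_mul_exp (c : ℝ) (hc : 0 < c) (m : ℕ) :
    ∫ z : ℂ, ‖z‖ ^ (2 * m) * Real.exp (-(c * ‖z‖ ^ 2)) =
      Real.pi / c * (m.factorial * (1 / c) ^ m) := by
  have h := Complex.integral_rpow_mul_exp_neg_mul_rpow (p := 2) (q := 2 * m) one_le_two
    (by have : (0 : ℝ) ≤ m := m.cast_nonneg
        linarith) hc
  have h1 : ∀ z : ℂ, ‖z‖ ^ (2 * m) * Real.exp (-(c * ‖z‖ ^ 2)) =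
      ‖z‖ ^ (2 * m : ℝ) * Real.exp (-c * ‖z‖ ^ (2 : ℝ)) := by
    intro z
    rw [← Real.rpow_natCast, ← Real.rpow_natCast]
    push_cast
    ring_nf
  simp_rw [h1]
  rw [h]
  have h2 : (-(2 * (m : ℝ) + 2) / 2) = -((m + 1 : ℕ) : ℝ) := by push_cast; ring
  have h3 : (2 * (m : ℝ) + 2) / 2 = m + 1 := by ring
  rw [h2, h3, Real.Gamma_nat_eq_factorial, Real.rpow_neg hc.le, Real.rpow_natCast, one_div, inv_pow, pow_succ]
  field_simp

/-- A non-integrable function has integral `0` by convention, whereas the value already computed is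
positive. -/
theorem integrable_norm_pow_mul_exp (c : ℝ) (hc : 0 < c) (m : ℕ) :
    Integrable fun z : ℂ => ‖z‖ ^ (2 * m) * Real.exp (-(c * ‖z‖ ^ 2)) := by
  by_contra h
  have h1 := integral_norm_pow_mul_exp c hc m
  rw [integral_undef h] at h1
  have : 0 < Real.pi / c * (m.factorial * (1 / c) ^ m) := by positivity
  exact this.ne h1

theorem integrable_pow_mul_conj_pow_mul_exp (c : ℝ) (hc : 0 < c) (m n : ℕ) :
    Integrable fun z : ℂ => z ^ m * conj z ^ n * (Real.exp (-(c * ‖z‖ ^ 2)) : ℂ) := by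
  have h := (integrable_norm_pow_mul_exp c hc m).add (integrable_norm_pow_mul_exp c hc n)
  refine h.mono' (by fun_prop) (.of_forall fun z => ?_)
  rw [norm_mul, norm_mul, norm_pow, norm_pow, RCLike.norm_conj, Complex.norm_real,
    Real.norm_of_nonneg (Real.exp_pos _).le, Pi.add_apply, ← add_mul]
  refine mul_le_mul_of_nonneg_right ?_ (Real.exp_pos _).le
  rw [pow_mul', pow_mul']
  nlinarith [sq_nonneg (‖z‖ ^ m - ‖z‖ ^ n), sq_nonneg (‖z‖ ^ m), sq_nonneg (‖z‖ ^ n)]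

theorem integral_pow_mul_conj_pow_mul_exp (c : ℝ) (hc : 0 < c) (m n : ℕ) :
    ∫ z : ℂ, z ^ m * conj z ^ n * (Real.exp (-(c * ‖z‖ ^ 2)) : ℂ) =
      (Real.pi / c : ℝ) * if m = n then (m.factorial : ℂ) * (1 / c : ℂ) ^ m else 0 := by
  split_ifs with h
  · subst h
    have h1 : ∀ z : ℂ, z ^ m * conj z ^ m * (Real.exp (-(c * ‖z‖ ^ 2)) : ℂ) =
        ((‖z‖ ^ (2 * m) * Real.exp (-(c * ‖z‖ ^ 2)) : ℝ) : ℂ) := by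
      intro z
      rw [← mul_pow, Complex.mul_conj, Complex.normSq_eq_norm_sq, pow_mul]
      push_cast
      rfl
    simp_rw [h1]
    rw [integral_complex_ofReal, integral_norm_pow_mul_exp c hc]
    push_cast
    rfl
  · rw [mul_zero]
    -- Rotation by `θ` multiplies `z ^ m * conj z ^ n` by `exp (i (m - n) θ) = -1` and preserves the
    -- weight and the measure, so the integral equals its own negative.
    set θ : ℝ := Real.pi / ((m : ℝ) - n) with hθ
    have hmn : (m : ℝ) - n ≠ 0 := sub_ne_zero.2 (by exact_mod_cast h)
    have hrot := (rotation (Circle.exp θ)).measurePreserving.integral_comp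
      (rotation (Circle.exp θ)).toHomeomorph.measurableEmbedding
      (fun z : ℂ => z ^ m * conj z ^ n * (Real.exp (-(c * ‖z‖ ^ 2)) : ℂ))
    have hu : Complex.exp (θ * Complex.I) ^ m * conj (Complex.exp (θ * Complex.I)) ^ n = -1 := by
      rw [← Complex.exp_conj, ← Complex.exp_nat_mul, ← Complex.exp_nat_mul, ← Complex.exp_add,
        ← Complex.exp_pi_mul_I]
      congr 1
      simp only [map_mul, Complex.conj_ofReal, Complex.conj_I]
      have : (m : ℂ) * (θ * Complex.I) + n * (θ * -Complex.I) = ((θ * (m - n) : ℝ) : ℂ) * Complex.I := by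
        push_cast; ring
      rw [this, hθ, div_mul_cancel₀ _ hmn]
    have h2 : ∀ z : ℂ, (rotation (Circle.exp θ) z) ^ m * conj (rotation (Circle.exp θ) z) ^ n *
        (Real.exp (-(c * ‖rotation (Circle.exp θ) z‖ ^ 2)) : ℂ) =
        -(z ^ m * conj z ^ n * (Real.exp (-(c * ‖z‖ ^ 2)) : ℂ)) := by
      intro z
      rw [LinearIsometryEquiv.norm_map, rotation_apply, Circle.coe_exp, map_mul, mul_pow, mul_pow]
      linear_combination (z ^ m * conj z ^ n * (Real.exp (-(c * ‖z‖ ^ 2)) : ℂ)) * hu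
    simp_rw [h2] at hrot
    rw [integral_neg] at hrot
    exact self_eq_neg.1 hrot.symm

/-- Integrals over `E` of products of functions of the individual coordinates `x a i` factorize. -/
structure HasProductIntegral {E ι : Type*} [Fintype ι] [MeasureSpace E] (x : E → ι → ℂ) : Prop where
  integrable : ∀ f : ι → ℂ → ℂ, (∀ i, Integrable (f i)) → Integrable fun a => ∏ i, f i (x a i)
  integral : ∀ f : ι → ℂ → ℂ, ∫ a, ∏ i, f i (x a i) = ∏ i, ∫ z, f i z

theorem hasProductIntegral_pi (ι : Type*) [Fintype ι] :
    HasProductIntegral (fun a : ι → ℂ => a) where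
  integrable _ hf := Integrable.fintype_prod hf
  integral f := integral_fintype_prod_volume_eq_prod f

theorem hasProductIntegral_curry (ι κ : Type*) [Fintype ι] [Fintype κ] :
    HasProductIntegral (fun (a : ι → κ → ℂ) (p : ι × κ) => a p.1 p.2) where
  integrable f hf := by
    simp only [Fintype.prod_prod_type]
    exact Integrable.fintype_prod (f := fun i (b : κ → ℂ) => ∏ j, f (i, j) (b j))
      fun i => Integrable.fintype_prod fun j => hf (i, j)
  integral f := by
    simp only [Fintype.prod_prod_type]
    rw [integral_fintype_prod_volume_eq_prod (fun i (b : κ → ℂ) => ∏ j, f (i, j) (b j))]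
    exact Finset.prod_congr rfl fun i _ => integral_fintype_prod_volume_eq_prod _

theorem HasProductIntegral.prod {E F ι κ : Type*} [Fintype ι] [Fintype κ] [MeasureSpace E]
    [MeasureSpace F] [SFinite (volume : Measure E)] [SFinite (volume : Measure F)]
    {x : E → ι → ℂ} {y : F → κ → ℂ} (hx : HasProductIntegral x) (hy : HasProductIntegral y) :
    HasProductIntegral (fun a : E × F => Sum.elim (x a.1) (y a.2)) where
  integrable f hf := by
    simp only [Fintype.prod_sum_type, Sum.elim_inl, Sum.elim_inr]
    exact (hx.integrable _ fun i => hf (.inl i)).mul_prod (hy.integrable _ fun i => hf (.inr i))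
  integral f := by
    simp only [Fintype.prod_sum_type, Sum.elim_inl, Sum.elim_inr]
    rw [Measure.volume_eq_prod, integral_prod_mul (fun a => ∏ i, f (.inl i) (x a i))
      (fun b => ∏ i, f (.inr i) (y b i)), hx.integral fun i => f (.inl i),
      hy.integral fun i => f (.inr i)]

open MvPolynomial

/-- The evaluation point at which the variables `inl (inl i)` are `a i`, the variables
`inr (inl i)` are their conjugates, and the remaining variables vanish. -/
def conjPoint {ι : Type*} (κ : Type*) (a : ι → ℂ) : (ι ⊕ κ) ⊕ (ι ⊕ κ) → ℂ :=
  Sum.elim (Sum.elim a 0) (Sum.elim (fun i => conj (a i)) 0)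

variable {E ι κ : Type*} [Fintype ι] [Fintype κ] [MeasureSpace E] {x : E → ι → ℂ}

theorem HasProductIntegral.integral_monomial (hx : HasProductIntegral x) (c : ι → ℝ)
    (hc : ∀ i, 0 < c i) (m : (ι ⊕ κ) ⊕ (ι ⊕ κ) →₀ ℕ) :
    Integrable (fun a => eval (conjPoint κ (x a)) (monomial m 1) *
        (Real.exp (-∑ i, c i * ‖x a i‖ ^ 2) : ℂ)) ∧
    ∫ a, eval (conjPoint κ (x a)) (monomial m 1) * (Real.exp (-∑ i, c i * ‖x a i‖ ^ 2) : ℂ) =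
      (∏ i, (Real.pi / c i : ℝ) : ℂ) *
        wickMoment (Sum.elim (fun i => (1 / c i : ℂ)) 0) m := by
  -- `K` is the contribution of the dual variables evaluated at `0`. It is `1` or `0`, and agrees
  -- with their moments at variance zero because `0 ^ 0 = 1`.
  set K : ℂ := ∏ k : κ, 0 ^ m (.inl (.inr k)) * 0 ^ m (.inr (.inr k)) with hK
  have h : ∀ a, eval (conjPoint κ (x a)) (monomial m 1) *
      (Real.exp (-∑ i, c i * ‖x a i‖ ^ 2) : ℂ) =
      K * ∏ i, x a i ^ m (.inl (.inl i)) * conj (x a i) ^ m (.inr (.inl i)) *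
        (Real.exp (-(c i * ‖x a i‖ ^ 2)) : ℂ) := by
    intro a
    rw [eval_monomial, Finsupp.prod_fintype _ _ (by simp), Fintype.prod_sum_type,
      Fintype.prod_sum_type, Fintype.prod_sum_type, ← Finset.sum_neg_distrib, Real.exp_sum,
      Complex.ofReal_prod, Finset.prod_mul_distrib, Finset.prod_mul_distrib, hK,
      Finset.prod_mul_distrib]
    simp only [conjPoint, Sum.elim_inl, Sum.elim_inr, Pi.zero_apply]
    ring
  simp_rw [h]
  refine ⟨(hx.integrable (fun i z => z ^ m (.inl (.inl i)) * conj z ^ m (.inr (.inl i)) *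
    (Real.exp (-(c i * ‖z‖ ^ 2)) : ℂ)) fun i =>
      integrable_pow_mul_conj_pow_mul_exp _ (hc i) _ _).const_mul K, ?_⟩
  rw [integral_const_mul, hx.integral fun i z => z ^ m (.inl (.inl i)) *
    conj z ^ m (.inr (.inl i)) * (Real.exp (-(c i * ‖z‖ ^ 2)) : ℂ)]
  simp_rw [integral_pow_mul_conj_pow_mul_exp _ (hc _)]
  rw [Finset.prod_mul_distrib, wickMoment, Fintype.prod_sum_type]
  simp only [Sum.elim_inl, Sum.elim_inr, Pi.zero_apply]
  have hK' : K = ∏ k : κ, if m (.inl (.inr k)) = m (.inr (.inr k)) then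
      ((m (.inl (.inr k))).factorial : ℂ) * 0 ^ m (.inl (.inr k)) else 0 := by
    refine Finset.prod_congr rfl fun k _ => ?_
    generalize m (.inl (.inr k)) = p
    generalize m (.inr (.inr k)) = q
    rcases p with _ | p <;> rcases q with _ | q <;> simp
  rw [← hK']
  ring

theorem HasProductIntegral.integral_eval (hx : HasProductIntegral x) (c : ι → ℝ)
    (hc : ∀ i, 0 < c i) (f : MvPolynomial ((ι ⊕ κ) ⊕ (ι ⊕ κ)) ℂ) :
    Integrable (fun a => eval (conjPoint κ (x a)) f * (Real.exp (-∑ i, c i * ‖x a i‖ ^ 2) : ℂ)) ∧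
    ∫ a, eval (conjPoint κ (x a)) f * (Real.exp (-∑ i, c i * ‖x a i‖ ^ 2) : ℂ) =
      (∏ i, (Real.pi / c i : ℝ) : ℂ) * wick (Sum.elim (fun i => (1 / c i : ℂ)) 0) f := by
  induction f using MvPolynomial.induction_on' with
  | monomial m r =>
    have h := hx.integral_monomial (κ := κ) c hc m
    have hr : monomial m r = r • monomial m (1 : ℂ) := by simp [smul_monomial]
    simp only [hr, smul_eval, mul_assoc]
    refine ⟨h.1.const_mul r, ?_⟩
    rw [integral_const_mul, h.2, map_smul, wick_monomial, smul_eq_mul]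
    ring
  | add p q hp hq =>
    simp only [map_add, add_mul]
    refine ⟨hp.1.add hq.1, ?_⟩
    rw [integral_add hp.1 hq.1, hp.2, hq.2, mul_add]

/-- Gaussian averages of polynomials in the independent entries. -/
theorem gaussAverage_eq_wick (hx : HasProductIntegral x) (κ : Type*) [Fintype κ] {n : Type*}
    [Fintype n] (emb : E → Matrix n n ℂ) (c : ι → ℝ) (hc : ∀ i, 0 < c i)
    (hw : ∀ a, (emb a * (emb a)ᴴ).trace.re = ∑ i, c i * ‖x a i‖ ^ 2) (O : Matrix n n ℂ → ℂ)
    (f : MvPolynomial ((ι ⊕ κ) ⊕ (ι ⊕ κ)) ℂ) (hf : ∀ a, O (emb a) = eval (conjPoint κ (x a)) f) :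
    gaussAverage emb O = wick (Sum.elim (fun i => (1 / c i : ℂ)) 0) f := by
  have h1 := (hx.integral_eval (κ := κ) c hc 1).2
  have h2 := (hx.integral_eval c hc f).2
  simp only [gaussAverage, gaussWeight, hw, hf]
  rw [← integral_complex_ofReal, h2]
  -- The polynomial `1` yields the partition function, so the prefactor `∏ π / c i` cancels in the
  -- quotient.
  have h3 : wick (Sum.elim (fun i => (1 / c i : ℂ)) 0 : ι ⊕ κ → ℂ) 1 = 1 := by
    have : (1 : MvPolynomial ((ι ⊕ κ) ⊕ (ι ⊕ κ)) ℂ) = monomial 0 1 := rfl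
    rw [this, wick_monomial]
    simp [wickMoment]
  rw [h3, mul_one] at h1
  simp only [map_one, one_mul] at h1
  rw [h1]
  refine mul_div_cancel_left₀ _ ?_
  refine Finset.prod_ne_zero_iff.2 fun i _ => ?_
  exact_mod_cast (div_pos Real.pi_pos (hc i)).ne'

end GaussianMoments

/-! ### Determinants that are squares. -/

section AlternatingDeterminant

/-- The root is the Pfaffian, built by induction on the size. A nonzero entry `M i j` gives an
invertible `2 × 2` block of determinant `(M i j)²`, and the Schur complement of that block is again
antisymmetric. -/
theorem Matrix.isSquare_det_of_transpose_eq_neg {K : Type*} [Field K] [CharZero K] {n : Type*}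
    [Fintype n] [DecidableEq n] (M : Matrix n n K) (hM : Mᵀ = -M) : IsSquare M.det := by
  classical
  induction hN : Fintype.card n using Nat.strong_induction_on generalizing n with
  | _ N ih =>
  by_cases h0 : M = 0
  · subst h0
    cases isEmpty_or_nonempty n
    · simp
    · simp [Matrix.det_zero]
  obtain ⟨i, j, hij⟩ : ∃ i j, M i j ≠ 0 := by
    by_contra! h
    exact h0 (by ext i j; exact h i j)
  have hM' : ∀ k l, M k l = -M l k := fun k l => congrFun (congrFun hM l) k
  have hd : ∀ k, M k k = 0 := fun k => self_eq_neg.1 (hM' k k)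
  have hne : i ≠ j := by rintro rfl; exact hij (hd i)
  have hf : Function.Injective ![i, j] := by
    intro a b hab
    fin_cases a <;> fin_cases b <;> simp [hne, hne.symm] at hab ⊢
  let e : Fin 2 ⊕ ((Set.range ![i, j])ᶜ : Set n) ≃ n :=
    (Equiv.sumCongr (Equiv.ofInjective _ hf) (Equiv.refl _)).trans (Equiv.Set.sumCompl _)
  have hcard : Fintype.card ((Set.range ![i, j])ᶜ : Set n) < N := by
    have := Fintype.card_congr e
    rw [Fintype.card_sum, Fintype.card_fin, hN] at this
    omega
  have he0 : e (.inl 0) = i := by simp [e]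
  have he1 : e (.inl 1) = j := by simp [e]
  set T := M.submatrix e e with hT
  have hTt : Tᵀ = -T := by rw [hT, Matrix.transpose_submatrix, hM]; rfl
  rw [← Matrix.det_submatrix_equiv_self e M, ← hT, ← Matrix.fromBlocks_toBlocks T]
  rw [← Matrix.fromBlocks_toBlocks T, Matrix.fromBlocks_transpose, Matrix.fromBlocks_neg,
    Matrix.fromBlocks_inj] at hTt
  obtain ⟨h11, h21, h12, h22⟩ := hTt
  generalize hA : T.toBlocks₁₁ = A at *
  generalize T.toBlocks₁₂ = B at *
  generalize T.toBlocks₂₁ = C at *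
  generalize T.toBlocks₂₂ = D at *
  have hdet : A.det = M i j * M i j := by
    rw [Matrix.det_fin_two, ← hA]
    simp only [Matrix.toBlocks₁₁, Matrix.of_apply, hT, Matrix.submatrix_apply, he0, he1, hd]
    rw [hM' j i]; ring
  have hu : IsUnit A.det := by rw [hdet]; exact (mul_ne_zero hij hij).isUnit
  let _ := Matrix.invertibleOfIsUnitDet A hu
  rw [Matrix.det_fromBlocks₁₁, hdet]
  refine (IsSquare.mul_self _).mul (ih _ hcard _ ?_ rfl)
  rw [Matrix.transpose_sub, Matrix.transpose_mul, Matrix.transpose_mul, Matrix.invOf_eq_nonsing_inv,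
    Matrix.transpose_nonsing_inv, h11, h22, h12]
  have hB : Cᵀ = -B := h21
  have hinv : (-A)⁻¹ = -A⁻¹ := by
    refine Matrix.inv_eq_left_inv ?_
    rw [neg_mul_neg, Matrix.nonsing_inv_mul _ hu]
  rw [hB, hinv]
  simp only [Matrix.neg_mul, Matrix.mul_neg, neg_neg, Matrix.mul_assoc]
  abel

/-- In the fraction field `det Y` is the square of a quotient of Pfaffians, those of `Y * Z` and
`Z`. This quotient is integral over `R`, since its square lies in `R`, and hence belongs to `R`. -/
theorem Matrix.exists_sq_eq_det {R : Type*} [CommRing R] [IsDomain R] [CharZero R]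
    [IsIntegrallyClosed R] {n : Type*} [Fintype n] [DecidableEq n] (Y Z : Matrix n n R)
    (hZ : Zᵀ = -Z) (hYZ : (Y * Z)ᵀ = -(Y * Z)) (hdet : Z.det ≠ 0) : ∃ φ : R, φ ^ 2 = Y.det := by
  let K := FractionRing R
  have : CharZero K := charZero_of_injective_algebraMap (IsFractionRing.injective R K)
  let f := algebraMap R K
  obtain ⟨s, hs⟩ := (Z.map f).isSquare_det_of_transpose_eq_neg (by
    rw [← Matrix.transpose_map, hZ]; ext; simp)
  obtain ⟨r, hr⟩ := ((Y * Z).map f).isSquare_det_of_transpose_eq_neg (by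
    rw [← Matrix.transpose_map, hYZ]; ext; simp [-Matrix.map_mul])
  have hZd : (Z.map f).det = f Z.det := (RingHom.map_det f Z).symm
  have hYd : ((Y * Z).map f).det = f (Y.det * Z.det) := by
    rw [← Matrix.det_mul]; exact (RingHom.map_det f (Y * Z)).symm
  have hs0 : s ≠ 0 := by
    rintro rfl
    rw [hZd, mul_zero] at hs
    exact hdet ((map_eq_zero_iff f (IsFractionRing.injective R K)).1 hs)
  have hsq : (r / s) ^ 2 = f Y.det := by
    rw [div_pow, pow_two, pow_two, ← hr, ← hs, hYd, map_mul, hZd, mul_div_cancel_right₀]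
    rw [← hZd, hs]; exact mul_ne_zero hs0 hs0
  obtain ⟨φ, hφ⟩ := IsIntegrallyClosed.exists_algebraMap_eq_of_isIntegral_pow (R := R) (K := K)
    (x := r / s) two_pos (by rw [hsq]; exact isIntegral_algebraMap)
  refine ⟨φ, IsFractionRing.injective R K ?_⟩
  rw [map_pow, hφ, hsq]

end AlternatingDeterminant

/-! ### Contraction of traces with completeness relations. -/

section Completeness

variable {R n ι : Type*} [CommRing R] [Fintype n] [DecidableEq n] [Fintype ι]

/-- The weighted sum of `U e ⊗ U e` is `c₁` times the flip plus `c₂` times a twisted flip. -/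
def IsFlipFrame (σ : ι → R) (U : ι → Matrix n n R) (c₁ c₂ : R) (τ : Matrix n n R) : Prop :=
  ∀ i j l k, ∑ e, σ e * (U e i j * U e l k) =
    c₁ * ((1 : Matrix n n R) i l * (1 : Matrix n n R) j k) + c₂ * (τ i k * τ j l)

variable {σ : ι → R} {U : ι → Matrix n n R} {c₁ c₂ : R} {τ : Matrix n n R}

/-- Summation over a frame merges two traces into one; `sum_trace_mul` is the companion in which the
flip term splits one trace into two. These are the only two patterns in the second derivatives
below. -/
theorem IsFlipFrame.sum_trace_mul_trace (h : IsFlipFrame σ U c₁ c₂ τ) (P Q : Matrix n n R) :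
    ∑ e, σ e * ((P * U e).trace * (Q * (U e)ᵀ).trace) =
      c₁ * (P * Q).trace + c₂ * (P * (τ * Qᵀ * τᵀ)).trace := by
  have h1 : ∀ e, σ e * ((P * U e).trace * (Q * (U e)ᵀ).trace) =
      ∑ j, ∑ i, ∑ l, ∑ k, P j i * Q l k * (σ e * (U e i j * U e l k)) := by
    intro e
    simp only [Matrix.trace, Matrix.diag_apply, Matrix.mul_apply, Matrix.transpose_apply,
      Finset.sum_mul]
    simp only [Finset.mul_sum]
    refine Finset.sum_congr rfl fun j _ => Finset.sum_congr rfl fun i _ =>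
      Finset.sum_congr rfl fun l _ => Finset.sum_congr rfl fun k _ => ?_
    ring
  simp only [h1]
  rw [Finset.sum_comm]
  simp_rw [Finset.sum_comm (s := (Finset.univ : Finset ι)), ← Finset.mul_sum]
  simp only [h _ _ _ _, mul_add, Finset.sum_add_distrib]
  congr 1
  · simp only [Matrix.one_apply, Matrix.trace, Matrix.diag_apply, Matrix.mul_apply, Finset.mul_sum]
    refine Finset.sum_congr rfl fun j _ => Finset.sum_congr rfl fun i _ => ?_
    simp
    ring
  · simp only [Matrix.trace, Matrix.diag_apply, Matrix.mul_apply, Matrix.transpose_apply,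
      Finset.mul_sum, Finset.sum_mul]
    refine Finset.sum_congr rfl fun j _ => Finset.sum_congr rfl fun i _ => ?_
    refine Finset.sum_congr rfl fun l _ => Finset.sum_congr rfl fun k _ => ?_
    ring

theorem Finset.sum_comm_outer {M α β γ : Type*} [AddCommMonoid M] [Fintype α] [Fintype β]
    [Fintype γ] (f : α → β → γ → M) : ∑ a, ∑ b, ∑ c, f a b c = ∑ c, ∑ b, ∑ a, f a b c := by
  rw [Finset.sum_comm]
  simp_rw [Finset.sum_comm (s := (Finset.univ : Finset α))]
  rw [Finset.sum_comm]

theorem IsFlipFrame.sum_trace_mul (h : IsFlipFrame σ U c₁ c₂ τ) (P Q : Matrix n n R) :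
    ∑ e, σ e * (P * U e * Q * (U e)ᵀ).trace =
      c₁ * (P.trace * Q.trace) + c₂ * (P * (τ * Qᵀ * τ)).trace := by
  have h1 : ∀ e, σ e * (P * U e * Q * (U e)ᵀ).trace =
      ∑ m, ∑ k, ∑ j, ∑ i, P m i * Q j k * (σ e * (U e i j * U e m k)) := by
    intro e
    simp only [Matrix.trace, Matrix.diag_apply, Matrix.mul_apply, Matrix.transpose_apply,
      Finset.sum_mul, Finset.mul_sum]
    refine Finset.sum_congr rfl fun j _ => Finset.sum_congr rfl fun i _ =>
      Finset.sum_congr rfl fun l _ => Finset.sum_congr rfl fun k _ => ?_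
    ring
  simp only [h1]
  rw [Finset.sum_comm]
  simp_rw [Finset.sum_comm (s := (Finset.univ : Finset ι)), ← Finset.mul_sum]
  simp only [h _ _ _ _, mul_add, Finset.sum_add_distrib]
  congr 1
  · simp only [Matrix.trace, Matrix.diag_apply, Finset.sum_mul]
    simp only [Finset.mul_sum]
    refine Finset.sum_congr rfl fun m _ => Finset.sum_congr rfl fun k _ => ?_
    simp [Matrix.one_apply]
    ring
  · simp only [Matrix.trace, Matrix.diag_apply, Matrix.mul_apply, Matrix.transpose_apply,
      Finset.mul_sum, Finset.sum_mul]
    refine Finset.sum_congr rfl fun m _ => ?_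
    rw [Finset.sum_comm_outer]
    refine Finset.sum_congr rfl fun i _ => Finset.sum_congr rfl fun l _ =>
      Finset.sum_congr rfl fun k _ => ?_
    ring

end Completeness

/-! ### Agreement of the two generators for unconstrained and symmetric matrices. -/

section DeterminantDuality

variable {k R n ι : Type*} [CommRing k] [CommRing R] [Algebra k R] [Fintype n] [DecidableEq n]
  [Fintype ι]

/-- An intertwiner of `Y'` and `Y` intertwines their inverses; multiplying by the common determinant
states this for adjugates. -/
theorem Matrix.adjugate_mul_eq_mul_adjugate [IsDomain R] {Y Y' M : Matrix n n R}
    (h : Y' * M = M * Y) (hdet : Y'.det = Y.det) (h0 : Y.det ≠ 0) :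
    Y'.adjugate * M = M * Y.adjugate := by
  refine smul_right_injective _ h0 ?_
  calc Y.det • (Y'.adjugate * M) = Y'.adjugate * (M * Y) * Y.adjugate := by
        rw [mul_assoc, mul_assoc, Matrix.mul_adjugate]; simp
    _ = Y.det • (M * Y.adjugate) := by
        rw [← h, ← mul_assoc, Matrix.adjugate_mul, hdet]; simp

/-- The matrices `Z` and `V` vary in the opposite directions `-U` and `-Uᵀ` under `D` and `D'`. -/
structure IsDualPair (D D' : Derivation k R R) (Z V U : Matrix n n R) : Prop where
  fst_map : Z.map D = -U
  snd_map : V.map D = 0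
  fst_map' : Z.map D' = 0
  snd_map' : V.map D' = -Uᵀ
  dir_map' : U.map D' = 0

/-- Here `Y` has first derivatives `-U V` and `-Z Uᵀ` and mixed derivative `U Uᵀ`. Cyclicity of the
trace brings each term into a shape that a flip frame contracts. -/
theorem IsDualPair.det_mul_map_map_det {D D' : Derivation k R R} {Z V U : Matrix n n R}
    (h : IsDualPair D D' Z V U) (ρ : R) (hρ : D ρ = 0) (hρ' : D' ρ = 0) {Y : Matrix n n R}
    (hY : Y = Z * V + ρ • 1) :
    Y.det * D' (D Y.det) =
      (V * Y.adjugate * U).trace * (Y.adjugate * Z * Uᵀ).trace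
      - (Y.adjugate * U * (V * Y.adjugate * Z) * Uᵀ).trace
      + Y.det * (Y.adjugate * U * 1 * Uᵀ).trace := by
  have h1 : Y.map D = -(U * V) := by
    rw [hY, Matrix.map_derivation_add, Matrix.map_derivation_mul, Matrix.map_derivation_smul,
      Matrix.map_derivation_one, h.fst_map, h.snd_map, hρ]
    simp
  have h2 : Y.map D' = -(Z * Uᵀ) := by
    rw [hY, Matrix.map_derivation_add, Matrix.map_derivation_mul, Matrix.map_derivation_smul,
      Matrix.map_derivation_one, h.fst_map', h.snd_map', hρ']
    simp
  have h3 : (Y.map D).map D' = U * Uᵀ := by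
    have : (-(U * V)).map D' = -((U * V).map D') := by ext; simp [-Matrix.map_mul]
    rw [h1, this, Matrix.map_derivation_mul, h.snd_map', h.dir_map']
    simp
  rw [Derivation.det_mul_map_map_det, h3, h1, h2]
  generalize Y.adjugate = A
  have e1 : (A * (U * V)).trace = (V * A * U).trace := by
    rw [← mul_assoc, Matrix.trace_mul_comm, mul_assoc]
  have e2 : A * Z * Uᵀ * A * (U * V) = (A * Z * Uᵀ) * (A * U * V) := by simp only [mul_assoc]
  have e3 : (A * Z * Uᵀ * A * (U * V)).trace = (A * U * (V * A * Z) * Uᵀ).trace := by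
    rw [e2, Matrix.trace_mul_comm]
    simp only [mul_assoc]
  simp only [mul_neg, neg_mul, Matrix.trace_neg, neg_neg, mul_one]
  rw [e1, ← mul_assoc A, ← mul_assoc A, e3, mul_comm (A * Z * Uᵀ).trace]

/-- The dual side: a dual variable enters `Y` only through a multiple of the identity, so both first
derivatives are scalar matrices. -/
theorem det_mul_map_map_det_scalar {D D' : Derivation k R R} {Y : Matrix n n R} (q q' : R)
    (h : Y.map D = q' • 1) (h' : Y.map D' = q • 1) (hq : D' q' = 1) :
    Y.det * D' (D Y.det) = q * q' * (Y.adjugate.trace ^ 2 - (Y.adjugate * Y.adjugate).trace)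
      + Y.det * Y.adjugate.trace := by
  have h3 : (Y.map D).map D' = 1 := by
    rw [h, Matrix.map_derivation_smul, Matrix.map_derivation_one, hq]; simp
  rw [Derivation.det_mul_map_map_det, h3, h, h']
  simp only [Matrix.mul_smul, mul_one, Matrix.smul_mul, Matrix.trace_smul, smul_eq_mul]
  ring

variable {Z V : Matrix n n R} {σ : ι → R} {U : ι → Matrix n n R} {D D' : ι → Derivation k R R}

theorem adjugate_mul_mul {Y : Matrix n n R} {ρ : R} (hY : Y = Z * V + ρ • 1) :
    Y.adjugate * (Z * V) = Y.det • 1 - ρ • Y.adjugate := by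
  rw [← Matrix.adjugate_mul, eq_sub_iff_add_eq]
  nth_rw 4 [hY]
  rw [mul_add, Matrix.mul_smul, mul_one]

/-- Duality for unconstrained matrices. -/
theorem IsFlipFrame.det_duality (hU : IsFlipFrame σ U 1 0 0)
    (h : ∀ e, IsDualPair (D e) (D' e) Z V (U e)) {ρ : R} (hρ : ∀ e, D e ρ = 0 ∧ D' e ρ = 0)
    {Y : Matrix n n R} (hY : Y = Z * V + ρ • 1) :
    Y.det * ∑ e, σ e * D' e (D e Y.det) =
      ρ * (Y.adjugate.trace ^ 2 - (Y.adjugate * Y.adjugate).trace) + Y.det * Y.adjugate.trace := by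
  have hA := adjugate_mul_mul hY
  have hn : Y.det * ∑ e, σ e * D' e (D e Y.det) =
      ∑ e, σ e * ((V * Y.adjugate * U e).trace * (Y.adjugate * Z * (U e)ᵀ).trace)
      - ∑ e, σ e * (Y.adjugate * U e * (V * Y.adjugate * Z) * (U e)ᵀ).trace
      + Y.det * ∑ e, σ e * (Y.adjugate * U e * 1 * (U e)ᵀ).trace := by
    rw [Finset.mul_sum, Finset.mul_sum, ← Finset.sum_sub_distrib, ← Finset.sum_add_distrib]
    refine Finset.sum_congr rfl fun e _ => ?_
    linear_combination σ e * (h e).det_mul_map_map_det ρ (hρ e).1 (hρ e).2 hY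
  rw [hn, hU.sum_trace_mul_trace, hU.sum_trace_mul, hU.sum_trace_mul]
  have h1 : (V * Y.adjugate * (Y.adjugate * Z)).trace =
      Y.det * Y.adjugate.trace - ρ * (Y.adjugate * Y.adjugate).trace := by
    rw [mul_assoc, Matrix.trace_mul_comm, mul_assoc, mul_assoc, hA, mul_sub, Matrix.mul_smul,
      Matrix.mul_smul, mul_one, Matrix.trace_sub, Matrix.trace_smul, Matrix.trace_smul,
      smul_eq_mul, smul_eq_mul]
  -- The term with the trace of `1`, which carries the matrix size, cancels against the third sum.
  have h2 : (V * Y.adjugate * Z).trace =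
      Y.det * (1 : Matrix n n R).trace - ρ * Y.adjugate.trace := by
    rw [mul_assoc, Matrix.trace_mul_comm, mul_assoc, hA, Matrix.trace_sub, Matrix.trace_smul,
      Matrix.trace_smul, smul_eq_mul, smul_eq_mul]
  rw [h1, h2]
  ring

/-- Duality for symmetric matrices. -/
theorem IsFlipFrame.det_duality_of_symm [IsDomain R] {c : R} (hU : IsFlipFrame σ U c c 1)
    (h : ∀ e, IsDualPair (D e) (D' e) Z V (U e)) {ρ : R} (hρ : ∀ e, D e ρ = 0 ∧ D' e ρ = 0)
    {Y : Matrix n n R} (hY : Y = Z * V + ρ • 1) (hZ : Zᵀ = Z) (hV : Vᵀ = V) (h0 : Y.det ≠ 0) :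
    Y.det * ∑ e, σ e * D' e (D e Y.det) = c * (ρ * (Y.adjugate.trace ^ 2
      - (Y.adjugate * Y.adjugate).trace) + 2 * (Y.det * Y.adjugate.trace)) := by
  have hA := adjugate_mul_mul hY
  have hYt : Yᵀ = V * Z + ρ • 1 := by rw [hY]; simp [hZ, hV]
  -- For symmetric `Z` and `V`, `Yᵀ = V Z + ρ`, so `V` and `Z` intertwine `Y` and `Yᵀ`. The twisted
  -- contractions thus reduce to the same traces, and the term `Y.det * tr (adj Y)` occurs twice:
  -- the number of dual variables needed.
  have hAV : Y.adjugateᵀ * V = V * Y.adjugate := by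
    rw [Matrix.adjugate_transpose]
    refine Matrix.adjugate_mul_eq_mul_adjugate ?_ (Matrix.det_transpose _) h0
    rw [hYt, hY]; simp [add_mul, mul_add, mul_assoc]
  have hAZ : Y.adjugate * Z = Z * Y.adjugateᵀ := by
    rw [Matrix.adjugate_transpose]
    refine Matrix.adjugate_mul_eq_mul_adjugate ?_ (Matrix.det_transpose _).symm
      (by rwa [Matrix.det_transpose])
    rw [hYt, hY]; simp [add_mul, mul_add, mul_assoc]
  have hn : Y.det * ∑ e, σ e * D' e (D e Y.det) =
      ∑ e, σ e * ((V * Y.adjugate * U e).trace * (Y.adjugate * Z * (U e)ᵀ).trace)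
      - ∑ e, σ e * (Y.adjugate * U e * (V * Y.adjugate * Z) * (U e)ᵀ).trace
      + Y.det * ∑ e, σ e * (Y.adjugate * U e * 1 * (U e)ᵀ).trace := by
    rw [Finset.mul_sum, Finset.mul_sum, ← Finset.sum_sub_distrib, ← Finset.sum_add_distrib]
    refine Finset.sum_congr rfl fun e _ => ?_
    linear_combination σ e * (h e).det_mul_map_map_det ρ (hρ e).1 (hρ e).2 hY
  rw [hn, hU.sum_trace_mul_trace, hU.sum_trace_mul, hU.sum_trace_mul]
  have h1 : (V * Y.adjugate * (Y.adjugate * Z)).trace =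
      Y.det * Y.adjugate.trace - ρ * (Y.adjugate * Y.adjugate).trace := by
    rw [mul_assoc, Matrix.trace_mul_comm, mul_assoc, mul_assoc, hA, mul_sub, Matrix.mul_smul,
      Matrix.mul_smul, mul_one, Matrix.trace_sub, Matrix.trace_smul, Matrix.trace_smul,
      smul_eq_mul, smul_eq_mul]
  have h2 : (V * Y.adjugate * Z).trace =
      Y.det * (1 : Matrix n n R).trace - ρ * Y.adjugate.trace := by
    rw [mul_assoc, Matrix.trace_mul_comm, mul_assoc, hA, Matrix.trace_sub, Matrix.trace_smul,
      Matrix.trace_smul, smul_eq_mul, smul_eq_mul]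
  have h3 : (Y.adjugate * Z)ᵀ = Y.adjugate * Z := by
    rw [Matrix.transpose_mul, hZ, hAZ]
  have h4 : (Y.adjugate * (V * Y.adjugate * Z)ᵀ).trace =
      Y.det * Y.adjugate.trace - ρ * (Y.adjugate * Y.adjugate).trace := by
    rw [mul_assoc V, Matrix.transpose_mul, h3, hV, mul_assoc, hA, mul_sub, Matrix.mul_smul,
      Matrix.mul_smul, mul_one, Matrix.trace_sub, Matrix.trace_smul, Matrix.trace_smul,
      smul_eq_mul, smul_eq_mul]
  simp only [Matrix.transpose_one, mul_one, one_mul]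
  rw [h3, h4, h1, h2]
  ring

end DeterminantDuality

/-! ### Second derivatives of the square root of a quadratic determinant. -/

section SelfDualDuality

variable {k R n ι : Type*} [CommRing k] [CommRing R] [Algebra k R]
  [Fintype n] [DecidableEq n] [Fintype ι]

/-- Completing the square: `Y = (X + s)² - (s² - t)`. -/
theorem square_shift_mul_adjugate {X Y : Matrix n n R} {s t : R}
    (hY : Y = X * X + (2 * s) • X + t • 1) :
    (X + s • 1) * (X + s • 1) * Y.adjugate = Y.det • 1 + (s ^ 2 - t) • Y.adjugate := by
  have : (X + s • 1) * (X + s • 1) = Y + (s ^ 2 - t) • 1 := by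
    rw [hY]
    simp only [add_mul, mul_add, Matrix.smul_mul, Matrix.mul_smul, one_mul, mul_one, smul_smul]
    module
  rw [this, add_mul, Matrix.mul_adjugate, Matrix.smul_mul, one_mul]

variable [IsDomain R]

theorem adjugate_comm_quadratic {X Y : Matrix n n R} {s t : R}
    (hY : Y = X * X + (2 * s) • X + t • 1) (h0 : Y.det ≠ 0) :
    Y.adjugate * X = X * Y.adjugate := by
  refine Matrix.adjugate_mul_eq_mul_adjugate ?_ rfl h0
  rw [hY]; simp [add_mul, mul_add, mul_assoc]

variable [CharZero R]

/-- With `S = X + s`, every derivative of `Y` is an anticommutator with `S`. The combination `B = S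
adj Y` absorbs these factors, and what remains of `S adj Y S` is reduced by completing the square.
The result is again a sum of patterns that a flip frame contracts. -/
theorem IsDualPair.det_mul_map_map_sqrt_det {D D' : Derivation k R R} {Z V U : Matrix n n R}
    (h : IsDualPair D D' Z V U) {s t φ : R} (hs : D s = 0 ∧ D' s = 0) (ht : D t = 0 ∧ D' t = 0)
    {X Y B : Matrix n n R} (hX : X = Z * V) (hY : Y = X * X + (2 * s) • X + t • 1)
    (h0 : Y.det ≠ 0) (hB : B = (X + s • 1) * Y.adjugate) (hφ : φ ^ 2 = Y.det) :
    Y.det * φ * D' (D φ) =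
      (V * B * U).trace * (B * Z * Uᵀ).trace
      - (B * U * (V * B * Z) * Uᵀ).trace
      - (s ^ 2 - t) * (Y.adjugate * U * (V * Y.adjugate * Z) * Uᵀ).trace
      + Y.det * (B * U * 1 * Uᵀ).trace := by
  set S := X + s • 1 with hS
  have hSS := square_shift_mul_adjugate hY
  rw [← hS] at hSS
  have hAS : Y.adjugate * S = S * Y.adjugate := by
    rw [hS, mul_add, add_mul, adjugate_comm_quadratic hY h0]; simp
  have hXD : X.map D = -(U * V) := by
    rw [hX, Matrix.map_derivation_mul, h.fst_map, h.snd_map]; simp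
  have hXD' : X.map D' = -(Z * Uᵀ) := by
    rw [hX, Matrix.map_derivation_mul, h.fst_map', h.snd_map']; simp
  have h2s : D (2 * s) = 0 ∧ D' (2 * s) = 0 := by
    rw [two_mul, map_add, map_add, hs.1, hs.2, add_zero]; exact ⟨rfl, rfl⟩
  have hYD : ∀ (E : Derivation k R R) (W : Matrix n n R), X.map E = -W → E (2 * s) = 0 → E t = 0 →
      Y.map E = -(W * S + S * W) := by
    intro E W hW h1 h2
    rw [hY, Matrix.map_derivation_add, Matrix.map_derivation_add, Matrix.map_derivation_mul,
      Matrix.map_derivation_smul, Matrix.map_derivation_smul, Matrix.map_derivation_one, hW, h1, h2,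
      hS]
    simp only [neg_mul, mul_neg, add_mul, mul_add, Matrix.smul_mul, Matrix.mul_smul, one_mul, mul_one]
    module
  have h1 := hYD D _ hXD h2s.1 ht.1
  have h2 := hYD D' _ hXD' h2s.2 ht.2
  have hSD' : S.map D' = -(Z * Uᵀ) := by
    rw [hS, Matrix.map_derivation_add, Matrix.map_derivation_smul, Matrix.map_derivation_one, hs.2,
      hXD']
    simp
  have hWD' : (U * V).map D' = -(U * Uᵀ) := by
    rw [Matrix.map_derivation_mul, h.snd_map', h.dir_map']; simp
  have h3 : (Y.map D).map D' = U * Uᵀ * S + U * V * (Z * Uᵀ) + Z * Uᵀ * (U * V) + S * (U * Uᵀ) := by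
    have : (-(U * V * S + S * (U * V))).map D' = -((U * V * S + S * (U * V)).map D') := by
      ext; simp [-Matrix.map_mul]
    rw [h1, this, Matrix.map_derivation_add, Matrix.map_derivation_mul (n := n) D' (U * V) S,
      Matrix.map_derivation_mul (n := n) D' S, hWD', hSD']
    noncomm_ring
  have h4 := Derivation.det_mul_map_map_sqrt_det D D' Y φ hφ
  rw [h3, h1, h2] at h4
  clear h1 h2 h3 hYD hSD' hWD' hXD hXD'
  generalize Y.adjugate = A at *
  have hBA : B = A * S := by rw [hB, hAS]
  have tr1 : ∀ W : Matrix n n R, (A * -(W * S + S * W)).trace = -2 * (B * W).trace := by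
    intro W
    have : (A * (W * S)).trace = (B * W).trace := by
      rw [← mul_assoc, Matrix.trace_mul_comm, ← mul_assoc, hB]
    rw [mul_neg, Matrix.trace_neg, mul_add, Matrix.trace_add, this, ← mul_assoc, ← hBA]
    ring
  -- The `det Y` part produces terms that later cancel the `U V Z Uᵀ` and `Z Uᵀ U V` parts of the
  -- mixed second derivative.
  have hSAS : S * A * S = Y.det • 1 + (s ^ 2 - t) • A := by
    rw [mul_assoc, hAS, ← mul_assoc, hSS]
  have tr2 : ∀ W W' : Matrix n n R, (A * -(W' * S + S * W') * A * -(W * S + S * W)).trace =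
      2 * (B * W' * B * W).trace + 2 * (s ^ 2 - t) * (A * W' * A * W).trace
        + Y.det * ((A * W' * W).trace + (A * W * W').trace) := by
    intro W W'
    have e0 : A * -(W' * S + S * W') * A * -(W * S + S * W) =
        (A * W' * (S * A) * W) * S + A * W' * (S * A * S) * W + (A * S) * W' * A * W * S
          + (A * S) * W' * (A * S) * W := by noncomm_ring
    have e1 : ((A * W' * (S * A) * W) * S).trace = (B * W' * B * W).trace := by
      rw [Matrix.trace_mul_comm, hB]
      simp only [mul_assoc]
    have e2 : (A * S * W' * A * W * S).trace = (W' * A * W * (S * A * S)).trace := by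
      rw [Matrix.trace_mul_comm, ← mul_assoc, ← mul_assoc, ← mul_assoc, ← mul_assoc,
        Matrix.trace_mul_comm (W' * A * W)]
      simp only [mul_assoc]
    have e3 : (W' * A * W * A).trace = (A * W' * A * W).trace := by
      rw [Matrix.trace_mul_comm]; simp only [mul_assoc]
    have e4 : (W' * A * W).trace = (A * W * W').trace := by
      rw [mul_assoc, Matrix.trace_mul_comm]
    rw [e0, Matrix.trace_add, Matrix.trace_add, Matrix.trace_add, e1, e2, hSAS, ← hBA]
    simp only [mul_add, add_mul, Matrix.trace_add, Matrix.mul_smul, Matrix.smul_mul, mul_one,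
      Matrix.trace_smul, smul_eq_mul, e3, e4]
    ring
  have tr3 : (A * (U * Uᵀ * S + U * V * (Z * Uᵀ) + Z * Uᵀ * (U * V) + S * (U * Uᵀ))).trace =
      2 * (B * (U * Uᵀ)).trace + (A * (U * V) * (Z * Uᵀ)).trace
        + (A * (Z * Uᵀ) * (U * V)).trace := by
    have e1 : (A * (U * Uᵀ * S)).trace = (B * (U * Uᵀ)).trace := by
      rw [← mul_assoc, Matrix.trace_mul_comm, ← mul_assoc, hB]
    rw [mul_add, mul_add, mul_add, Matrix.trace_add, Matrix.trace_add, Matrix.trace_add, e1,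
      ← mul_assoc A S, ← hBA, ← mul_assoc A (U * V), ← mul_assoc A (Z * Uᵀ)]
    ring
  rw [tr1, tr1, tr2, tr3] at h4
  have f1 : (B * (U * V)).trace = (V * B * U).trace := by
    rw [← mul_assoc, Matrix.trace_mul_comm, mul_assoc]
  have f2 : ∀ M : Matrix n n R, (M * (Z * Uᵀ) * M * (U * V)).trace =
      (M * U * (V * M * Z) * Uᵀ).trace := by
    intro M
    have : M * (Z * Uᵀ) * M * (U * V) = (M * Z * Uᵀ) * (M * U * V) := by simp only [mul_assoc]
    rw [this, Matrix.trace_mul_comm]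
    simp only [mul_assoc]
  rw [f1, f2, f2, ← mul_assoc B Z, ← mul_assoc B U] at h4
  rw [mul_one]
  have h44 : (4 : R) ≠ 0 := by norm_num
  refine mul_left_cancel₀ h44 ?_
  linear_combination h4


end SelfDualDuality

/-! ### Agreement of the two generators for self-dual matrices. -/

section SelfDualSum

variable {k R n ι : Type*} [CommRing k] [CommRing R] [Algebra k R] [Fintype n] [Fintype ι]

/-- Invariance under the adjoint `M ↦ τ Mᵀ τᵀ`. -/
def IsSelfDual (τ M : Matrix n n R) : Prop := τ * Mᵀ * τᵀ = M

variable {τ M N : Matrix n n R}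

theorem IsSelfDual.add (hM : IsSelfDual τ M) (hN : IsSelfDual τ N) : IsSelfDual τ (M + N) := by
  rw [IsSelfDual, Matrix.transpose_add, mul_add, add_mul, hM, hN]

theorem IsSelfDual.smul (hM : IsSelfDual τ M) (r : R) : IsSelfDual τ (r • M) := by
  rw [IsSelfDual, Matrix.transpose_smul, Matrix.mul_smul, Matrix.smul_mul, hM]

variable [DecidableEq n]

theorem twist_mul (hτ : τᵀ * τ = 1) (M N : Matrix n n R) :
    τ * (M * N)ᵀ * τᵀ = τ * Nᵀ * τᵀ * (τ * Mᵀ * τᵀ) := by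
  rw [Matrix.transpose_mul]
  calc τ * (Nᵀ * Mᵀ) * τᵀ = τ * Nᵀ * 1 * Mᵀ * τᵀ := by simp only [mul_assoc, one_mul]
    _ = _ := by rw [← hτ]; simp only [mul_assoc]

theorem IsSelfDual.mul_rev (hτ : τᵀ * τ = 1) (hM : IsSelfDual τ M) (hN : IsSelfDual τ N) :
    τ * (M * N)ᵀ * τᵀ = N * M := by
  rw [twist_mul hτ, hM, hN]

theorem IsSelfDual.mul_mul (hτ : τᵀ * τ = 1) (hM : IsSelfDual τ M) (hN : IsSelfDual τ N) :
    IsSelfDual τ (M * N * M) := by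
  rw [IsSelfDual, twist_mul hτ, hM.mul_rev hτ hN, hM, mul_assoc]

variable [IsDomain R]

/-- The adjoint of `M` is conjugate to `M` by `N` whenever `N` and `M N` are self-dual, and this
relation passes to the adjugate. -/
theorem IsSelfDual.adjugate_mul (hτ : τᵀ * τ = 1) (hN : IsSelfDual τ N)
    (hMN : IsSelfDual τ (M * N)) (h0 : M.det ≠ 0) : IsSelfDual τ (M.adjugate * N) := by
  have h1 : M * (τ * (M.adjugate * N)ᵀ * τᵀ) = M.det • N := by
    rw [twist_mul hτ, hN, ← mul_assoc, ← hMN, ← twist_mul hτ, ← mul_assoc, Matrix.adjugate_mul,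
      Matrix.smul_mul, one_mul]
    exact hN.smul _
  refine smul_right_injective _ h0 ?_
  calc M.det • (τ * (M.adjugate * N)ᵀ * τᵀ)
      = M.adjugate * (M * (τ * (M.adjugate * N)ᵀ * τᵀ)) := by
        rw [← mul_assoc, Matrix.adjugate_mul]; simp
    _ = M.det • (M.adjugate * N) := by rw [h1, Matrix.mul_smul]

variable [CharZero R] {Z V X Y : Matrix n n R} {σ : ι → R} {U : ι → Matrix n n R}
  {D D' : ι → Derivation k R R}

/-- Duality for self-dual matrices: the matrix side. -/
theorem IsFlipFrame.sqrt_det_of_selfDual {c : R} (hU : IsFlipFrame σ U c c τ)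
    (h : ∀ e, IsDualPair (D e) (D' e) Z V (U e)) {s t φ : R} (hs : ∀ e, D e s = 0 ∧ D' e s = 0)
    (ht : ∀ e, D e t = 0 ∧ D' e t = 0) (hX : X = Z * V) (hY : Y = X * X + (2 * s) • X + t • 1)
    (h0 : Y.det ≠ 0) (hτ : τᵀ * τ = 1) (hτ' : τᵀ = -τ) (hZ : IsSelfDual τ Z)
    (hV : IsSelfDual τ V) (hφ : φ ^ 2 = Y.det) {A : Matrix n n R} (hA : A = Y.adjugate) :
    Y.det * φ * ∑ e, σ e * D' e (D e φ) =
      c * (2 * Y.det * (A * X).trace - Y.det * s * A.trace + 4 * (s ^ 2 - t) * (A * A * X).trace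
        + s * (A * X).trace ^ 2 + 2 * t * (A.trace * (A * X).trace) + s * t * A.trace ^ 2) := by
  set B := (X + s • 1) * A with hB
  have hAX : A * X = X * A := by rw [hA]; exact adjugate_comm_quadratic hY h0
  have hBA : B = X * A + s • A := by rw [hB, add_mul, Matrix.smul_mul, one_mul]
  have hSS : (X + s • 1) * (X + s • 1) * A = Y.det • 1 + (s ^ 2 - t) • A := by
    rw [hA]; exact square_shift_mul_adjugate hY
  have hAS : A * (X + s • 1) = (X + s • 1) * A := by simp [mul_add, add_mul, hAX]
  have hBB : B * B = Y.det • A + (s ^ 2 - t) • (A * A) := by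
    calc B * B = (X + s • 1) * (A * (X + s • 1)) * A := by rw [hB]; simp only [mul_assoc]
      _ = (X + s • 1) * (X + s • 1) * A * A := by rw [hAS]; simp only [mul_assoc]
      _ = _ := by rw [hSS, add_mul, Matrix.smul_mul, Matrix.smul_mul, one_mul]
  -- self-duality
  have hXZ : IsSelfDual τ (X * Z) := by rw [hX]; exact hZ.mul_mul hτ hV
  have hYZ : IsSelfDual τ (Y * Z) := by
    -- `X = Z V` itself need not be self-dual, but palindromic words such as `Z V Z` and `Z V Z V Z`
    -- are.
    have h1 : IsSelfDual τ (X * X * Z) := by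
      have h2 : X * X * Z = Z * (V * Z * V) * Z := by rw [hX]; simp only [mul_assoc]
      rw [h2]
      exact hZ.mul_mul hτ (hV.mul_mul hτ hZ)
    rw [hY, add_mul, add_mul, Matrix.smul_mul, Matrix.smul_mul, one_mul]
    exact (h1.add (hXZ.smul _)).add (hZ.smul _)
  have hAZ : IsSelfDual τ (A * Z) := by rw [hA]; exact hZ.adjugate_mul hτ hYZ h0
  have hBZ : IsSelfDual τ (B * Z) := by
    have h1 : IsSelfDual τ (X * A * Z) := by
      have h2 : X * A * Z = A * Z * V * Z := by rw [← hAX, hX]; simp only [mul_assoc]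
      rw [IsSelfDual, h2, twist_mul hτ, hAZ.mul_rev hτ hV, hZ, ← h2, hX]
      simp only [mul_assoc]
    rw [hBA, add_mul, Matrix.smul_mul]
    exact h1.add (hAZ.smul _)
  have hn : Y.det * φ * ∑ e, σ e * D' e (D e φ) =
      ∑ e, σ e * ((V * B * U e).trace * (B * Z * (U e)ᵀ).trace)
      - ∑ e, σ e * (B * U e * (V * B * Z) * (U e)ᵀ).trace
      - (s ^ 2 - t) * ∑ e, σ e * (A * U e * (V * A * Z) * (U e)ᵀ).trace
      + Y.det * ∑ e, σ e * (B * U e * 1 * (U e)ᵀ).trace := by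
    rw [Finset.mul_sum, Finset.mul_sum, Finset.mul_sum, ← Finset.sum_sub_distrib,
      ← Finset.sum_sub_distrib, ← Finset.sum_add_distrib]
    refine Finset.sum_congr rfl fun e _ => ?_
    have := (h e).det_mul_map_map_sqrt_det (hs e) (ht e) hX hY h0 (B := B) (by rw [hB, hA]) hφ
    rw [← hA] at this
    linear_combination σ e * this
  rw [hn, hU.sum_trace_mul_trace, hU.sum_trace_mul, hU.sum_trace_mul, hU.sum_trace_mul]
  -- The antisymmetry of `τ` gives the single-trace contractions a sign opposite to the symmetric
  -- case.
  have hflip : ∀ M : Matrix n n R, τ * Mᵀ * τ = -(τ * Mᵀ * τᵀ) := by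
    intro M; rw [hτ', mul_neg, neg_neg]
  have tw : ∀ M : Matrix n n R, IsSelfDual τ (M * Z) → τ * (V * M * Z)ᵀ * τ = -(M * X) := by
    intro M hM
    rw [hflip, mul_assoc V, hV.mul_rev hτ hM, mul_assoc, hX]
  have tw1 : τ * (1 : Matrix n n R)ᵀ * τ = -1 := by
    rw [Matrix.transpose_one, mul_one, ← neg_eq_iff_eq_neg, ← neg_mul, ← hτ', hτ]
  rw [show τ * (B * Z)ᵀ * τᵀ = B * Z from hBZ, tw B hBZ, tw A hAZ, tw1]
  have t1 : (V * B * (B * Z)).trace = (B * B * X).trace := by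
    rw [mul_assoc, Matrix.trace_mul_comm, hX]; simp only [mul_assoc]
  have t2 : ∀ M : Matrix n n R, (V * M * Z).trace = (M * X).trace := by
    intro M
    rw [mul_assoc, Matrix.trace_mul_comm, hX, mul_assoc]
  have t3 : (B * B * X).trace = Y.det * (A * X).trace + (s ^ 2 - t) * (A * A * X).trace := by
    rw [hBB, add_mul, Matrix.smul_mul, Matrix.smul_mul, Matrix.trace_add, Matrix.trace_smul,
      Matrix.trace_smul, smul_eq_mul, smul_eq_mul]
  have t4 : B.trace = (A * X).trace + s * A.trace := by
    rw [hBA, Matrix.trace_add, Matrix.trace_smul, smul_eq_mul, hAX]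
  have t5 : (B * X).trace = Y.det * (1 : Matrix n n R).trace - s * (A * X).trace - t * A.trace := by
    have h1 : B * X = A * Y - s • (A * X) - t • A := by
      rw [hB, mul_assoc, hAX, add_mul, hY]
      simp only [mul_add, Matrix.mul_smul, mul_one, Matrix.smul_mul, one_mul]
      rw [← mul_assoc A, hAX, mul_assoc X A X, hAX]
      module
    rw [h1, hA, Matrix.adjugate_mul, Matrix.trace_sub, Matrix.trace_sub, Matrix.trace_smul,
      Matrix.trace_smul, Matrix.trace_smul, smul_eq_mul, smul_eq_mul, smul_eq_mul]
  rw [t1, t2, t2, t4, t5]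
  simp only [mul_neg, Matrix.trace_neg, mul_one, ← mul_assoc]
  rw [t3, t4]
  ring

/-- Duality for self-dual matrices: the dual side. -/
theorem det_mul_map_map_sqrt_det_scalar {D D' : Derivation k R R} {q q' b d φ : R}
    (h : Y.map D = (2 * q') • (X + d • 1)) (h' : Y.map D' = (2 * q) • (X + d • 1))
    (h'' : (Y.map D).map D' = (2 : R) • (X + d • 1) + (2 * (q * q')) • 1)
    (hY : Y = X * X + (2 * d) • X + (4 * b) • X + (d ^ 2) • 1) (hAX : Y.adjugate * X = X * Y.adjugate)
    (hφ : φ ^ 2 = Y.det) {A : Matrix n n R} (hA : A = Y.adjugate) :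
    Y.det * φ * D' (D φ) = q * q' * ((A * X).trace + d * A.trace) ^ 2
      - 2 * (q * q') * (Y.det * A.trace - 4 * b * (A * A * X).trace)
      + Y.det * ((A * X).trace + d * A.trace + q * q' * A.trace) := by
  have h4 := Derivation.det_mul_map_map_sqrt_det D D' Y φ hφ
  rw [h'', h, h', ← hA] at h4
  rw [← hA] at hAX
  have e1 : (A * (X + d • 1)).trace = (A * X).trace + d * A.trace := by
    rw [mul_add, Matrix.trace_add, Matrix.mul_smul, mul_one, Matrix.trace_smul, smul_eq_mul]
  have e2 : A * (X + d • 1) * A * (X + d • 1) = A * (A * Y) - (4 * b) • (A * A * X) := by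
    have : A * (X + d • 1) = (X + d • 1) * A := by simp [mul_add, add_mul, hAX]
    -- Here `a = q * q'` and `b` play the two squared moduli and `d = a - b`; the linear coefficient
    -- is `2 (a + b) = 2 d + 4 b`.
    have hE : (X + d • 1) * (X + d • 1) = Y - (4 * b) • X := by
      rw [hY]
      simp only [add_mul, mul_add, Matrix.mul_smul, mul_one, Matrix.smul_mul, one_mul]
      module
    calc A * (X + d • 1) * A * (X + d • 1) = A * ((X + d • 1) * A) * (X + d • 1) := by
          simp only [mul_assoc]
      _ = A * A * ((X + d • 1) * (X + d • 1)) := by rw [← this]; simp only [mul_assoc]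
      _ = _ := by rw [hE, mul_sub, Matrix.mul_smul, mul_assoc A A Y]
  rw [hA, Matrix.adjugate_mul, ← hA, Matrix.mul_smul, mul_one] at e2
  have e3 : (A * (X + d • 1) * A * (X + d • 1)).trace =
      Y.det * A.trace - 4 * b * (A * A * X).trace := by
    rw [e2, Matrix.trace_sub, Matrix.trace_smul, Matrix.trace_smul, smul_eq_mul, smul_eq_mul]
  clear h h' h'' e2
  generalize X + d • (1 : Matrix n n R) = F at *
  simp only [Matrix.mul_smul, Matrix.smul_mul, Matrix.trace_smul, smul_eq_mul, mul_add,
    Matrix.trace_add, mul_one, e1, e3] at h4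
  have h44 : (4 : R) ≠ 0 := by norm_num
  refine mul_left_cancel₀ h44 ?_
  linear_combination h4

end SelfDualSum

/-! ### Generic matrices over the polynomial ring. -/

section PolynomialModel

open MvPolynomial

variable {ι κ n : Type*}

/-- Polynomials in matrix entries, dual variables and their formal conjugates. -/
abbrev DualRing (ι κ : Type*) : Type _ := MvPolynomial ((ι ⊕ κ) ⊕ (ι ⊕ κ)) ℂ

/-- The squared modulus `q k * q̄ k` of a dual variable. -/
noncomputable def dualSq (ι : Type*) {κ : Type*} (k : κ) :
    DualRing ι κ :=
  X (.inl (.inr k)) * X (.inr (.inr k))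

theorem pderiv_dualSq_entry (k : κ) (e : ι) :
    pderiv (.inl (.inl e)) (dualSq ι k) = 0 ∧ pderiv (.inr (.inl e)) (dualSq ι k) = 0 := by
  constructor <;> simp [dualSq, pderiv_X_of_ne]

theorem pderiv_dualSq [DecidableEq κ] (k l : κ) :
    pderiv (.inl (.inr l)) (dualSq ι k) = (if k = l then X (.inr (.inr l)) else 0) ∧
    pderiv (.inr (.inr l)) (dualSq ι k) = (if k = l then X (.inl (.inr l)) else 0) := by
  by_cases h : k = l
  · subst h; constructor <;> simp [dualSq, pderiv_X_of_ne]
  · constructor <;> simp [dualSq, pderiv_X_of_ne, h]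

/-- The substitution that sets the matrix variables to zero. -/
noncomputable def killEntries : DualRing ι κ →ₐ[ℂ]
    DualRing ι κ :=
  aeval (Sum.elim (Sum.elim 0 fun k => X (.inl (.inr k)))
    (Sum.elim 0 fun k => X (.inr (.inr k))))

theorem killEntries_dualSq (k : κ) : killEntries (dualSq ι k) = dualSq ι k := by
  simp [killEntries, dualSq]

variable [Fintype ι] [DecidableEq n]

theorem IsFlipFrame.map {R S : Type*} [CommRing R] [CommRing S] {σ : ι → R} {U : ι → Matrix n n R}
    {c₁ c₂ : R} {τ : Matrix n n R} (h : IsFlipFrame σ U c₁ c₂ τ) (f : R →+* S) :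
    IsFlipFrame (fun e => f (σ e)) (fun e => (U e).map f) (f c₁) (f c₂) (τ.map f) := by
  intro i j l k
  have h1 : ∀ i j, (1 : Matrix n n S) i j = f ((1 : Matrix n n R) i j) := by
    intro i j; by_cases hij : i = j <;> simp [Matrix.one_apply, hij]
  simp only [h1, Matrix.map_apply, ← map_mul, ← map_add, ← h i j l k, map_sum]

/-- The generic matrix `z - ∑ e, x e • u e`. -/
noncomputable def polyZ (κ : Type*) (u : ι → Matrix n n ℂ) (z : ℂ) :
    Matrix n n (DualRing ι κ) :=
  (C z : DualRing ι κ) • (1 : Matrix n n (DualRing ι κ)) - ∑ e, (X (.inl (.inl e)) : DualRing ι κ) • (u e).map C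

/-- The generic matrix `v - ∑ e, x̄ e • (u e)ᵀ`. -/
noncomputable def polyV (κ : Type*) (u : ι → Matrix n n ℂ) (v : ℂ) :
    Matrix n n (DualRing ι κ) :=
  (C v : DualRing ι κ) • (1 : Matrix n n (DualRing ι κ)) - ∑ e, (X (.inr (.inl e)) : DualRing ι κ) • ((u e).map C)ᵀ

theorem map_polyZ {S : Type*} [CommRing S] (f : DualRing ι κ →+* S)
    (u : ι → Matrix n n ℂ) (z : ℂ) : (polyZ κ u z).map f =
      f (C z) • 1 - ∑ e, f (X (.inl (.inl e))) • (u e).map (fun a => f (C a)) := by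
  ext i j
  by_cases hij : i = j <;> simp [polyZ, Matrix.sum_apply, hij]

theorem map_polyV {S : Type*} [CommRing S] (f : DualRing ι κ →+* S)
    (u : ι → Matrix n n ℂ) (v : ℂ) : (polyV κ u v).map f =
      f (C v) • 1 - ∑ e, f (X (.inr (.inl e))) • ((u e).map (fun a => f (C a)))ᵀ := by
  ext i j
  by_cases hij : i = j <;> simp [polyV, Matrix.sum_apply, hij]

theorem map_pderiv_polyZ (i : (ι ⊕ κ) ⊕ (ι ⊕ κ)) (u : ι → Matrix n n ℂ) (z : ℂ) :
    (polyZ κ u z).map (pderiv i) =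
      - ∑ e, (pderiv i (X (.inl (.inl e)) : DualRing ι κ)) •
        (u e).map C := by
  ext k l
  by_cases hij : k = l <;>
    simp [polyZ, Matrix.sum_apply, hij, mul_comm]

theorem map_pderiv_polyV (i : (ι ⊕ κ) ⊕ (ι ⊕ κ)) (u : ι → Matrix n n ℂ) (v : ℂ) :
    (polyV κ u v).map (pderiv i) =
      - ∑ e, (pderiv i (X (.inr (.inl e)) : DualRing ι κ)) •
        ((u e).map C)ᵀ := by
  ext k l
  by_cases hij : k = l <;>
    simp [polyV, Matrix.sum_apply, hij, mul_comm]

theorem isDualPair_poly (u : ι → Matrix n n ℂ) (z v : ℂ) (e : ι) :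
    IsDualPair (pderiv (.inl (.inl e))) (pderiv (.inr (.inl e))) (polyZ κ u z) (polyV κ u v)
      ((u e).map C) where
  fst_map := by
    classical
    rw [map_pderiv_polyZ, Finset.sum_eq_single e]
    · simp
    · intro b _ hb
      rw [pderiv_X_of_ne (by simpa using hb), zero_smul]
    · simp
  snd_map := by
    rw [map_pderiv_polyV, Finset.sum_eq_zero, neg_zero]
    intro b _
    rw [pderiv_X_of_ne (by simp), zero_smul]
  fst_map' := by
    rw [map_pderiv_polyZ, Finset.sum_eq_zero, neg_zero]
    intro b _
    rw [pderiv_X_of_ne (by simp), zero_smul]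
  snd_map' := by
    classical
    rw [map_pderiv_polyV, Finset.sum_eq_single e]
    · simp
    · intro b _ hb
      rw [pderiv_X_of_ne (by simpa using hb), zero_smul]
    · simp
  dir_map' := by ext; simp

theorem map_pderiv_polyZ_of_dual (k : κ) (u : ι → Matrix n n ℂ) (z : ℂ) :
    (polyZ κ u z).map (pderiv (.inl (.inr k))) = 0 ∧
    (polyZ κ u z).map (pderiv (.inr (.inr k))) = 0 := by
  constructor <;>
  · rw [map_pderiv_polyZ, Finset.sum_eq_zero, neg_zero]
    intro b _
    rw [pderiv_X_of_ne (by simp), zero_smul]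

theorem map_pderiv_polyV_of_dual (k : κ) (u : ι → Matrix n n ℂ) (v : ℂ) :
    (polyV κ u v).map (pderiv (.inl (.inr k))) = 0 ∧
    (polyV κ u v).map (pderiv (.inr (.inr k))) = 0 := by
  constructor <;>
  · rw [map_pderiv_polyV, Finset.sum_eq_zero, neg_zero]
    intro b _
    rw [pderiv_X_of_ne (by simp), zero_smul]

theorem map_killEntries_polyZ (u : ι → Matrix n n ℂ) (z : ℂ) :
    (polyZ κ u z).map (killEntries : DualRing ι κ →ₐ[ℂ] _) =
      (C z : DualRing ι κ) • (1 : Matrix n n (DualRing ι κ)) := by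
  have := map_polyZ (killEntries : DualRing ι κ →ₐ[ℂ] _).toRingHom u z
  refine this.trans ?_
  simp [killEntries]

theorem map_killEntries_polyV (u : ι → Matrix n n ℂ) (v : ℂ) :
    (polyV κ u v).map (killEntries : DualRing ι κ →ₐ[ℂ] _) =
      (C v : DualRing ι κ) • (1 : Matrix n n (DualRing ι κ)) := by
  have := map_polyV (killEntries : DualRing ι κ →ₐ[ℂ] _).toRingHom u v
  refine this.trans ?_
  simp [killEntries]

variable [Fintype n]

/-- For a real basis, `polyV` evaluates to `v - J†`. It is the transpose of `v - J*`, so the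
determinant is the required one. -/
theorem eval_polyZ_mul_polyV (u : ι → Matrix n n ℂ) (z v : ℂ) (a : ι → ℂ)
    (hu : ∀ e, (u e).map conj = u e) :
    eval (conjPoint κ a) ((polyZ κ u z).det * (polyV κ u v).det) =
      (z • (1 : Matrix n n ℂ) - ∑ e, a e • u e).det *
        (v • (1 : Matrix n n ℂ) - (∑ e, a e • u e).map conj).det := by
  rw [map_mul, RingHom.map_det, RingHom.map_det, RingHom.mapMatrix_apply, RingHom.mapMatrix_apply,
    map_polyZ, map_polyV]
  congr 1
  · simp [conjPoint, Matrix.map_id']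
  · rw [← Matrix.det_transpose]
    congr 1
    have h : ∀ e i j, conj (u e i j) = u e i j := fun e i j => congrFun (congrFun (hu e) i) j
    ext i j
    by_cases hij : i = j
    · subst hij; simp [conjPoint, Matrix.sum_apply, h]
    · simp [conjPoint, Matrix.sum_apply, h, hij, Ne.symm hij]

variable [Fintype κ]

theorem heat_sumElim_left (σ : ι → ℂ) (f : DualRing ι κ) :
    heat (Sum.elim σ 0) f = ∑ e, C (σ e) * pderiv (.inr (.inl e)) (pderiv (.inl (.inl e)) f) := by
  simp [heat]

theorem heat_sumElim_right (τ : κ → ℂ) (f : DualRing ι κ) :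
    heat (Sum.elim 0 τ) f = ∑ k, C (τ k) * pderiv (.inr (.inr k)) (pderiv (.inl (.inr k)) f) := by
  simp [heat]

theorem charPair_eq_wick {E : Type*} [MeasureSpace E] {x : E → ι → ℂ} (hx : HasProductIntegral x)
    (emb : E → Matrix n n ℂ) (u : ι → Matrix n n ℂ) (hu : ∀ e, (u e).map conj = u e)
    (hemb : ∀ a, emb a = ∑ e, x a e • u e) (c : ι → ℝ) (hc : ∀ i, 0 < c i)
    (hw : ∀ a, (emb a * (emb a)ᴴ).trace.re = ∑ i, c i * ‖x a i‖ ^ 2) (z v : ℂ)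
    (φ : DualRing ι κ)
    (hφ : ∀ a : ι → ℂ, eval (conjPoint κ a) φ =
      eval (conjPoint κ a) ((polyZ κ u z).det * (polyV κ u v).det)) :
    charPair emb z v = wick (Sum.elim (fun i => (1 / c i : ℂ)) 0) φ := by
  refine gaussAverage_eq_wick hx κ emb c hc hw _ φ fun a => ?_
  rw [hφ, eval_polyZ_mul_polyV u z v _ hu, hemb]

theorem wick_killEntries (τ : κ → ℂ) (f : DualRing ι κ) :
    wick (Sum.elim 0 τ) (killEntries f) = wick (Sum.elim 0 τ) f := by
  classical
  have h := wick_aeval_zero (Sum.elim 0 τ : ι ⊕ κ → ℂ) (Set.range Sum.inl)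
    (by rintro _ ⟨e, rfl⟩; rfl) f
  have hk : (killEntries : DualRing ι κ →ₐ[ℂ] _) =
      aeval (fun i => if Sum.elim id id i ∈ Set.range Sum.inl then 0 else X i) := by
    apply MvPolynomial.algHom_ext
    rintro ((e | k) | (e | k)) <;> simp [killEntries]
  rw [hk, h]

/-- The Gaussian moments of the squared moduli of the dual variables. -/
theorem wick_prod_dualSq (τ : κ → ℂ) (m : κ → ℕ) (c : ℂ) :
    wick (Sum.elim 0 τ) (C c * ∏ k, dualSq ι k ^ m k) =
      c * ∏ k, ((m k).factorial * τ k ^ m k) := by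
  have h : C c * ∏ k, dualSq ι k ^ m k = monomial (Finsupp.equivFunOnFinite.symm
      (Sum.elim (Sum.elim 0 m) (Sum.elim 0 m) : (ι ⊕ κ) ⊕ (ι ⊕ κ) → ℕ)) c := by
    rw [monomial_eq, Finsupp.prod_fintype _ _ (by simp)]
    simp [dualSq, mul_pow, Finset.prod_mul_distrib]
  rw [h, wick_monomial, wickMoment]
  simp

end PolynomialModel

/-! ### Radial integrals for one and two dual variables. -/

section DualIntegrals

open MvPolynomial

theorem integrableOn_pow_mul_exp_neg (k : ℕ) :
    IntegrableOn (fun s : ℝ => s ^ k * Real.exp (-s)) (Set.Ioi 0) := by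
  have h := Real.GammaIntegral_convergent (s := k + 1) (by positivity)
  refine h.congr_fun (fun s _ => ?_) measurableSet_Ioi
  simp [mul_comm]

theorem integral_pow_mul_exp_neg (k : ℕ) :
    ∫ s in Set.Ioi (0 : ℝ), s ^ k * Real.exp (-s) = k.factorial := by
  rw [← Real.Gamma_nat_eq_factorial, Real.Gamma_eq_integral (by positivity)]
  refine setIntegral_congr_fun measurableSet_Ioi fun s _ => ?_
  simp [mul_comm]

theorem integral_pow_mul_one_sub_pow (k l : ℕ) :
    ∫ v in (0 : ℝ)..1, ((v : ℂ) ^ k * (1 - v) ^ l) =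
      (k.factorial * l.factorial : ℂ) / (k + l + 1).factorial := by
  have h := Complex.Gamma_mul_Gamma_eq_betaIntegral (s := k + 1) (t := l + 1)
    (by simp; positivity) (by simp; positivity)
  have h1 : (k + 1 + (l + 1) : ℂ) = ((k + l + 1 : ℕ) : ℂ) + 1 := by push_cast; ring
  rw [h1, Complex.Gamma_nat_eq_factorial, Complex.Gamma_nat_eq_factorial,
    Complex.Gamma_nat_eq_factorial, Complex.betaIntegral] at h
  rw [h, mul_div_cancel_left₀ _ (by exact_mod_cast (Nat.factorial_pos _).ne')]
  refine intervalIntegral.integral_congr fun v _ => ?_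
  simp

theorem aeval_dualSq_monomial (ι : Type*) {κ : Type*} [Fintype κ] (m : κ →₀ ℕ) (c : ℂ) :
    aeval (dualSq ι) (monomial m c) = C c * ∏ k, dualSq ι k ^ m k := by
  rw [aeval_monomial, Finsupp.prod_fintype _ _ (by simp)]
  rfl

/-- The squared modulus of a standard complex Gaussian variable has moments `m!`, those of the
exponential law. -/
theorem wick_aeval_dualSq_unit (ι : Type*) [Fintype ι] (g : MvPolynomial Unit ℂ) :
    IntegrableOn (fun s : ℝ => (Real.exp (-s) : ℂ) * eval (fun _ => (s : ℂ)) g) (Set.Ioi 0) ∧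
    wick (Sum.elim 0 fun _ => 1) (aeval (dualSq ι) g) =
      ∫ s in Set.Ioi (0 : ℝ), (Real.exp (-s) : ℂ) * eval (fun _ => (s : ℂ)) g := by
  induction g using MvPolynomial.induction_on' with
  | monomial m c =>
    have h : ∀ s : ℝ, (Real.exp (-s) : ℂ) * eval (fun _ => (s : ℂ)) (monomial m c) =
        c * ((s ^ m () * Real.exp (-s) : ℝ) : ℂ) := by
      intro s
      rw [eval_monomial, Finsupp.prod_fintype _ _ (by simp)]
      simp
      ring
    simp only [h]
    refine ⟨(integrableOn_pow_mul_exp_neg _).ofReal.const_mul c, ?_⟩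
    rw [integral_const_mul, integral_complex_ofReal, integral_pow_mul_exp_neg,
      aeval_dualSq_monomial, wick_prod_dualSq]
    simp
  | add p q hp hq =>
    simp only [map_add, mul_add]
    refine ⟨hp.1.add hq.1, ?_⟩
    rw [integral_add hp.1 hq.1, hp.2, hq.2]

/-- Two independent exponential variables of mean `1 / 2` have total `s / 2`, with `s` of density `s
exp (-s)`, and an independent uniform fraction `v`. On monomials this is the Beta integral. -/
theorem wick_aeval_dualSq_fin_two (ι : Type*) [Fintype ι] (g : MvPolynomial (Fin 2) ℂ) :
    IntegrableOn (fun s : ℝ => ((s * Real.exp (-s) : ℝ) : ℂ) *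
      ∫ v in (0 : ℝ)..1, eval ![(s * v / 2 : ℂ), s * (1 - v) / 2] g) (Set.Ioi 0) ∧
    wick (Sum.elim 0 fun _ => 1 / 2) (aeval (dualSq ι) g) =
      ∫ s in Set.Ioi (0 : ℝ), ((s * Real.exp (-s) : ℝ) : ℂ) *
        ∫ v in (0 : ℝ)..1, eval ![(s * v / 2 : ℂ), s * (1 - v) / 2] g := by
  induction g using MvPolynomial.induction_on' with
  | monomial m c =>
    have h : ∀ s : ℝ, ((s * Real.exp (-s) : ℝ) : ℂ) *
        ∫ v in (0 : ℝ)..1, eval ![(s * v / 2 : ℂ), s * (1 - v) / 2] (monomial m c) =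
        (c * (1 / 2) ^ (m 0 + m 1) * ((m 0).factorial * (m 1).factorial /
          (m 0 + m 1 + 1).factorial)) * ((s ^ (m 0 + m 1 + 1) * Real.exp (-s) : ℝ) : ℂ) := by
      intro s
      have h1 : ∀ v : ℝ, eval ![(s * v / 2 : ℂ), s * (1 - v) / 2] (monomial m c) =
          (c * (1 / 2) ^ (m 0 + m 1) * (s : ℂ) ^ (m 0 + m 1)) *
            ((v : ℂ) ^ m 0 * (1 - v) ^ m 1) := by
        intro v
        rw [eval_monomial, Finsupp.prod_fintype _ _ (by simp), Fin.prod_univ_two]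
        simp only [Matrix.cons_val_zero, Matrix.cons_val_one, div_pow, mul_pow, pow_add, one_pow]
        ring
      simp only [h1]
      rw [intervalIntegral.integral_const_mul, integral_pow_mul_one_sub_pow]
      push_cast
      ring
    simp only [h]
    refine ⟨(integrableOn_pow_mul_exp_neg _).ofReal.const_mul _, ?_⟩
    rw [integral_const_mul, integral_complex_ofReal, integral_pow_mul_exp_neg,
      aeval_dualSq_monomial, wick_prod_dualSq, Fin.prod_univ_two, Complex.ofReal_natCast,
      mul_assoc _ _ (((m 0 + m 1 + 1).factorial : ℕ) : ℂ), div_mul_cancel₀]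
    · ring
    · exact_mod_cast (Nat.factorial_pos _).ne'
  | add p q hp hq =>
    have hi : ∀ (s : ℝ) (f : MvPolynomial (Fin 2) ℂ), IntervalIntegrable
        (fun v : ℝ => eval ![(s * v / 2 : ℂ), s * (1 - v) / 2] f) volume 0 1 := by
      intro s f
      refine Continuous.intervalIntegrable ?_ _ _
      refine (MvPolynomial.continuous_eval f).comp (continuous_pi fun i => ?_)
      fin_cases i
      · simp; fun_prop
      · simp; fun_prop
    have hs : ∀ s : ℝ, ∫ v in (0 : ℝ)..1, eval ![(s * v / 2 : ℂ), s * (1 - v) / 2] (p + q) =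
        (∫ v in (0 : ℝ)..1, eval ![(s * v / 2 : ℂ), s * (1 - v) / 2] p) +
        ∫ v in (0 : ℝ)..1, eval ![(s * v / 2 : ℂ), s * (1 - v) / 2] q := by
      intro s
      simp only [map_add]
      exact intervalIntegral.integral_add (hi s p) (hi s q)
    simp only [hs, mul_add]
    refine ⟨hp.1.add hq.1, ?_⟩
    rw [integral_add hp.1 hq.1, ← hp.2, ← hq.2, map_add, map_add]

end DualIntegrals

/-! ### The dual representation for classes A and AI†. -/

section DualSide

open MvPolynomial

variable {ι κ n : Type*} [Fintype ι] [Fintype κ] [Fintype n] [DecidableEq n]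
  {u : ι → Matrix n n ℂ} {z v : ℂ} {c : ℂ}

/-- The squared moduli add up to `ρ`, while each dual variable contributes one further `Y.det * tr
(adj Y)`. -/
theorem heat_dual_det {Y : Matrix n n (DualRing ι κ)} {ρ : DualRing ι κ}
    (hρ : ρ = ∑ k, dualSq ι k) (hY : Y = polyZ κ u z * polyV κ u v + ρ • 1) :
    Y.det * heat (Sum.elim 0 fun _ => c) Y.det =
      C c * (ρ * (Y.adjugate.trace ^ 2 - (Y.adjugate * Y.adjugate).trace)
        + (Fintype.card κ : DualRing ι κ) * (Y.det * Y.adjugate.trace)) := by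
  classical
  have h : ∀ k, Y.det * pderiv (.inr (.inr k)) (pderiv (.inl (.inr k)) Y.det) =
      dualSq ι k * (Y.adjugate.trace ^ 2 - (Y.adjugate * Y.adjugate).trace)
        + Y.det * Y.adjugate.trace := by
    intro k
    have hD : Y.map (pderiv (.inl (.inr k))) = (X (.inr (.inr k)) : DualRing ι κ) • 1 := by
      rw [hY, Matrix.map_derivation_add, Matrix.map_derivation_mul, Matrix.map_derivation_smul,
        Matrix.map_derivation_one, (map_pderiv_polyZ_of_dual k u z).1,
        (map_pderiv_polyV_of_dual k u v).1, hρ, map_sum]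
      simp [pderiv_dualSq]
    have hD' : Y.map (pderiv (.inr (.inr k))) = (X (.inl (.inr k)) : DualRing ι κ) • 1 := by
      rw [hY, Matrix.map_derivation_add, Matrix.map_derivation_mul, Matrix.map_derivation_smul,
        Matrix.map_derivation_one, (map_pderiv_polyZ_of_dual k u z).2,
        (map_pderiv_polyV_of_dual k u v).2, hρ, map_sum]
      simp [pderiv_dualSq]
    exact det_mul_map_map_det_scalar _ _ hD hD' (by simp)
  rw [heat_sumElim_right, ← Finset.mul_sum, mul_left_comm, Finset.mul_sum]
  simp only [h]
  rw [Finset.sum_add_distrib, ← Finset.sum_mul, ← hρ]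
  simp

theorem killEntries_det {Y : Matrix n n (DualRing ι κ)} {ρ : DualRing ι κ}
    (hρ : ρ = ∑ k, dualSq ι k) (hY : Y = polyZ κ u z * polyV κ u v + ρ • 1) :
    killEntries Y.det = (C (z * v) + ρ) ^ Fintype.card n := by
  have h1 : killEntries ρ = ρ := by rw [hρ, map_sum]; simp only [killEntries_dualSq]
  have h2 : Y.map (killEntries : DualRing ι κ →ₐ[ℂ] _) =
      (C (z * v) + ρ) • (1 : Matrix n n (DualRing ι κ)) := by
    have h3 : Y.map (killEntries : DualRing ι κ →ₐ[ℂ] _) =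
        (polyZ κ u z).map (killEntries : DualRing ι κ →ₐ[ℂ] _) *
        (polyV κ u v).map (killEntries : DualRing ι κ →ₐ[ℂ] _) +
        (killEntries ρ) • (1 : Matrix n n (DualRing ι κ)) := by
      rw [hY]
      ext i j
      by_cases hij : i = j <;> simp [Matrix.mul_apply, hij]
    rw [h3, map_killEntries_polyZ, map_killEntries_polyV, h1, add_smul, map_mul]
    simp [smul_smul, mul_comm]
  have h4 : killEntries Y.det = (Y.map (killEntries : DualRing ι κ →ₐ[ℂ] _)).det :=
    AlgHom.map_det killEntries Y
  rw [h4, h2, Matrix.det_smul, Matrix.det_one, mul_one]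

theorem det_ne_zero_of_dual [Nonempty κ] {Y : Matrix n n (DualRing ι κ)} {ρ : DualRing ι κ}
    (hρ : ρ = ∑ k, dualSq ι k) (hY : Y = polyZ κ u z * polyV κ u v + ρ • 1) : Y.det ≠ 0 := by
  classical
  intro h0
  have h := killEntries_det hρ hY
  rw [h0, map_zero] at h
  obtain ⟨k⟩ := ‹Nonempty κ›
  -- A dual variable and its formal conjugate are independent, so their product may take the value
  -- `1 - z v`; at zero entries `Y` is then the identity.
  have h1 := congrArg (eval (Sum.elim (Sum.elim 0 (Pi.single k (1 - z * v)))
    (Sum.elim 0 (Pi.single k 1)))) h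
  rw [map_zero, map_pow, map_add, eval_C, hρ, map_sum, Finset.sum_eq_single k] at h1
  · simp [dualSq] at h1
  · intro l _ hl; simp [dualSq, hl]
  · simp

/-- The dual integral representation, from the equality of the two generators. -/
theorem wick_det_eq [Nonempty κ] {σ : ι → ℂ} {Y : Matrix n n (DualRing ι κ)} {ρ : DualRing ι κ}
    (hρ : ρ = ∑ k, dualSq ι k) (hY : Y = polyZ κ u z * polyV κ u v + ρ • 1)
    (h : Y.det * ∑ e, C (σ e) * pderiv (.inr (.inl e)) (pderiv (.inl (.inl e)) Y.det) =
      C c * (ρ * (Y.adjugate.trace ^ 2 - (Y.adjugate * Y.adjugate).trace)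
        + (Fintype.card κ : DualRing ι κ) * (Y.det * Y.adjugate.trace))) :
    wick (Sum.elim σ 0) Y.det = wick (Sum.elim 0 fun _ => c)
      (aeval (dualSq ι) ((C (z * v) + ∑ k, X k) ^ Fintype.card n : MvPolynomial κ ℂ)) := by
  have h1 : heat (Sum.elim σ 0) Y.det = heat (Sum.elim 0 fun _ => c) Y.det := by
    refine mul_left_cancel₀ (det_ne_zero_of_dual hρ hY) ?_
    rw [heat_dual_det hρ hY, ← h, heat_sumElim_left]
  rw [wick_eq_of_heat_eq _ _ _ h1, ← wick_killEntries, killEntries_det hρ hY]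
  congr 1
  simp [hρ, algebraMap_eq]

theorem eval_conjPoint_det {Y : Matrix n n (DualRing ι κ)} {ρ : DualRing ι κ}
    (hρ : ρ = ∑ k, dualSq ι k) (hY : Y = polyZ κ u z * polyV κ u v + ρ • 1) (a : ι → ℂ) :
    eval (conjPoint κ a) Y.det =
      eval (conjPoint κ a) ((polyZ κ u z).det * (polyV κ u v).det) := by
  have h1 : eval (conjPoint κ a) ρ = 0 := by
    rw [hρ, map_sum]; simp [dualSq, conjPoint]
  rw [← Matrix.det_mul, RingHom.map_det, RingHom.map_det]
  congr 1
  rw [hY]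
  ext i j
  by_cases hij : i = j <;> simp [h1]

end DualSide

/-! ### Ingredients for the quadratic determinant of class AII†. -/

section SelfDualModel

open MvPolynomial

/-- The substitution that sets the dual variables to zero. -/
noncomputable def killDual {ι κ : Type*} : DualRing ι κ →ₐ[ℂ] DualRing ι κ :=
  aeval (Sum.elim (Sum.elim (fun e => X (.inl (.inl e))) 0)
    (Sum.elim (fun e => X (.inr (.inl e))) 0))

theorem killDual_dualSq {ι κ : Type*} (k : κ) : killDual (dualSq ι k) = 0 := by
  simp [killDual, dualSq]

theorem eval_conjPoint_killDual {ι κ : Type*} (a : ι → ℂ) (f : DualRing ι κ) :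
    eval (conjPoint κ a) (killDual f) = eval (conjPoint κ a) f := by
  have h : (aeval (conjPoint κ a)).comp (killDual : DualRing ι κ →ₐ[ℂ] _) =
      (aeval (conjPoint κ a) : DualRing ι κ →ₐ[ℂ] ℂ) := by
    apply MvPolynomial.algHom_ext
    rintro ((e | k) | (e | k)) <;> simp [killDual, conjPoint]
  exact DFunLike.congr_fun h f

theorem IsSelfDual.transpose_mul_eq_neg {R n : Type*} [CommRing R] [Fintype n] [DecidableEq n]
    {τ M : Matrix n n R} (hM : IsSelfDual τ M) (hτ : τᵀ * τ = 1) (hτ' : τᵀ = -τ) :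
    (M * τ)ᵀ = -(M * τ) := by
  have h : M * τ = τ * Mᵀ := by
    conv_lhs => rw [← hM]
    rw [mul_assoc, hτ, mul_one]
  rw [Matrix.transpose_mul, h, hτ', neg_mul]

/-- A flip frame whose twist is orthogonal spans the identity matrix. -/
theorem IsFlipFrame.exists_sum_smul_eq_one {ι n : Type*} [Fintype ι] [Fintype n] [DecidableEq n]
    {σ : ι → ℂ} {u : ι → Matrix n n ℂ} {c : ℂ} {τ : Matrix n n ℂ} (hU : IsFlipFrame σ u c c τ)
    (hc : c ≠ 0) (hτ : τ * τᵀ = 1) : ∃ a : ι → ℂ, ∑ e, a e • u e = 1 := by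
  refine ⟨fun e => (2 * c)⁻¹ * (σ e * (u e).trace), ?_⟩
  ext i j
  -- Tracing the second factor turns both terms of the relation into the identity, which explains
  -- the factor `2 c`.
  have h := Finset.sum_congr rfl fun k (_ : k ∈ Finset.univ) => hU i j k k
  rw [Finset.sum_comm] at h
  have hττ : ∑ k, τ i k * τ j k = (1 : Matrix n n ℂ) i j := by
    rw [← hτ, Matrix.mul_apply]; rfl
  have h1 : ∑ k, (1 : Matrix n n ℂ) i k * (1 : Matrix n n ℂ) j k = (1 : Matrix n n ℂ) i j := by
    simp [Matrix.one_apply]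
  rw [Finset.sum_add_distrib, ← Finset.mul_sum, ← Finset.mul_sum, hττ, h1] at h
  have h2 : (∑ e, ((2 * c)⁻¹ * (σ e * (u e).trace)) • u e) i j =
      (2 * c)⁻¹ * ∑ e, ∑ k, σ e * (u e i j * u e k k) := by
    rw [Matrix.sum_apply, Finset.mul_sum]
    refine Finset.sum_congr rfl fun e _ => ?_
    rw [Matrix.smul_apply, ← Finset.mul_sum, ← Finset.mul_sum, smul_eq_mul, Matrix.trace]
    simp only [Matrix.diag_apply]
    ring
  rw [h2, h]
  field_simp
  ring

variable {ι n : Type*} [Fintype ι] [Fintype n] [DecidableEq n]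
  {u : ι → Matrix n n ℂ} {z v : ℂ} {c : ℂ}

/-- With `a` and `b` the moduli squared of the variables `k` and `l`, the derivative of `2 (a + b) P
+ (a - b)²` in `a` is `2 (P + a - b)`. The statement is used for both orders of the two variables.
-/
theorem map_pderiv_quadratic {k l : Fin 2} (hkl : k ≠ l) {P Y : Matrix n n (DualRing ι (Fin 2))}
    (hP : P = polyZ (Fin 2) u z * polyV (Fin 2) u v)
    (hY : Y = P * P + (2 * (dualSq ι k + dualSq ι l)) • P
      + ((dualSq ι k - dualSq ι l) ^ 2) • 1) :
    Y.map (pderiv (.inl (.inr k))) =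
      (2 * X (.inr (.inr k)) : DualRing ι (Fin 2)) • (P + (dualSq ι k - dualSq ι l) • 1) ∧
    Y.map (pderiv (.inr (.inr k))) =
      (2 * X (.inl (.inr k)) : DualRing ι (Fin 2)) • (P + (dualSq ι k - dualSq ι l) • 1) ∧
    (Y.map (pderiv (.inl (.inr k)))).map (pderiv (.inr (.inr k))) =
      (2 : DualRing ι (Fin 2)) • (P + (dualSq ι k - dualSq ι l) • 1) +
        (2 * (X (.inl (.inr k)) * X (.inr (.inr k))) : DualRing ι (Fin 2)) • 1 := by
  have hP0 : P.map (pderiv (.inl (.inr k))) = 0 ∧ P.map (pderiv (.inr (.inr k))) = 0 := by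
    rw [hP, Matrix.map_derivation_mul, Matrix.map_derivation_mul,
      (map_pderiv_polyZ_of_dual k u z).1, (map_pderiv_polyV_of_dual k u v).1,
      (map_pderiv_polyZ_of_dual k u z).2, (map_pderiv_polyV_of_dual k u v).2]
    simp
  have e1 := (pderiv_dualSq (ι := ι) k k).1
  have e2 := (pderiv_dualSq (ι := ι) k k).2
  have e3 := (pderiv_dualSq (ι := ι) l k).1
  have e4 := (pderiv_dualSq (ι := ι) l k).2
  simp only [if_true, if_neg hkl.symm] at e1 e2 e3 e4
  have d2 : ∀ i, pderiv i (2 : DualRing ι (Fin 2)) = 0 := fun i => by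
    simpa using (pderiv (R := ℂ) i).map_natCast 2
  have hD : Y.map (pderiv (.inl (.inr k))) =
      (2 * X (.inr (.inr k)) : DualRing ι (Fin 2)) • (P + (dualSq ι k - dualSq ι l) • 1) := by
    rw [hY]
    simp only [Matrix.map_derivation_add, Matrix.map_derivation_mul, Matrix.map_derivation_smul,
      Matrix.map_derivation_one, hP0.1, Derivation.leibniz, Derivation.leibniz_pow, map_add,
      map_sub, e1, e3, d2, smul_eq_mul]
    simp only [smul_add, smul_smul, zero_mul, mul_zero, smul_zero, zero_add, add_zero, sub_zero]
    congr 2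
    ring
  have hD' : Y.map (pderiv (.inr (.inr k))) =
      (2 * X (.inl (.inr k)) : DualRing ι (Fin 2)) • (P + (dualSq ι k - dualSq ι l) • 1) := by
    rw [hY]
    simp only [Matrix.map_derivation_add, Matrix.map_derivation_mul, Matrix.map_derivation_smul,
      Matrix.map_derivation_one, hP0.2, Derivation.leibniz, Derivation.leibniz_pow, map_add,
      map_sub, e2, e4, d2, smul_eq_mul]
    simp only [smul_add, smul_smul, zero_mul, mul_zero, smul_zero, zero_add, add_zero, sub_zero]
    congr 2
    ring
  refine ⟨hD, hD', ?_⟩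
  rw [hD]
  simp only [Matrix.map_derivation_add, Matrix.map_derivation_smul,
    Matrix.map_derivation_one, hP0.2, Derivation.leibniz, map_sub, e2, e4, d2, smul_eq_mul,
    pderiv_X_self]
  simp only [smul_add, smul_smul, mul_zero, smul_zero, zero_add, add_zero, sub_zero, mul_one]
  rw [add_comm, mul_assoc, mul_comm (X (Sum.inr (Sum.inr k)))]

end SelfDualModel

/-! ### The dual representation for class AII†. -/

section SelfDualDet

open MvPolynomial

section

variable {R n : Type*} [CommRing R] [Fintype n] {τ M : Matrix n n R}

theorem IsSelfDual.sub {N : Matrix n n R} (hM : IsSelfDual τ M) (hN : IsSelfDual τ N) :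
    IsSelfDual τ (M - N) := by
  rw [IsSelfDual, Matrix.transpose_sub, mul_sub, sub_mul, hM, hN]

theorem IsSelfDual.sum {ι : Type*} [Fintype ι] {u : ι → Matrix n n R}
    (h : ∀ e, IsSelfDual τ (u e)) : IsSelfDual τ (∑ e, u e) := by
  rw [IsSelfDual, Matrix.transpose_sum, Finset.mul_sum, Finset.sum_mul]
  exact Finset.sum_congr rfl fun e _ => h e

theorem IsSelfDual.one [DecidableEq n] (hτ : τ * τᵀ = 1) : IsSelfDual τ (1 : Matrix n n R) := by
  rw [IsSelfDual, Matrix.transpose_one, mul_one, hτ]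

theorem IsSelfDual.transpose [DecidableEq n] (hτ' : τᵀ = -τ) (hM : IsSelfDual τ M) : IsSelfDual τ Mᵀ := by
  have h := congrArg Matrix.transpose hM
  rw [Matrix.transpose_mul, Matrix.transpose_mul, Matrix.transpose_transpose,
    Matrix.transpose_transpose, hτ'] at h
  rw [IsSelfDual, Matrix.transpose_transpose, hτ', ← h]
  simp [mul_assoc]

theorem IsSelfDual.map {S : Type*} [CommRing S] (f : R →+* S) (hM : IsSelfDual τ M) :
    IsSelfDual (τ.map f) (M.map f) := by
  rw [IsSelfDual, ← Matrix.transpose_map, ← Matrix.transpose_map, ← Matrix.map_mul, ← Matrix.map_mul, hM]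

end

variable {ι n : Type*} [Fintype ι] [Fintype n] [DecidableEq n]
  {u : ι → Matrix n n ℂ} {z v : ℂ} {c : ℂ}

theorem isSelfDual_polyZ {κ : Type*} {τ : Matrix n n ℂ} (hτ : τ * τᵀ = 1) 
    (hu : ∀ e, IsSelfDual τ (u e)) : IsSelfDual (τ.map C) (polyZ κ u z) := by
  refine ((IsSelfDual.one ?_).smul _).sub (IsSelfDual.sum fun e => ((hu e).map C).smul _)
  rw [← Matrix.transpose_map, ← Matrix.map_mul, hτ]
  exact Matrix.map_one _ (map_zero _) (map_one _)

theorem isSelfDual_polyV {κ : Type*} {τ : Matrix n n ℂ} (hτ : τ * τᵀ = 1) (hτ' : τᵀ = -τ)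
    (hu : ∀ e, IsSelfDual τ (u e)) : IsSelfDual (τ.map C) (polyV κ u v) := by
  refine ((IsSelfDual.one ?_).smul _).sub (IsSelfDual.sum fun e => IsSelfDual.smul ?_ _)
  · rw [← Matrix.transpose_map, ← Matrix.map_mul, hτ]
    exact Matrix.map_one _ (map_zero _) (map_one _)
  · rw [← Matrix.transpose_map]
    exact ((hu e).transpose hτ').map C

/-- Adding the contributions of the two dual variables symmetrizes in `a` and `b`, so only `s = a +
b` and `t = (a - b)²` survive. -/
theorem heat_dual_sqrt_det {P Y : Matrix n n (DualRing ι (Fin 2))}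
    (hP : P = polyZ (Fin 2) u z * polyV (Fin 2) u v) {s t φ : DualRing ι (Fin 2)}
    (hs : s = dualSq ι 0 + dualSq ι 1) (ht : t = (dualSq ι 0 - dualSq ι 1) ^ 2)
    (hY : Y = P * P + (2 * s) • P + t • 1) (h0 : Y.det ≠ 0) (hφ : φ ^ 2 = Y.det)
    {A : Matrix n n (DualRing ι (Fin 2))} (hA : A = Y.adjugate) :
    Y.det * φ * heat (Sum.elim 0 fun _ => c) φ =
      C c * (2 * Y.det * (A * P).trace - Y.det * s * A.trace + 4 * (s ^ 2 - t) * (A * A * P).trace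
        + s * (A * P).trace ^ 2 + 2 * t * (A.trace * (A * P).trace) + s * t * A.trace ^ 2) := by
  have hAP : Y.adjugate * P = P * Y.adjugate := adjugate_comm_quadratic hY h0
  have h : ∀ k l : Fin 2, k ≠ l → s = dualSq ι k + dualSq ι l → t = (dualSq ι k - dualSq ι l) ^ 2 →
      Y.det * φ * pderiv (.inr (.inr k)) (pderiv (.inl (.inr k)) φ) =
      dualSq ι k * ((A * P).trace + (dualSq ι k - dualSq ι l) * A.trace) ^ 2
      - 2 * dualSq ι k * (Y.det * A.trace - 4 * dualSq ι l * (A * A * P).trace)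
      + Y.det * ((A * P).trace + (dualSq ι k - dualSq ι l) * A.trace + dualSq ι k * A.trace) := by
    intro k l hkl hs ht
    rw [hs, ht] at hY
    obtain ⟨h1, h2, h3⟩ := map_pderiv_quadratic hkl hP hY
    refine det_mul_map_map_sqrt_det_scalar h1 h2 h3 ?_ hAP hφ hA
    rw [hY]
    module
  rw [heat_sumElim_right, Fin.sum_univ_two, ← mul_add, mul_left_comm, mul_add (Y.det * φ),
    h 0 1 (by simp) hs ht, h 1 0 (by simp) (by rw [hs, add_comm]) (by rw [ht]; ring), hs, ht]
  ring

/-- The dual representation of the self-dual ensemble, up to a sign. -/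
theorem exists_sqrt_det_wick_eq {σ : ι → ℂ} {τ : Matrix n n ℂ} (hU : IsFlipFrame σ u c c τ)
    (hc : c ≠ 0) (hτ : τᵀ * τ = 1) (hτ' : τᵀ = -τ) (hu : ∀ e, IsSelfDual τ (u e)) {N : ℕ}
    (hN : Fintype.card n = 2 * N) (z v : ℂ) :
    ∃ (φ : DualRing ι (Fin 2)) (ε : ℂ), (ε = 1 ∨ ε = -1) ∧ (z * v ≠ 0 → ε = 1) ∧
      (∀ a, eval (conjPoint (Fin 2) a) φ =
        eval (conjPoint (Fin 2) a) ((polyZ (Fin 2) u z).det * (polyV (Fin 2) u v).det)) ∧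
      wick (Sum.elim σ 0) φ = ε * wick (Sum.elim 0 fun _ => c) (aeval (dualSq ι)
        ((C ((z * v) ^ 2) + C (2 * (z * v)) * (X 0 + X 1) + (X 0 - X 1) ^ 2) ^ N :
          MvPolynomial (Fin 2) ℂ)) := by
  have hττ : τ * τᵀ = 1 := by rw [hτ', mul_neg, ← neg_mul, ← hτ', hτ]
  set Z := polyZ (Fin 2) u z with hZ
  set V := polyV (Fin 2) u v with hV
  set s : DualRing ι (Fin 2) := dualSq ι 0 + dualSq ι 1 with hs
  set t : DualRing ι (Fin 2) := (dualSq ι 0 - dualSq ι 1) ^ 2 with ht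
  obtain ⟨P, hP⟩ : ∃ P, P = Z * V := ⟨_, rfl⟩
  obtain ⟨Y, hY⟩ : ∃ Y, Y = P * P + (2 * s) • P + t • 1 := ⟨_, rfl⟩
  set T : Matrix n n (DualRing ι (Fin 2)) := τ.map C with hT
  have hT1 : Tᵀ * T = 1 := by
    rw [hT, ← Matrix.transpose_map, ← Matrix.map_mul, hτ]; exact Matrix.map_one _ (map_zero _) (map_one _)
  have hT2 : Tᵀ = -T := by
    rw [hT, ← Matrix.transpose_map, hτ']; ext; simp
  have hZs : IsSelfDual T Z := isSelfDual_polyZ hττ hu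
  have hVs : IsSelfDual T V := isSelfDual_polyV hττ hτ' hu
  have hPZ : IsSelfDual T (P * Z) := by rw [hP]; exact hZs.mul_mul hT1 hVs
  have hYZ : IsSelfDual T (Y * Z) := by
    have hPPZ : IsSelfDual T (P * P * Z) := by
      have : P * P * Z = Z * (V * Z * V) * Z := by rw [hP]; simp only [mul_assoc]
      rw [this]
      exact hZs.mul_mul hT1 (hVs.mul_mul hT1 hZs)
    rw [hY, add_mul, add_mul, Matrix.smul_mul, Matrix.smul_mul, one_mul]
    exact (hPPZ.add (hPZ.smul _)).add (hZs.smul _)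
  -- nondegeneracy
  have hkY : killEntries Y.det =
      (C (z * v) ^ 2 + C (2 * (z * v)) * s + t : DualRing ι (Fin 2)) ^ (2 * N) := by
    have hk2 : killEntries (2 : DualRing ι (Fin 2)) = 2 := map_ofNat _ 2
    have hks : killEntries s = s := by rw [hs, map_add, killEntries_dualSq, killEntries_dualSq]
    have hkt : killEntries t = t := by
      rw [ht, map_pow, map_sub, killEntries_dualSq, killEntries_dualSq]
    have hkP : P.map (killEntries : DualRing ι (Fin 2) →ₐ[ℂ] _) =
        (C (z * v) : DualRing ι (Fin 2)) • 1 := by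
      rw [hP, Matrix.map_mul, hZ, hV, map_killEntries_polyZ, map_killEntries_polyV]
      simp [smul_smul, mul_comm]
    have h1 : killEntries Y.det = (Y.map (killEntries : DualRing ι (Fin 2) →ₐ[ℂ] _)).det :=
      AlgHom.map_det killEntries Y
    have h2 : Y.map (killEntries : DualRing ι (Fin 2) →ₐ[ℂ] _) =
        P.map (killEntries : DualRing ι (Fin 2) →ₐ[ℂ] _) *
          P.map (killEntries : DualRing ι (Fin 2) →ₐ[ℂ] _) +
        (2 * killEntries s) • P.map (killEntries : DualRing ι (Fin 2) →ₐ[ℂ] _) +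
        killEntries t • 1 := by
      rw [hY]
      ext i j
      by_cases hij : i = j <;> simp [Matrix.mul_apply, hij, hk2]
    have h3 : Y.map (killEntries : DualRing ι (Fin 2) →ₐ[ℂ] _) =
        (C (z * v) ^ 2 + C (2 * (z * v)) * s + t : DualRing ι (Fin 2)) • 1 := by
      rw [h2, hks, hkt, hkP, add_smul, add_smul, Matrix.smul_mul, one_mul, smul_smul, smul_smul,
        pow_two, map_mul C 2, mul_right_comm, map_ofNat]
    rw [h1, h3, Matrix.det_smul, Matrix.det_one, mul_one, hN]
  have h0 : Y.det ≠ 0 := by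
    intro h0
    rw [h0, map_zero] at hkY
    -- With `a = 1 - z v` and `b = 0` the quadratic expression is `(z v + a)² = 1`.
    have h1 := congrArg (eval (Sum.elim (Sum.elim 0 ![1 - z * v, 0])
      (Sum.elim 0 ![1, 0]))) hkY
    simp [hs, ht, dualSq] at h1
    have h2 : (z * v) ^ 2 + 2 * (z * v) * (1 - z * v) + (1 - z * v) ^ 2 = 1 := by ring
    rw [h2] at h1
    simp at h1
  have hZ0 : (Z * T).det ≠ 0 := by
    have hTd : T.det ≠ 0 := by
      intro h
      have := congrArg Matrix.det hT1
      rw [Matrix.det_mul, h, mul_zero, Matrix.det_one] at this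
      exact zero_ne_one this
    rw [Matrix.det_mul]
    refine mul_ne_zero (fun h => ?_) hTd
    obtain ⟨a, ha⟩ := hU.exists_sum_smul_eq_one hc hττ
    -- The identity lies in the span of the basis, so the entries can be chosen to make `Z` the
    -- identity.
    have h1 := congrArg (eval (conjPoint (Fin 2) fun e => (z - 1) * a e)) h
    rw [map_zero, RingHom.map_det, RingHom.mapMatrix_apply, hZ, map_polyZ] at h1
    have h2 : ∑ e, ((z - 1) * a e) • u e = (z - 1) • 1 := by
      rw [← ha, Finset.smul_sum]; simp only [mul_smul]
    simp [conjPoint, Matrix.map_id', h2, ← sub_smul] at h1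
  -- the square root
  obtain ⟨φ₀, hφ₀⟩ := Matrix.exists_sq_eq_det Y (Z * T) (hZs.transpose_mul_eq_neg hT1 hT2)
    (by rw [← mul_assoc]; exact hYZ.transpose_mul_eq_neg hT1 hT2) hZ0
  have hkd : ∀ φ : DualRing ι (Fin 2), φ ^ 2 = Y.det →
      killDual φ ^ 2 = killDual (Z.det * V.det) ^ 2 := by
    intro φ hφ
    rw [← map_pow, ← map_pow, hφ, ← Matrix.det_mul, ← hP, ← Matrix.det_pow]
    have h1 : ∀ M : Matrix n n (DualRing ι (Fin 2)), killDual M.det =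
      (M.map (killDual : DualRing ι (Fin 2) →ₐ[ℂ] _)).det := AlgHom.map_det killDual
    rw [h1, h1]
    congr 1
    have hks : killDual s = 0 := by rw [hs, map_add, killDual_dualSq, killDual_dualSq, add_zero]
    have hkt : killDual t = 0 := by
      rw [ht, map_pow, map_sub, killDual_dualSq, killDual_dualSq]; simp
    rw [hY, pow_two]
    ext i j
    by_cases hij : i = j <;> simp [Matrix.mul_apply, hij, hks, hkt]
  -- At zero dual variables `Y = P²`, hence the root is `± det Z * det V`; the plus sign is imposed
  -- here.
  obtain ⟨φ, hφ, hφk⟩ : ∃ φ, φ ^ 2 = Y.det ∧ killDual φ = killDual (Z.det * V.det) := by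
    rcases sq_eq_sq_iff_eq_or_eq_neg.1 (hkd φ₀ hφ₀) with h | h
    · exact ⟨φ₀, hφ₀, h⟩
    · exact ⟨-φ₀, by rw [neg_sq, hφ₀], by rw [map_neg, h, neg_neg]⟩
  have hφe : ∀ a, eval (conjPoint (Fin 2) a) φ = eval (conjPoint (Fin 2) a) (Z.det * V.det) := by
    intro a
    rw [← eval_conjPoint_killDual, hφk, eval_conjPoint_killDual]
  have hheat : heat (Sum.elim σ 0) φ = heat (Sum.elim 0 fun _ => c) φ := by
    have hφ0 : φ ≠ 0 := by
      rintro rfl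
      exact h0 (by rw [← hφ]; simp)
    refine mul_left_cancel₀ (mul_ne_zero h0 hφ0) ?_
    rw [heat_dual_sqrt_det hP hs ht hY h0 hφ rfl, heat_sumElim_left]
    refine IsFlipFrame.sqrt_det_of_selfDual (hU.map C) (isDualPair_poly u z v) ?_ ?_ hP hY h0
      hT1 hT2 hZs hVs hφ rfl
    · intro e
      rw [hs]
      simp [pderiv_dualSq_entry]
    · intro e
      rw [ht]
      simp [pderiv_dualSq_entry, Derivation.leibniz_pow]
  have hG : killEntries φ ^ 2 =
      ((C (z * v) ^ 2 + C (2 * (z * v)) * s + t : DualRing ι (Fin 2)) ^ N) ^ 2 := by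
    rw [← map_pow, hφ, hkY, ← pow_mul, mul_comm 2 N]
  -- The root is now fixed, so its restriction to zero entries carries a sign of its own.
  obtain ⟨ε, hε, hεφ⟩ : ∃ ε : ℂ, (ε = 1 ∨ ε = -1) ∧ killEntries φ =
      C ε * (C (z * v) ^ 2 + C (2 * (z * v)) * s + t : DualRing ι (Fin 2)) ^ N := by
    rcases sq_eq_sq_iff_eq_or_eq_neg.1 hG with h | h
    · exact ⟨1, .inl rfl, by rw [h]; simp⟩
    · exact ⟨-1, .inr rfl, by rw [h]; simp⟩
  refine ⟨φ, ε, hε, fun hzv => ?_, hφe, ?_⟩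
  · have h1 : eval (conjPoint (Fin 2) 0) (killEntries φ) = eval (conjPoint (Fin 2) 0) φ := by
      have h : (aeval (conjPoint (Fin 2) 0)).comp (killEntries : DualRing ι (Fin 2) →ₐ[ℂ] _) =
          (aeval (conjPoint (Fin 2) 0) : DualRing ι (Fin 2) →ₐ[ℂ] ℂ) := by
        apply MvPolynomial.algHom_ext
        rintro ((e | k) | (e | k)) <;> simp [killEntries, conjPoint]
      exact DFunLike.congr_fun h φ
    rw [hφe, ← Matrix.det_mul, hεφ, RingHom.map_det, RingHom.mapMatrix_apply, Matrix.map_mul, hZ,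
      hV, map_polyZ, map_polyV] at h1
    simp [conjPoint, hs, ht, dualSq, hN, ← mul_pow, ← pow_mul] at h1
    have h2 : (z * v) ^ (2 * N) ≠ 0 := pow_ne_zero _ hzv
    rw [mul_comm v z] at h1
    exact mul_right_cancel₀ h2 (by rw [h1, one_mul])
  · rw [wick_eq_of_heat_eq _ _ _ hheat, ← wick_killEntries, hεφ, ← smul_eq_C_mul, map_smul,
      smul_eq_mul]
    congr 2
    simp [hs, ht, algebraMap_eq]

end SelfDualDet

/-! ### The dual integrals in classes A and AI†. -/

section Ensembles

open MvPolynomial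

theorem trace_mul_conjTranspose_re {n : Type*} [Fintype n] (J : Matrix n n ℂ) :
    (J * Jᴴ).trace.re = ∑ i, ∑ j, ‖J i j‖ ^ 2 := by
  simp only [Matrix.trace, Matrix.diag_apply, Matrix.mul_apply, Matrix.conjTranspose_apply,
    Complex.re_sum]
  refine Finset.sum_congr rfl fun i _ => Finset.sum_congr rfl fun j _ => ?_
  rw [RCLike.star_def, Complex.mul_conj, Complex.ofReal_re, Complex.normSq_eq_norm_sq]

/-- The dual integral in class A. -/
theorem charPair_ginibreMatrix (N : ℕ) (z v : ℂ) :
    charPair (ginibreMatrix N) z v =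
      ∫ s in Set.Ioi (0 : ℝ), (Real.exp (-s) : ℂ) * (z * v + s) ^ N := by
  let u : Fin N × Fin N → Matrix (Fin N) (Fin N) ℂ := fun p => Matrix.single p.1 p.2 1
  let ρ : DualRing (Fin N × Fin N) Unit := ∑ k, dualSq _ k
  let Y := polyZ Unit u z * polyV Unit u v + ρ • 1
  have h := charPair_eq_wick (κ := Unit) (hasProductIntegral_curry (Fin N) (Fin N)) (ginibreMatrix N) u
    (fun e => by ext; simp [u, Matrix.single_apply, apply_ite conj])
    (fun a => by
      ext i j
      simp [ginibreMatrix, u, Matrix.sum_apply, Matrix.single_apply, Fintype.sum_prod_type,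
        ite_and])
    (fun _ => 1) (fun _ => one_pos)
    (fun a => by
      simp [trace_mul_conjTranspose_re, ginibreMatrix, Fintype.sum_prod_type]) z v
    Y.det (eval_conjPoint_det rfl rfl)
  have hU : IsFlipFrame (fun _ => 1 : Fin N × Fin N → ℂ) u 1 0 0 := by
    intro i j l k
    simp only [u, Matrix.single_apply, Fintype.sum_prod_type, ite_and, Matrix.one_apply]
    by_cases h1 : i = l <;> by_cases h2 : j = k <;> simp [h1, h2, eq_comm]
  have h2 := wick_det_eq (c := 1) (σ := fun _ => 1) (Y := Y) (ρ := ρ) rfl rfl (by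
    have := IsFlipFrame.det_duality (by simpa using hU.map (C : ℂ →+* DualRing (Fin N × Fin N) Unit))
      (isDualPair_poly (κ := Unit) u z v) (ρ := ρ)
      (fun e => by simp [ρ, pderiv_dualSq_entry]) (Y := Y) rfl
    simpa using this)
  simp only [Complex.ofReal_one, div_one] at h
  rw [h, h2, (wick_aeval_dualSq_unit _ _).2]
  simp

section Symmetric

variable {N : ℕ}

/-- The position on or above the diagonal of a matrix entry up to transposition. -/
def sortPair (i j : Fin N) : {p : Fin N × Fin N // p.1 ≤ p.2} :=
  if h : i ≤ j then ⟨(i, j), h⟩ else ⟨(j, i), (lt_of_not_ge h).le⟩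

theorem symmetricMatrix_apply (a : {p : Fin N × Fin N // p.1 ≤ p.2} → ℂ) (i j : Fin N) :
    symmetricMatrix N a i j = a (sortPair i j) := by
  simp only [symmetricMatrix, Matrix.of_apply, sortPair]
  split_ifs <;> rfl

theorem sortPair_eq_iff (i j : Fin N) (p : {p : Fin N × Fin N // p.1 ≤ p.2}) :
    sortPair i j = p ↔ (i, j) = p.1 ∨ (i, j) = (p.1.2, p.1.1) := by
  obtain ⟨⟨a, b⟩, h⟩ := p
  simp only at h
  simp only [sortPair]
  split_ifs with h' <;> simp only [Subtype.mk.injEq, Prod.mk.injEq] <;> omega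

theorem sortPair_eq_sortPair_iff (i j l k : Fin N) :
    sortPair l k = sortPair i j ↔ (i = l ∧ j = k) ∨ (i = k ∧ j = l) := by
  rw [sortPair_eq_iff]
  simp only [sortPair]
  split_ifs with h' <;> simp only [Prod.mk.injEq] <;> omega

theorem sortPair_fst_eq_snd_iff (i j : Fin N) :
    (sortPair i j).1.1 = (sortPair i j).1.2 ↔ i = j := by
  simp only [sortPair]
  split_ifs with h'
  · rfl
  · exact eq_comm

/-- The number of entries of a symmetric matrix sharing a position. -/
noncomputable def symmetricMultiplicity (p : {p : Fin N × Fin N // p.1 ≤ p.2}) : ℝ :=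
  if p.1.1 = p.1.2 then 1 else 2

/-- Off-diagonal entries occur twice in `Tr (J J†)`, which halves their variance relative to the
diagonal. -/
theorem sum_sortPair (f : {p : Fin N × Fin N // p.1 ≤ p.2} → ℝ) :
    ∑ i, ∑ j, f (sortPair i j) = ∑ p, symmetricMultiplicity p * f p := by
  have h : ∀ q : Fin N × Fin N, f (sortPair q.1 q.2) =
      ∑ p, if sortPair q.1 q.2 = p then f p else 0 := by simp
  rw [← Fintype.sum_prod_type' (f := fun i j => f (sortPair i j))]
  simp only [h]
  rw [Finset.sum_comm]
  refine Finset.sum_congr rfl fun p _ => ?_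
  rw [← Finset.sum_filter, Finset.sum_const, nsmul_eq_mul]
  congr 1
  have h2 : Finset.univ.filter (fun q : Fin N × Fin N => sortPair q.1 q.2 = p) =
      {p.1, (p.1.2, p.1.1)} := by
    ext q
    simp [sortPair_eq_iff]
  rw [h2, symmetricMultiplicity]
  split_ifs with hp
  · have : p.1 = (p.1.2, p.1.1) := Prod.ext hp hp.symm
    rw [← this]; simp
  · rw [Finset.card_pair]
    · simp
    · intro h3
      exact hp (congrArg Prod.fst h3)

/-- The dual integral in class AI-dagger. -/
theorem charPair_symmetricMatrix (N : ℕ) (z v : ℂ) :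
    charPair (symmetricMatrix N) z v =
      ∫ s in Set.Ioi (0 : ℝ), ((s * Real.exp (-s) : ℝ) : ℂ) * (z * v + s / 2) ^ N := by
  let ι := {p : Fin N × Fin N // p.1 ≤ p.2}
  let u : ι → Matrix (Fin N) (Fin N) ℂ := fun p => Matrix.of fun i j =>
    if sortPair i j = p then 1 else 0
  let ρ : DualRing ι (Fin 2) := ∑ k, dualSq _ k
  let Y := polyZ (Fin 2) u z * polyV (Fin 2) u v + ρ • 1
  have hpos : ∀ p : ι, 0 < symmetricMultiplicity p := by
    intro p; rw [symmetricMultiplicity]; split_ifs <;> norm_num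
  have h := charPair_eq_wick (κ := Fin 2) (hasProductIntegral_pi ι) (symmetricMatrix N) u
    (fun e => by ext; simp [u, apply_ite conj])
    (fun a => by ext i j; simp [symmetricMatrix_apply, u, Matrix.sum_apply])
    symmetricMultiplicity hpos
    (fun a => by
      simp only [trace_mul_conjTranspose_re, symmetricMatrix_apply]
      exact sum_sortPair fun p => ‖a p‖ ^ 2) z v
    Y.det (eval_conjPoint_det rfl rfl)
  have hus : ∀ e, (u e)ᵀ = u e := by
    intro e
    ext i j
    have : sortPair j i = sortPair i j := (sortPair_eq_sortPair_iff _ _ _ _).2 (.inr ⟨rfl, rfl⟩)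
    simp [u, this]
  -- For `i ≠ j` one of the two terms equals the variance `1 / 2`; on the diagonal both contribute
  -- and give the variance `1`.
  have hU : IsFlipFrame (fun p : ι => (1 / symmetricMultiplicity p : ℂ)) u (1 / 2) (1 / 2) 1 := by
    intro i j l k
    rw [Finset.sum_eq_single (sortPair i j)]
    · simp only [u, Matrix.of_apply, if_true, symmetricMultiplicity, sortPair_fst_eq_snd_iff,
        sortPair_eq_sortPair_iff, Matrix.one_apply]
      by_cases h1 : i = j
      · subst h1
        by_cases h2 : i = l <;> by_cases h3 : i = k <;> simp [h2, h3] <;>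
          split_ifs <;> norm_num
      · by_cases h2 : i = l <;> by_cases h3 : j = k <;> by_cases h4 : i = k <;>
          by_cases h5 : j = l <;> simp_all
    · intro p _ hp
      simp [u, hp.symm]
    · simp
  have hT : ∀ (f : ι → DualRing ι (Fin 2)) (r : DualRing ι (Fin 2)),
      (r • (1 : Matrix (Fin N) (Fin N) (DualRing ι (Fin 2))) - ∑ e, f e • (u e).map C)ᵀ =
        r • 1 - ∑ e, f e • (u e).map C := by
    intro f r
    rw [Matrix.transpose_sub, Matrix.transpose_smul, Matrix.transpose_one, Matrix.transpose_sum]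
    simp only [Matrix.transpose_smul, ← Matrix.transpose_map, hus]
  have hZ : (polyZ (Fin 2) u z)ᵀ = polyZ (Fin 2) u z := hT _ _
  have hV : (polyV (Fin 2) u v)ᵀ = polyV (Fin 2) u v := by
    simp only [polyV, ← Matrix.transpose_map, hus]
    exact hT _ _
  have h2 := wick_det_eq (c := 1 / 2) (σ := fun p : ι => (1 / symmetricMultiplicity p : ℂ))
    (Y := Y) (ρ := ρ) rfl rfl (by
    have hU' := hU.map (C : ℂ →+* DualRing ι (Fin 2))
    have h1 : (1 : Matrix (Fin N) (Fin N) ℂ).map (C : ℂ →+* DualRing ι (Fin 2)) = 1 :=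
      Matrix.map_one _ (map_zero _) (map_one _)
    rw [h1] at hU'
    have := hU'.det_duality_of_symm
      (isDualPair_poly (κ := Fin 2) u z v) (ρ := ρ)
      (fun e => by simp [ρ, pderiv_dualSq_entry]) (Y := Y) rfl hZ hV
      (det_ne_zero_of_dual (κ := Fin 2) (u := u) (z := z) (v := v) rfl rfl)
    simpa using this)
  rw [h, h2, (wick_aeval_dualSq_fin_two _ _).2]
  refine setIntegral_congr_fun measurableSet_Ioi fun s _ => ?_
  congr 1
  -- Only the sum of the two squared moduli enters, so the uniform fraction integrates out.
  have : ∀ t : ℝ, eval ![(s * t / 2 : ℂ), s * (1 - t) / 2]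
      ((C (z * v) + ∑ k, X k) ^ Fintype.card (Fin N)) = (z * v + s / 2) ^ N := by
    intro t
    simp only [map_pow, map_add, eval_C, Fin.sum_univ_two, eval_X, Matrix.cons_val_zero,
      Matrix.cons_val_one, Fintype.card_fin]
    congr 1
    ring
  simp only [this]
  simp

end Symmetric

end Ensembles

/-! ### The dual integral in class AII†. -/

section SelfDualEnsemble

open MvPolynomial

variable {N : ℕ}

/-- The elementary antisymmetric matrix at a position above the diagonal. -/
def antisymmetricSingle (p : {p : Fin N × Fin N // p.1 < p.2}) : Matrix (Fin N) (Fin N) ℂ :=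
  Matrix.single p.1.1 p.1.2 1 - Matrix.single p.1.2 p.1.1 1

theorem sum_mul_antisymmetricSingle (b : {p : Fin N × Fin N // p.1 < p.2} → ℂ) (i j : Fin N) :
    ∑ p, b p * antisymmetricSingle p i j = antisymmetricMatrix N b i j := by
  simp only [antisymmetricMatrix, Matrix.of_apply]
  have h0 : ∀ p : {p : Fin N × Fin N // p.1 < p.2}, antisymmetricSingle p i j =
      (if p.1.1 = i ∧ p.1.2 = j then 1 else 0) - (if p.1.1 = j ∧ p.1.2 = i then 1 else 0) := by
    intro p
    simp only [antisymmetricSingle, Matrix.sub_apply, Matrix.single_apply, and_comm]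
  split_ifs with h h'
  · rw [Finset.sum_eq_single ⟨(i, j), h⟩]
    · rw [h0]; simp [h.ne]
    · rintro ⟨⟨k, l⟩, hkl⟩ _ hp
      have h1 : ¬(k = i ∧ l = j) := fun h1 => hp (by simp [h1])
      have h2 : ¬(k = j ∧ l = i) := by simp only at hkl; omega
      rw [h0]; simp [h1, h2]
    · simp
  · rw [Finset.sum_eq_single ⟨(j, i), h'⟩]
    · rw [h0]; simp [h'.ne]
    · rintro ⟨⟨k, l⟩, hkl⟩ _ hp
      have h1 : ¬(k = j ∧ l = i) := fun h1 => hp (by simp [h1])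
      have h2 : ¬(k = i ∧ l = j) := by simp only at hkl; omega
      rw [h0]; simp [h1, h2]
    · simp
  · refine Finset.sum_eq_zero fun ⟨⟨k, l⟩, hkl⟩ _ => ?_
    have h1 : ¬(k = j ∧ l = i) := by simp only at hkl; omega
    have h2 : ¬(k = i ∧ l = j) := by simp only at hkl; omega
    rw [h0]; simp [h1, h2]

theorem sum_antisymmetricSingle_mul (i j l k : Fin N) :
    ∑ p, antisymmetricSingle p i j * antisymmetricSingle p l k =
      (1 : Matrix (Fin N) (Fin N) ℂ) i l * (1 : Matrix (Fin N) (Fin N) ℂ) j k -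
      (1 : Matrix (Fin N) (Fin N) ℂ) i k * (1 : Matrix (Fin N) (Fin N) ℂ) j l := by
  simp only [mul_comm (antisymmetricSingle _ i j)]
  have h0 : ∀ (p : {p : Fin N × Fin N // p.1 < p.2}) (i j : Fin N), antisymmetricSingle p i j =
      (if p.1.1 = i ∧ p.1.2 = j then 1 else 0) - (if p.1.1 = j ∧ p.1.2 = i then 1 else 0) := by
    intro p i j
    simp only [antisymmetricSingle, Matrix.sub_apply, Matrix.single_apply, and_comm]
  rw [sum_mul_antisymmetricSingle (fun p => antisymmetricSingle p l k)]
  simp only [antisymmetricMatrix, Matrix.of_apply, h0, Matrix.one_apply]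
  split_ifs <;> first | (exfalso; omega) | norm_num

theorem sum_norm_antisymmetricMatrix (b : {p : Fin N × Fin N // p.1 < p.2} → ℂ) :
    ∑ i, ∑ j, ‖antisymmetricMatrix N b i j‖ ^ 2 = 2 * ∑ p, ‖b p‖ ^ 2 := by
  have h : ∀ i j, ‖antisymmetricMatrix N b i j‖ ^ 2 =
      ∑ p, ((if p.1.1 = i ∧ p.1.2 = j then ‖b p‖ ^ 2 else 0) +
        (if p.1.1 = j ∧ p.1.2 = i then ‖b p‖ ^ 2 else 0)) := by
    intro i j
    simp only [antisymmetricMatrix, Matrix.of_apply]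
    split_ifs with h h'
    · rw [Finset.sum_eq_single ⟨(i, j), h⟩]
      · simp [h.ne]
      · rintro ⟨⟨k, l⟩, hkl⟩ _ hp
        have h1 : ¬(k = i ∧ l = j) := fun h1 => hp (by simp [h1])
        have h2 : ¬(k = j ∧ l = i) := by simp only at hkl; omega
        simp [h1, h2]
      · simp
    · rw [Finset.sum_eq_single ⟨(j, i), h'⟩]
      · simp [h'.ne]
      · rintro ⟨⟨k, l⟩, hkl⟩ _ hp
        have h1 : ¬(k = j ∧ l = i) := fun h1 => hp (by simp [h1])
        have h2 : ¬(k = i ∧ l = j) := by simp only at hkl; omega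
        simp [h1, h2]
      · simp
    · rw [Finset.sum_eq_zero]
      · simp
      rintro ⟨⟨k, l⟩, hkl⟩ _
      have h1 : ¬(k = j ∧ l = i) := by simp only at hkl; omega
      have h2 : ¬(k = i ∧ l = j) := by simp only at hkl; omega
      simp [h1, h2]
  simp only [h]
  rw [← Fintype.sum_prod_type' (f := fun i j => ∑ p : {p : Fin N × Fin N // p.1 < p.2},
    ((if p.1.1 = i ∧ p.1.2 = j then ‖b p‖ ^ 2 else 0) +
        (if p.1.1 = j ∧ p.1.2 = i then ‖b p‖ ^ 2 else 0))), Finset.sum_comm, Finset.mul_sum]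
  refine Finset.sum_congr rfl fun p _ => ?_
  have hab : ∀ (a b : Fin N) (r : ℝ), ∑ i, ∑ j, (if a = i ∧ b = j then r else 0) = r := by
    intro a b r
    rw [Finset.sum_eq_single a (fun i _ hi => by simp [hi.symm]) (by simp),
      Finset.sum_eq_single b (fun i _ hi => by simp [hi.symm]) (by simp)]
    simp
  rw [Fintype.sum_prod_type]
  simp only [Finset.sum_add_distrib, hab]
  rw [Finset.sum_comm, hab, two_mul]

/-- The indices of the independent entries of a self-dual matrix. -/
abbrev SelfDualIndex (N : ℕ) : Type :=
  (Fin N × Fin N) ⊕ {p : Fin N × Fin N // p.1 < p.2} ⊕ {p : Fin N × Fin N // p.1 < p.2}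

/-- The elementary self-dual matrices. -/
def selfDualSingle : SelfDualIndex N → Matrix (Fin N ⊕ Fin N) (Fin N ⊕ Fin N) ℂ :=
  Sum.elim (fun p => Matrix.fromBlocks (Matrix.single p.1 p.2 1) 0 0 (Matrix.single p.1 p.2 1)ᵀ)
    (Sum.elim (fun p => Matrix.fromBlocks 0 (antisymmetricSingle p) 0 0)
      (fun p => Matrix.fromBlocks 0 0 (antisymmetricSingle p) 0))

/-- The standard symplectic matrix. -/
def symplecticForm (N : ℕ) : Matrix (Fin N ⊕ Fin N) (Fin N ⊕ Fin N) ℂ :=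
  Matrix.fromBlocks 0 1 (-1) 0

theorem selfDualMatrix_eq_sum (a : (Fin N → Fin N → ℂ) ×
    ({p : Fin N × Fin N // p.1 < p.2} → ℂ) × ({p : Fin N × Fin N // p.1 < p.2} → ℂ)) :
    selfDualMatrix N a = ∑ e, Sum.elim (fun p : Fin N × Fin N => a.1 p.1 p.2)
      (Sum.elim a.2.1 a.2.2) e • selfDualSingle e := by
  ext i j
  rw [Matrix.sum_apply, Fintype.sum_sum_type, Fintype.sum_sum_type]
  rcases i with i | i <;> rcases j with j | j <;>
    simp [selfDualMatrix, selfDualSingle, sum_mul_antisymmetricSingle, Fintype.sum_prod_type,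
      Matrix.single_apply, ite_and]

theorem isSelfDual_selfDualSingle (e : SelfDualIndex N) :
    IsSelfDual (symplecticForm N) (selfDualSingle e) := by
  have h : ∀ p : {p : Fin N × Fin N // p.1 < p.2},
      (antisymmetricSingle p)ᵀ = -antisymmetricSingle p := by
    intro p
    rw [antisymmetricSingle, Matrix.transpose_sub, Matrix.transpose_single,
      Matrix.transpose_single, neg_sub]
  rcases e with p | p | p <;>
    simp [IsSelfDual, symplecticForm, selfDualSingle, Matrix.fromBlocks_transpose,
      Matrix.fromBlocks_multiply, h]

theorem isFlipFrame_selfDualSingle : IsFlipFrame (fun _ => 1 / 2 : SelfDualIndex N → ℂ)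
    selfDualSingle (1 / 2) (1 / 2) (symplecticForm N) := by
  intro i j l k
  rw [← Finset.mul_sum, Fintype.sum_sum_type, Fintype.sum_sum_type]
  have hs : ∀ i j l k : Fin N, ∑ x : Fin N × Fin N, (Matrix.single x.1 x.2 (1 : ℂ) i j *
      Matrix.single x.1 x.2 (1 : ℂ) l k) =
      (1 : Matrix (Fin N) (Fin N) ℂ) i l * (1 : Matrix (Fin N) (Fin N) ℂ) j k := by
    intro i j l k
    simp only [Matrix.single_apply, Fintype.sum_prod_type, ite_and, Matrix.one_apply]
    by_cases h1 : i = l <;> by_cases h2 : j = k <;> simp [h1, h2, eq_comm]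
  have ht : ∀ (x : Fin N × Fin N) (i j : Fin N),
      Matrix.single x.2 x.1 (1 : ℂ) i j = Matrix.single x.1 x.2 (1 : ℂ) j i := by
    intro x i j
    simp [Matrix.single_apply, and_comm]
  rcases i with i | i <;> rcases j with j | j <;> rcases l with l | l <;> rcases k with k | k <;>
    simp [selfDualSingle, symplecticForm, hs, ht, sum_antisymmetricSingle_mul, Matrix.one_apply] <;>
    split_ifs <;> norm_num

/-- Every independent entry occurs exactly twice: in `A` and `Aᵀ`, or with both signs in an
antisymmetric block. All variances are therefore `1 / 2`. -/
theorem trace_selfDualMatrix (a : (Fin N → Fin N → ℂ) ×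
    ({p : Fin N × Fin N // p.1 < p.2} → ℂ) × ({p : Fin N × Fin N // p.1 < p.2} → ℂ)) :
    (selfDualMatrix N a * (selfDualMatrix N a)ᴴ).trace.re =
      ∑ e, 2 * ‖Sum.elim (fun p : Fin N × Fin N => a.1 p.1 p.2)
      (Sum.elim a.2.1 a.2.2) e‖ ^ 2 := by
  rw [trace_mul_conjTranspose_re, ← Finset.mul_sum]
  simp only [Fintype.sum_sum_type, selfDualMatrix, Matrix.fromBlocks_apply₁₁,
    Matrix.fromBlocks_apply₁₂, Matrix.fromBlocks_apply₂₁, Matrix.fromBlocks_apply₂₂,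
    Finset.sum_add_distrib, sum_norm_antisymmetricMatrix, Sum.elim_inl, Sum.elim_inr,
    Fintype.sum_prod_type, Matrix.transpose_apply, Matrix.of_apply]
  rw [Finset.sum_comm (f := fun i j => ‖a.1 j i‖ ^ 2)]
  ring

/-- At `z = v = 0` the observable is `|det J|²`. This fixes the sign that the algebraic argument
leaves open there. -/
theorem charPair_zero_nonneg {n E : Type*} [Fintype n] [DecidableEq n] [MeasureSpace E]
    (emb : E → Matrix n n ℂ) : ∃ r : ℝ, 0 ≤ r ∧ charPair emb 0 0 = r := by
  refine ⟨(∫ e, ‖(emb e).det‖ ^ 2 * gaussWeight (emb e)) / ∫ e, gaussWeight (emb e), ?_, ?_⟩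
  · have hg : ∀ J : Matrix n n ℂ, 0 ≤ gaussWeight J := fun J => (Real.exp_pos _).le
    exact div_nonneg (integral_nonneg fun e => mul_nonneg (by positivity) (hg _))
      (integral_nonneg fun e => hg _)
  · rw [charPair, gaussAverage, Complex.ofReal_div, ← integral_complex_ofReal,
      ← integral_complex_ofReal]
    congr 1
    refine integral_congr_ae (.of_forall fun e => ?_)
    simp only
    have h : ((emb e).map conj).det = conj (emb e).det :=
      (RingHom.map_det (starRingEnd ℂ) (emb e)).symm
    rw [zero_smul, zero_sub, zero_sub, Matrix.det_neg, Matrix.det_neg, h, Complex.ofReal_mul]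
    have h2 : (-1 : ℂ) ^ Fintype.card n * (-1) ^ Fintype.card n = 1 := by
      rw [← mul_pow]; simp
    have h3 := Complex.mul_conj (emb e).det
    rw [Complex.normSq_eq_norm_sq] at h3
    rw [← h3]
    linear_combination ((emb e).det * conj (emb e).det * gaussWeight (emb e)) * h2

/-- The dual integral in class AII-dagger, up to the sign of a square root. -/
theorem exists_charPair_selfDualMatrix (N : ℕ) (z v : ℂ) :
    ∃ ε : ℂ, (ε = 1 ∨ ε = -1) ∧ (z * v ≠ 0 → ε = 1) ∧ charPair (selfDualMatrix N) z v =
      ε * ∫ s in Set.Ioi (0 : ℝ), ((s * Real.exp (-s) : ℝ) : ℂ) * ∫ w in (0 : ℝ)..1,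
        ((z * v) ^ 2 + z * v * s + (s * (2 * w - 1) / 2) ^ 2) ^ N := by
  have hτ : (symplecticForm N)ᵀ * symplecticForm N = 1 := by
    simp [symplecticForm, Matrix.fromBlocks_transpose, Matrix.fromBlocks_multiply]
  have hτ' : (symplecticForm N)ᵀ = -symplecticForm N := by
    simp [symplecticForm, Matrix.fromBlocks_transpose, Matrix.fromBlocks_neg]
  obtain ⟨φ, ε, hε, hε', hφ, hw⟩ := exists_sqrt_det_wick_eq isFlipFrame_selfDualSingle
    (by norm_num) hτ hτ' isSelfDual_selfDualSingle (N := N) (by simp; ring) z v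
  refine ⟨ε, hε, hε', ?_⟩
  have h := charPair_eq_wick (κ := Fin 2) ((hasProductIntegral_curry (Fin N) (Fin N)).prod
    ((hasProductIntegral_pi _).prod (hasProductIntegral_pi _))) (selfDualMatrix N) selfDualSingle
    (fun e => by
      rcases e with p | p | p <;> ext (i | i) (j | j) <;>
        simp [selfDualSingle, antisymmetricSingle, Matrix.single_apply, apply_ite conj])
    selfDualMatrix_eq_sum (fun _ => 2) (fun _ => two_pos) trace_selfDualMatrix z v φ hφ
  simp only [Complex.ofReal_ofNat] at h
  rw [h, hw, (wick_aeval_dualSq_fin_two _ _).2]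
  congr 1
  refine setIntegral_congr_fun measurableSet_Ioi fun s _ => ?_
  congr 1
  refine intervalIntegral.integral_congr fun t _ => ?_
  simp only [map_pow, map_add, map_sub, map_mul, eval_C, eval_X, Matrix.cons_val_zero,
    Matrix.cons_val_one]
  congr 1
  ring

end SelfDualEnsemble

/-! ### Pointwise limit and uniform bound of the rescaled integrand. -/

section EdgeScaling

/-- A quantitative form of `(1 + w) exp (-w) ≤ 1` that decays linearly in `√n w`. -/
theorem norm_one_add_mul_exp_pow_le {w : ℂ} {n : ℕ} (hn : 1 ≤ n) (hw : -1 / 2 ≤ w.re) {B : ℝ}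
    (hb : n * w.im ^ 2 ≤ B) :
    ‖((1 + w) * Complex.exp (-w)) ^ n‖ ≤ Real.exp (1 / 2 + B - Real.sqrt n * w.re / 2) := by
  have hn' : (1 : ℝ) ≤ n := by exact_mod_cast hn
  set r := Real.sqrt n with hr
  have hrr : r * r = n := Real.mul_self_sqrt (by positivity)
  have hr1 : 1 ≤ r := Real.one_le_sqrt.2 hn'
  -- Since `2 (1 + re w) ≥ 1`, adding `(im w)²` to the real part compensates the imaginary part in
  -- the norm of `1 + w`.
  set a := w.re + w.im ^ 2 with ha
  have ha0 : -1 / 2 ≤ a := by nlinarith [sq_nonneg w.im]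
  have h1 : ‖1 + w‖ ≤ 1 + a := by
    refine abs_le_of_sq_le_sq' ?_ (by linarith) |>.2
    rw [← Complex.normSq_eq_norm_sq, Complex.normSq_apply]
    simp only [Complex.add_re, Complex.one_re, Complex.add_im, Complex.one_im, zero_add, ha]
    nlinarith [sq_nonneg w.im, mul_nonneg (sq_nonneg w.im) (by linarith : 0 ≤ 1 + 2 * w.re)]
  -- Giving up a fraction `δ` of the exponent costs `2 n δ² = 1 / 2` in total and gains the decay `n
  -- δ a = √n a / 2`.
  set δ := 1 / (2 * r) with hδ
  have hδ0 : 0 < δ := by positivity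
  have hδ1 : δ ≤ 1 / 2 := by
    rw [hδ, div_le_div_iff₀ (by positivity) (by norm_num)]; linarith
  have h2 : 1 + a ≤ Real.exp ((1 - δ) * a + 2 * δ ^ 2) := by
    have e1 := Real.add_one_le_exp ((1 - δ) * (1 + a) - 1)
    have e2 := Real.add_one_le_exp (δ + 2 * δ ^ 2)
    have e3 : (1 - δ) * (1 + a) ≤ Real.exp ((1 - δ) * (1 + a) - 1) := by linarith
    have e4 : 1 ≤ (1 - δ) * Real.exp (δ + 2 * δ ^ 2) := by
      have : 1 ≤ (1 - δ) * (δ + 2 * δ ^ 2 + 1) := by nlinarith [sq_nonneg δ]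
      exact this.trans (mul_le_mul_of_nonneg_left e2 (by linarith))
    calc 1 + a ≤ (1 + a) * ((1 - δ) * Real.exp (δ + 2 * δ ^ 2)) :=
          le_mul_of_one_le_right (by linarith) e4
      _ = ((1 - δ) * (1 + a)) * Real.exp (δ + 2 * δ ^ 2) := by ring
      _ ≤ Real.exp ((1 - δ) * (1 + a) - 1) * Real.exp (δ + 2 * δ ^ 2) :=
          mul_le_mul_of_nonneg_right e3 (Real.exp_pos _).le
      _ = _ := by rw [← Real.exp_add]; congr 1; ring
  have h3 : ‖(1 + w) * Complex.exp (-w)‖ ≤ Real.exp ((1 - δ) * a + 2 * δ ^ 2 - w.re) := by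
    rw [norm_mul, Complex.norm_exp, Complex.neg_re, sub_eq_add_neg _ w.re, Real.exp_add]
    exact mul_le_mul_of_nonneg_right (h1.trans h2) (Real.exp_pos _).le
  rw [norm_pow]
  refine (pow_le_pow_left₀ (norm_nonneg _) h3 n).trans ?_
  rw [← Real.exp_nat_mul]
  refine Real.exp_le_exp.2 ?_
  have h4 : (n : ℝ) * δ = r / 2 := by rw [← hrr, hδ]; field_simp
  have h5 : (n : ℝ) * δ ^ 2 = 1 / 4 := by rw [← hrr, hδ]; field_simp; norm_num
  have h6 : (n : ℝ) * ((1 - δ) * a + 2 * δ ^ 2 - w.re) =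
      n * w.im ^ 2 - (n * δ) * a + 2 * (n * δ ^ 2) := by rw [ha]; ring
  rw [h6, h4, h5, ha]
  nlinarith [mul_nonneg (zero_le_one.trans hr1) (sq_nonneg w.im)]

/-- Subtracting a part of the square of the positive real direction does not increase the norm. -/
theorem norm_sq_sub_mul_le {x : ℂ} {r k : ℝ} (hx : |x.im| ≤ x.re) (hr : 0 ≤ r) (hk : 0 ≤ k)
    (hk' : k ≤ 1) : ‖(x + r) ^ 2 - (r ^ 2 * k : ℝ)‖ ≤ ‖(x + r) ^ 2‖ := by
  have hxi : x.im ^ 2 ≤ x.re ^ 2 := sq_le_sq' (by linarith [neg_abs_le x.im])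
    ((le_abs_self _).trans hx)
  have hx0 : 0 ≤ x.re := (abs_nonneg _).trans hx
  refine abs_le_of_sq_le_sq' ?_ (norm_nonneg _) |>.2
  rw [← Complex.normSq_eq_norm_sq, ← Complex.normSq_eq_norm_sq, Complex.normSq_apply,
    Complex.normSq_apply]
  simp only [pow_two, Complex.sub_re, Complex.sub_im, Complex.mul_re, Complex.mul_im,
    Complex.add_re, Complex.add_im, Complex.ofReal_re, Complex.ofReal_im, add_zero, sub_zero]
  have hrk : 0 ≤ r * r * k := by positivity
  have h : r * r * k ≤ 2 * ((x.re + r) * (x.re + r) - x.im * x.im) := by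
    nlinarith [mul_nonneg hx0 hr, mul_le_of_le_one_right (mul_nonneg hr hr) hk']
  nlinarith [mul_le_mul_of_nonneg_left h hrk]

theorem one_add_mul_exp_neg_isLittleO :
    (fun w : ℂ => (1 + w) * Complex.exp (-w) - 1 + w ^ 2 / 2) =o[𝓝 0] fun w => w ^ 2 := by
  have h1 : (fun w : ℂ => Complex.exp (-w) - (1 - w + w ^ 2 / 2)) =o[𝓝 0] fun w => w ^ 2 := by
    have h := (Complex.exp_sub_sum_range_succ_isLittleO_pow 2).comp_tendsto
      (k := fun w : ℂ => -w) (l' := 𝓝 0) (by simpa using (continuous_neg (G := ℂ)).tendsto 0)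
    refine (h.congr (fun w => ?_) fun w => ?_)
    · simp [Finset.sum_range_succ, Nat.factorial]; ring
    · simp
  have h2 : (fun w : ℂ => 1 + w) =O[𝓝 0] fun _ => (1 : ℂ) := by
    refine Tendsto.isBigO_one ℂ (c := 1) ?_
    have : Continuous fun w : ℂ => 1 + w := by fun_prop
    simpa using this.tendsto 0
  have h3 : (fun w : ℂ => w ^ 3 / 2) =o[𝓝 0] fun w => w ^ 2 := by
    have : (fun w : ℂ => w ^ 3) =o[𝓝 0] fun w : ℂ => w ^ 2 := isLittleO_pow_pow (by norm_num)
    refine (this.const_mul_left (1 / 2)).congr_left fun w => ?_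
    ring
  refine (((h2.mul_isLittleO h1).congr_right fun w => one_mul _).add h3).congr_left fun w => ?_
  ring

/-- The linear term of `(1 + w) exp (-w) = 1 - w² / 2 + o(w²)` vanishes, so the scale `w ~ 1 / √n`
produces a Gaussian. -/
theorem tendsto_mul_one_add_mul_exp_neg {w : ℕ → ℂ} {L : ℂ}
    (hw : Tendsto (fun n : ℕ => (Real.sqrt n : ℂ) * w n) atTop (𝓝 L)) :
    Tendsto w atTop (𝓝 0) ∧
    Tendsto (fun n : ℕ => (n : ℂ) * ((1 + w n) * Complex.exp (-w n) - 1)) atTop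
      (𝓝 (-(L ^ 2 / 2))) := by
  have hs : ∀ n : ℕ, (Real.sqrt n : ℂ) * Real.sqrt n = n := fun n => by
    rw [← Complex.ofReal_mul, Real.mul_self_sqrt (by positivity)]; simp
  have hr : Tendsto (fun n : ℕ => ((Real.sqrt n)⁻¹ : ℂ)) atTop (𝓝 0) := by
    have h1 : Tendsto (fun n : ℕ => (Real.sqrt n)⁻¹) atTop (𝓝 0) :=
      (Real.tendsto_sqrt_atTop.comp tendsto_natCast_atTop_atTop).inv_tendsto_atTop
    have h2 := (Complex.continuous_ofReal.tendsto 0).comp h1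
    simpa [Function.comp_def] using h2
  have hw0 : Tendsto w atTop (𝓝 0) := by
    have h := hr.mul hw
    rw [zero_mul] at h
    refine h.congr' ?_
    filter_upwards [eventually_ge_atTop 1] with n hn
    have : (Real.sqrt n : ℂ) ≠ 0 := by
      rw [Ne, Complex.ofReal_eq_zero, Real.sqrt_eq_zero (by positivity)]
      exact_mod_cast (by omega : n ≠ 0)
    rw [inv_mul_cancel_left₀ this]
  refine ⟨hw0, ?_⟩
  have h1 : (fun n : ℕ => (n : ℂ) * ((1 + w n) * Complex.exp (-w n) - 1 + w n ^ 2 / 2)) =o[atTop]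
      fun n => (n : ℂ) * w n ^ 2 :=
    (isBigO_refl _ _).mul_isLittleO (one_add_mul_exp_neg_isLittleO.comp_tendsto hw0)
  have h2 : Tendsto (fun n : ℕ => (n : ℂ) * w n ^ 2) atTop (𝓝 (L ^ 2)) := by
    refine (hw.pow 2).congr fun n => ?_
    rw [← hs n]; ring
  have h3 := (h1.trans_isBigO (h2.isBigO_one ℂ)).tendsto_zero_of_tendsto (tendsto_const_nhds (x := (1 : ℂ)))
  have h4 := h3.sub (h2.div_const 2)
  rw [zero_sub] at h4
  refine h4.congr fun n => ?_
  ring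

/-- The rescaled position `√(2 / n) (y + q) + γ / n` near the edge. -/
noncomputable def edgeShift (y γ : ℂ) (q : ℝ) (n : ℕ) : ℂ :=
  ((Real.sqrt 2 / Real.sqrt n : ℝ) : ℂ) * (y + q) + γ / n

theorem tendsto_sqrt_mul_edgeShift (y γ : ℂ) (q : ℝ) :
    Tendsto (fun n : ℕ => (Real.sqrt n : ℂ) * edgeShift y γ q n) atTop
      (𝓝 ((Real.sqrt 2 : ℂ) * (y + q))) := by
  have hr : Tendsto (fun n : ℕ => ((Real.sqrt n)⁻¹ : ℂ)) atTop (𝓝 0) := by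
    have h1 : Tendsto (fun n : ℕ => (Real.sqrt n)⁻¹) atTop (𝓝 0) :=
      (Real.tendsto_sqrt_atTop.comp tendsto_natCast_atTop_atTop).inv_tendsto_atTop
    have h2 := (Complex.continuous_ofReal.tendsto 0).comp h1
    simpa [Function.comp_def] using h2
  have h := (tendsto_const_nhds (x := (Real.sqrt 2 : ℂ) * (y + q))).add (hr.const_mul γ)
  rw [mul_zero, add_zero] at h
  refine h.congr' ?_
  filter_upwards [eventually_ge_atTop 1] with n hn
  have h0 : (Real.sqrt n : ℂ) ≠ 0 := by
    rw [Ne, Complex.ofReal_eq_zero, Real.sqrt_eq_zero (by positivity)]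
    exact_mod_cast (by omega : n ≠ 0)
  have hs : (n : ℂ) = (Real.sqrt n : ℂ) * Real.sqrt n := by
    rw [← Complex.ofReal_mul, Real.mul_self_sqrt (by positivity)]; simp
  rw [edgeShift, hs]
  push_cast
  field_simp

theorem edgeShift_bounds (y γ : ℂ) : ∀ᶠ n : ℕ in atTop, ∀ q : ℝ, 0 ≤ q →
    1 ≤ n ∧ -1 / 2 ≤ (edgeShift y γ q n).re ∧
      n * (edgeShift y γ q n).im ^ 2 ≤ (Real.sqrt 2 * ‖y‖ + ‖γ‖) ^ 2 ∧
      q - (Real.sqrt 2 * ‖y‖ + ‖γ‖) ≤ Real.sqrt n * (edgeShift y γ q n).re := by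
  set B := Real.sqrt 2 * ‖y‖ + ‖γ‖ with hB
  have hB0 : 0 ≤ B := by positivity
  -- For such `n` one has `√n ≥ 2 B`, so `√n re w ≥ q - B` forces `re w ≥ -1 / 2` uniformly in `q ≥
  -- 0`.
  obtain ⟨M, hM⟩ := exists_nat_gt (4 * B ^ 2)
  filter_upwards [eventually_ge_atTop M, eventually_ge_atTop 1] with n hnM hn q hq
  have hn' : (1 : ℝ) ≤ n := by exact_mod_cast hn
  have hnM' : 4 * B ^ 2 ≤ n := hM.le.trans (by exact_mod_cast hnM)
  set r := Real.sqrt n with hr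
  have hrr : r * r = n := Real.mul_self_sqrt (by positivity)
  have hr1 : 1 ≤ r := Real.one_le_sqrt.2 hn'
  have hr0 : 0 < r := by linarith
  have h2B : 2 * B ≤ r := abs_le_of_sq_le_sq' (by nlinarith) hr0.le |>.2
  have h2 : 1 ≤ Real.sqrt 2 := Real.one_le_sqrt.2 (by norm_num)
  have hre : r * (edgeShift y γ q n).re = Real.sqrt 2 * (y.re + q) + γ.re / r := by
    rw [edgeShift, Complex.add_re, Complex.re_ofReal_mul, ← Complex.ofReal_natCast,
      Complex.div_ofReal_re, ← hr, ← hrr]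
    simp only [Complex.add_re, Complex.ofReal_re]
    field_simp
  have him : r * (edgeShift y γ q n).im = Real.sqrt 2 * y.im + γ.im / r := by
    rw [edgeShift, Complex.add_im, Complex.im_ofReal_mul, ← Complex.ofReal_natCast,
      Complex.div_ofReal_im, ← hr, ← hrr]
    simp only [Complex.add_im, Complex.ofReal_im, add_zero]
    field_simp
  have hdiv : ∀ x : ℝ, |x / r| ≤ |x| := fun x => by
    rw [abs_div, abs_of_pos hr0]; exact div_le_self (abs_nonneg _) hr1
  have h3 : q - B ≤ r * (edgeShift y γ q n).re := by
    rw [hre]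
    have e1 := (abs_le.1 ((hdiv γ.re).trans (Complex.abs_re_le_norm γ))).1
    have e2 := (abs_le.1 (Complex.abs_re_le_norm y)).1
    nlinarith [mul_le_mul_of_nonneg_left e2 (zero_le_one.trans h2),
      mul_le_mul_of_nonneg_right h2 hq]
  refine ⟨hn, ?_, ?_, h3⟩
  · by_contra! hcon
    nlinarith [mul_lt_mul_of_pos_left hcon hr0]
  · have h4 : |r * (edgeShift y γ q n).im| ≤ B := by
      rw [him]
      refine (abs_add_le _ _).trans (add_le_add ?_ ((hdiv _).trans (Complex.abs_im_le_norm γ)))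
      rw [abs_mul, abs_of_pos (by linarith)]
      exact mul_le_mul_of_nonneg_left (Complex.abs_im_le_norm y) (by linarith)
    have h5 := sq_le_sq' (abs_le.1 h4).1 (abs_le.1 h4).2
    calc n * (edgeShift y γ q n).im ^ 2 = (r * (edgeShift y γ q n).im) ^ 2 := by
          rw [mul_pow, pow_two r, hrr]
      _ ≤ B ^ 2 := h5

end EdgeScaling

/-! ### Dominated convergence for the rescaled integrals. -/

section EdgeIntegrals

theorem integrableOn_pow_mul_exp_neg_half (k : ℕ) :
    IntegrableOn (fun q : ℝ => q ^ k * Real.exp (-q / 2)) (Set.Ioi 0) := by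
  have h := (integrableOn_Ioi_comp_mul_left_iff (fun q : ℝ => q ^ k * Real.exp (-q)) 0
    (a := 1 / 2) (by norm_num)).2 (by simpa using integrableOn_pow_mul_exp_neg k)
  refine IntegrableOn.congr_fun (f := fun q : ℝ => 2 ^ k * ((1 / 2 * q) ^ k * Real.exp (-(1 / 2 * q))))
    (h.const_mul (2 ^ k)) (fun q _ => ?_) measurableSet_Ioi
  simp only
  rw [mul_pow, ← mul_assoc, ← mul_assoc, ← mul_pow, show -(1 / 2 * q) = -q / 2 by ring]
  norm_num

theorem continuous_edgeShift (y γ : ℂ) (n : ℕ) : Continuous fun q => edgeShift y γ q n := by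
  unfold edgeShift; fun_prop

theorem norm_edge_factor_le (y γ : ℂ) : ∃ C : ℝ, ∀ᶠ n : ℕ in atTop, ∀ q : ℝ, 0 ≤ q →
    ‖((1 + edgeShift y γ q n) * Complex.exp (-edgeShift y γ q n)) ^ n‖ ≤
      C * Real.exp (-q / 2) := by
  set B := Real.sqrt 2 * ‖y‖ + ‖γ‖ with hB
  refine ⟨Real.exp (1 / 2 + B ^ 2 + B / 2), ?_⟩
  filter_upwards [edgeShift_bounds y γ] with n hn q hq
  obtain ⟨h1, h2, h3, h4⟩ := hn q hq
  refine (norm_one_add_mul_exp_pow_le h1 h2 h3).trans ?_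
  rw [← Real.exp_add]
  refine Real.exp_le_exp.2 ?_
  linarith

theorem tendsto_edge_integral (y γ : ℂ) (k : ℕ) :
    Tendsto (fun n : ℕ => ∫ q in Set.Ioi (0 : ℝ), (q : ℂ) ^ k *
      ((1 + edgeShift y γ q n) * Complex.exp (-edgeShift y γ q n)) ^ n) atTop
      (𝓝 (∫ q in Set.Ioi (0 : ℝ), (q : ℂ) ^ k * Complex.exp (-(y + q) ^ 2))) := by
  obtain ⟨C, hC⟩ := norm_edge_factor_le y γ
  refine tendsto_integral_filter_of_dominated_convergence
    (fun q => C * (q ^ k * Real.exp (-q / 2))) ?_ ?_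
    ((integrableOn_pow_mul_exp_neg_half k).const_mul C) ?_
  · refine .of_forall fun n => Continuous.aestronglyMeasurable ?_
    have := continuous_edgeShift y γ n
    fun_prop
  · filter_upwards [hC] with n hn
    filter_upwards [ae_restrict_mem measurableSet_Ioi] with q hq
    have hq0 : (0 : ℝ) < q := hq
    rw [norm_mul, norm_pow, Complex.norm_real, Real.norm_of_nonneg hq0.le, mul_left_comm]
    exact mul_le_mul_of_nonneg_left (hn q hq0.le) (by positivity)
  · refine .of_forall fun q => Tendsto.const_mul _ ?_
    have h := (tendsto_mul_one_add_mul_exp_neg (tendsto_sqrt_mul_edgeShift y γ q)).2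
    have h2 : -(((Real.sqrt 2 : ℂ) * (y + q)) ^ 2 / 2) = -(y + q) ^ 2 := by
      rw [mul_pow, ← Complex.ofReal_pow, Real.sq_sqrt (by norm_num)]
      push_cast; ring
    rw [h2] at h
    refine (Complex.tendsto_one_add_pow_exp_of_tendsto h).congr fun n => ?_
    congr 1; ring

/-- The integrand in class AII-dagger after rescaling. -/
noncomputable def selfDualFactor (y γ : ℂ) (q v : ℝ) (n : ℕ) : ℂ :=
  ((1 + edgeShift y γ q n) ^ 2 - (2 * q ^ 2 / n * (1 - (2 * v - 1) ^ 2) : ℝ)) *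
    Complex.exp (-(2 * edgeShift y γ q n))

/-- The subtracted term does not increase the norm, by `norm_sq_sub_mul_le`, so the bound for `((1 +
w) exp (-w)) ^ (2 N)` applies uniformly in `v`. -/
theorem norm_selfDualFactor_le (y γ : ℂ) : ∃ C : ℝ, ∀ᶠ N : ℕ in atTop, ∀ q v : ℝ, 0 ≤ q →
    0 ≤ v → v ≤ 1 → ‖selfDualFactor y γ q v (2 * N) ^ N‖ ≤ C * Real.exp (-q / 2) := by
  obtain ⟨C, hC⟩ := norm_edge_factor_le y γ
  refine ⟨C, ?_⟩
  have h2 : Tendsto (fun N : ℕ => 2 * N) atTop atTop :=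
    tendsto_id.const_mul_atTop' two_pos
  have hsmall : ∀ᶠ n : ℕ in atTop, |(1 + edgeShift y γ 0 n).im| ≤ (1 + edgeShift y γ 0 n).re := by
    have h := (tendsto_mul_one_add_mul_exp_neg (tendsto_sqrt_mul_edgeShift y γ 0)).1
    have hn := (tendsto_zero_iff_norm_tendsto_zero.1 h).eventually_le_const
      (show (0 : ℝ) < 1 / 2 by norm_num)
    filter_upwards [hn] with n hn
    have e1 := (Complex.abs_im_le_norm _).trans hn
    have e2 := (abs_le.1 ((Complex.abs_re_le_norm _).trans hn)).1
    simp only [Complex.add_im, Complex.one_im, zero_add, Complex.add_re, Complex.one_re]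
    linarith
  filter_upwards [h2.eventually hC, h2.eventually hsmall] with N hN hs q v hq hv hv'
  refine le_trans ?_ (hN q hq)
  -- The base point `1 + edgeShift y γ 0 n` is near `1`; the shift `r = √(2 / n) q` satisfies `r² =
  -- 2 q² / n`, the coefficient of the subtracted term.
  have h3 : 1 + edgeShift y γ q (2 * N) =
      (1 + edgeShift y γ 0 (2 * N)) + ((Real.sqrt 2 / Real.sqrt (2 * N : ℕ) * q : ℝ) : ℂ) := by
    simp only [edgeShift]; push_cast; ring
  have h4 : 2 * q ^ 2 / (2 * N : ℕ) = (Real.sqrt 2 / Real.sqrt (2 * N : ℕ) * q) ^ 2 := by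
    rw [mul_pow, div_pow, Real.sq_sqrt (by norm_num), Real.sq_sqrt (by positivity)]; ring
  rw [pow_mul, norm_pow, norm_pow _ N]
  refine pow_le_pow_left₀ (norm_nonneg _) ?_ _
  rw [selfDualFactor, mul_pow, ← Complex.exp_nat_mul, norm_mul, norm_mul]
  refine mul_le_mul ?_ (le_of_eq ?_) (norm_nonneg _) (norm_nonneg _)
  · rw [h3, h4]
    refine norm_sq_sub_mul_le hs (by positivity) ?_ ?_
    · nlinarith
    · nlinarith [sq_nonneg (2 * v - 1)]
  · congr 2; push_cast; ring

theorem tendsto_selfDualFactor_pow (y γ : ℂ) (q v : ℝ) :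
    Tendsto (fun N : ℕ => selfDualFactor y γ q v (2 * N) ^ N) atTop
      (𝓝 (Complex.exp (-(y + q) ^ 2 - (q ^ 2 * (1 - (2 * v - 1) ^ 2) : ℝ)))) := by
  have h2 : Tendsto (fun N : ℕ => 2 * N) atTop atTop :=
    tendsto_id.const_mul_atTop' two_pos
  obtain ⟨hw, hf⟩ := tendsto_mul_one_add_mul_exp_neg (tendsto_sqrt_mul_edgeShift y γ q)
  have h3 : -(((Real.sqrt 2 : ℂ) * (y + q)) ^ 2 / 2) = -(y + q) ^ 2 := by
    rw [mul_pow, ← Complex.ofReal_pow, Real.sq_sqrt (by norm_num)]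
    push_cast; ring
  rw [h3] at hf
  set w := fun n => edgeShift y γ q n with hwdef
  have hexp : Tendsto (fun n => Complex.exp (-(2 * w n))) atTop (𝓝 1) := by
    have hc : Continuous fun x : ℂ => Complex.exp (-(2 * x)) := by fun_prop
    have h := (hc.tendsto 0).comp hw
    simp only [mul_zero, neg_zero, Complex.exp_zero] at h
    exact h
  have hF : Tendsto (fun n => (1 + w n) * Complex.exp (-w n) + 1) atTop (𝓝 2) := by
    have hc : Continuous fun x : ℂ => (1 + x) * Complex.exp (-x) + 1 := by fun_prop
    have h := (hc.tendsto 0).comp hw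
    simp only [add_zero, neg_zero, Complex.exp_zero, mul_one] at h
    rw [one_add_one_eq_two] at h
    exact h
  -- For `F = (1 + w) exp (-w)`, write `F² - 1 = (F - 1) (F + 1)`. The limit `F + 1 → 2` compensates
  -- the power `N = n / 2`.
  have h4 := ((hf.mul hF).div_const 2).sub (hexp.const_mul ((q ^ 2 * (1 - (2 * v - 1) ^ 2) : ℝ) : ℂ))
  rw [mul_one, mul_div_cancel_right₀ _ two_ne_zero] at h4
  refine (Complex.tendsto_one_add_pow_exp_of_tendsto (g := fun N => selfDualFactor y γ q v (2 * N) - 1)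
    ((h4.comp h2).congr' ?_)).congr fun N => by congr 1; ring
  filter_upwards [eventually_ge_atTop 1] with N hN
  have hN0 : (N : ℂ) ≠ 0 := by exact_mod_cast (by omega : N ≠ 0)
  have he : Complex.exp (-(2 * w (2 * N))) = Complex.exp (-w (2 * N)) * Complex.exp (-w (2 * N)) := by
    rw [← Complex.exp_add]; congr 1; ring
  simp only [Function.comp_apply, selfDualFactor]
  rw [he]
  push_cast
  field_simp
  ring

theorem tendsto_selfDual_integral (y γ : ℂ) :
    Tendsto (fun N : ℕ => ∫ q in Set.Ioi (0 : ℝ), (q : ℂ) * ∫ v in (0 : ℝ)..1,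
      selfDualFactor y γ q v (2 * N) ^ N) atTop
      (𝓝 (∫ q in Set.Ioi (0 : ℝ), (q : ℂ) * ∫ v in (0 : ℝ)..1,
        Complex.exp (-(y + q) ^ 2 - (q ^ 2 * (1 - (2 * v - 1) ^ 2) : ℝ)))) := by
  obtain ⟨C, hC⟩ := norm_selfDualFactor_le y γ
  have hcont : ∀ n : ℕ, Continuous fun p : ℝ × ℝ => selfDualFactor y γ p.1 p.2 n := by
    intro n
    unfold selfDualFactor edgeShift
    fun_prop
  refine tendsto_integral_filter_of_dominated_convergence
    (fun q => C * (q ^ 1 * Real.exp (-q / 2))) ?_ ?_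
    ((integrableOn_pow_mul_exp_neg_half 1).const_mul C) ?_
  · refine .of_forall fun n => Continuous.aestronglyMeasurable ?_
    refine Complex.continuous_ofReal.mul ?_
    exact intervalIntegral.continuous_parametric_intervalIntegral_of_continuous'
      (f := fun q v => selfDualFactor y γ q v (2 * n) ^ n) ((hcont _).pow n) 0 1
  · filter_upwards [hC] with n hn
    filter_upwards [ae_restrict_mem measurableSet_Ioi] with q hq
    have hq0 : (0 : ℝ) < q := hq
    rw [norm_mul, Complex.norm_real, Real.norm_of_nonneg hq0.le, mul_left_comm, pow_one]
    refine mul_le_mul_of_nonneg_left ?_ hq0.le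
    have h := intervalIntegral.norm_integral_le_of_norm_le_const (a := 0) (b := 1)
      (f := fun v => selfDualFactor y γ q v (2 * n) ^ n) (C := C * Real.exp (-q / 2)) (by
        intro v hv
        rw [Set.uIoc_of_le zero_le_one] at hv
        exact hn q v hq0.le hv.1.le hv.2)
    simpa using h
  · filter_upwards [ae_restrict_mem measurableSet_Ioi] with q hq
    have hq0 : (0 : ℝ) < q := hq
    refine Tendsto.const_mul _ ?_
    refine intervalIntegral.tendsto_integral_filter_of_dominated_convergence
      (fun _ => C * Real.exp (-q / 2)) ?_ ?_ (by simp) ?_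
    · refine .of_forall fun n => Continuous.aestronglyMeasurable ?_
      exact ((hcont (2 * n)).comp (Continuous.prodMk_right q)).pow n
    · filter_upwards [hC] with n hn
      refine .of_forall fun v hv => ?_
      rw [Set.uIoc_of_le zero_le_one] at hv
      exact hn q v hq0.le hv.1.le hv.2
    · exact .of_forall fun v _ => tendsto_selfDualFactor_pow y γ q v

end EdgeIntegrals

/-! ### Exact rescaling of the dual integrals. -/

section EdgeLimits

theorem edgePoint_mul_edgePoint (d : ℕ) (s : ℝ) (z₀ χ η : ℂ) (hz : ‖z₀‖ = 1) :
    edgePoint d s z₀ χ * edgePoint d s (conj z₀) (conj η) =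
      (s : ℂ) ^ 2 * (d + (Real.sqrt (2 * d) : ℂ) * edgeVar z₀ χ η + χ * conj η) := by
  have h1 : z₀ * conj z₀ = 1 := by rw [Complex.mul_conj, Complex.normSq_eq_norm_sq, hz]; simp
  have h2 : (Real.sqrt d : ℂ) * Real.sqrt d = d := by
    rw [← Complex.ofReal_mul, Real.mul_self_sqrt (by positivity)]; simp
  have h3 : (Real.sqrt 2 : ℂ) ≠ 0 := by simp
  rw [edgePoint, edgePoint, edgeVar, Real.sqrt_mul (by norm_num), Complex.ofReal_mul]
  field_simp
  linear_combination (s : ℂ) ^ 2 * ((Real.sqrt d : ℂ) * Real.sqrt d * h1 + h2)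

/-- This is the substitution `s = √(2n) q` at the scale of the Gaussian fluctuations. -/
theorem edge_shift_eq {X y γ : ℂ} {n : ℕ} (hn : 1 ≤ n) (hX : X = n + (Real.sqrt (2 * n) : ℂ) * y + γ)
    (q : ℝ) : X + (Real.sqrt (2 * n) * q : ℝ) = n * (1 + edgeShift y γ q n) := by
  have hn0 : (n : ℂ) ≠ 0 := by exact_mod_cast (by omega : n ≠ 0)
  have hr : (Real.sqrt n : ℂ) ≠ 0 := by
    rw [Ne, Complex.ofReal_eq_zero, Real.sqrt_eq_zero (by positivity)]
    exact_mod_cast (by omega : n ≠ 0)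
  have hs : (n : ℂ) = (Real.sqrt n : ℂ) * Real.sqrt n := by
    rw [← Complex.ofReal_mul, Real.mul_self_sqrt (by positivity)]; simp
  have h1 : (n : ℂ) * ((Real.sqrt 2 / Real.sqrt n : ℝ) : ℂ) = (Real.sqrt (2 * n) : ℂ) := by
    rw [Real.sqrt_mul (by norm_num), Complex.ofReal_div, Complex.ofReal_mul]
    nth_rw 1 [hs]
    field_simp
  rw [hX, edgeShift, mul_add, mul_add, ← mul_assoc, h1, mul_div_cancel₀ _ hn0]
  push_cast
  ring

theorem exp_neg_edge_shift {X y γ : ℂ} {n : ℕ} (hn : 1 ≤ n)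
    (hX : X = n + (Real.sqrt (2 * n) : ℂ) * y + γ) (q : ℝ) :
    Complex.exp (-X) * Real.exp (-(Real.sqrt (2 * n) * q)) =
      (Real.exp (-n) : ℂ) * Complex.exp (-edgeShift y γ q n) ^ n := by
  rw [Complex.ofReal_exp, Complex.ofReal_exp, ← Complex.exp_add, ← Complex.exp_nat_mul,
    ← Complex.exp_add]
  congr 1
  have h := edge_shift_eq hn hX q
  push_cast at h ⊢
  linear_combination -h

theorem setIntegral_Ioi_scale {c : ℝ} (hc : 0 < c) (f : ℝ → ℂ) :
    ∫ s in Set.Ioi (0 : ℝ), f s = c * ∫ q in Set.Ioi (0 : ℝ), f (c * q) := by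
  rw [integral_comp_mul_left_Ioi f 0 hc, mul_zero, Complex.real_smul, ← mul_assoc,
    ← Complex.ofReal_mul, mul_inv_cancel₀ hc.ne', Complex.ofReal_one, one_mul]

theorem exp_mul_integral_pow {X y γ : ℂ} {n : ℕ} (hn : 1 ≤ n)
    (hX : X = n + (Real.sqrt (2 * n) : ℂ) * y + γ) (k : ℕ) :
    Complex.exp (-X) * ∫ s in Set.Ioi (0 : ℝ), ((s ^ k * Real.exp (-s) : ℝ) : ℂ) * (X + s) ^ n =
      ((Real.sqrt (2 * n) ^ k * n.factorial / Stirling.stirlingSeq n : ℝ) : ℂ) *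
        ∫ q in Set.Ioi (0 : ℝ), (q : ℂ) ^ k *
          ((1 + edgeShift y γ q n) * Complex.exp (-edgeShift y γ q n)) ^ n := by
  have hn0 : (0 : ℝ) < n := by exact_mod_cast (by omega : 0 < n)
  have hc : 0 < Real.sqrt (2 * n) := Real.sqrt_pos.2 (by positivity)
  -- By definition `stirlingSeq n = n! / (√(2n) (n / e) ^ n)`. The prefactor `n ^ n exp (-n)` is
  -- written through `n!` because the normalization contains a factorial.
  have hst : Real.sqrt (2 * n) ^ k * n.factorial / Stirling.stirlingSeq n =
      Real.sqrt (2 * n) ^ (k + 1) * (n ^ n * Real.exp (-n)) := by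
    rw [Stirling.stirlingSeq, div_pow, ← Real.exp_nat_mul, mul_one, Real.exp_neg]
    have := (Nat.factorial_pos n).ne'
    field_simp
    ring
  rw [hst, setIntegral_Ioi_scale hc, mul_left_comm, ← integral_const_mul, ← integral_const_mul,
    ← integral_const_mul]
  refine setIntegral_congr_fun measurableSet_Ioi fun q _ => ?_
  have h1 := edge_shift_eq hn hX q
  have h2 := exp_neg_edge_shift hn hX q
  rw [h1, mul_pow, mul_pow, mul_pow, Complex.ofReal_mul]
  push_cast at h2 ⊢
  linear_combination (Real.sqrt (2 * n) : ℂ) * ((Real.sqrt (2 * n) : ℂ) * q) ^ k *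
    ((n : ℂ) ^ n * (1 + edgeShift y γ q n) ^ n) * h2

theorem exp_mul_integral_selfDual {X y γ : ℂ} {N : ℕ} (hN : 1 ≤ N)
    (hX : X = (2 * N : ℕ) + (Real.sqrt (2 * (2 * N : ℕ)) : ℂ) * y + γ) :
    Complex.exp (-X) * ∫ s in Set.Ioi (0 : ℝ), ((s * Real.exp (-s) : ℝ) : ℂ) *
        ∫ v in (0 : ℝ)..1, ((X + s) ^ 2 - (s ^ 2 * (1 - (2 * v - 1) ^ 2) : ℝ)) ^ N =
      ((Real.sqrt (2 * (2 * N : ℕ)) * (2 * N).factorial / Stirling.stirlingSeq (2 * N) : ℝ) : ℂ) *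
        ∫ q in Set.Ioi (0 : ℝ), (q : ℂ) * ∫ v in (0 : ℝ)..1,
          selfDualFactor y γ q v (2 * N) ^ N := by
  obtain ⟨n, hn⟩ : ∃ n, n = 2 * N := ⟨_, rfl⟩
  have hn1 : 1 ≤ n := by omega
  rw [← hn] at hX ⊢
  have hn0 : (0 : ℝ) < n := by exact_mod_cast (by omega : 0 < n)
  have hn0' : (n : ℂ) ≠ 0 := by exact_mod_cast (by omega : n ≠ 0)
  have hc : 0 < Real.sqrt (2 * n) := Real.sqrt_pos.2 (by positivity)
  have hcc : Real.sqrt (2 * n) ^ 2 = 2 * n := Real.sq_sqrt (by positivity)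
  have hst : Real.sqrt (2 * n) * n.factorial / Stirling.stirlingSeq n =
      Real.sqrt (2 * n) ^ 2 * (n ^ n * Real.exp (-n)) := by
    rw [Stirling.stirlingSeq, div_pow, ← Real.exp_nat_mul, mul_one, Real.exp_neg]
    have := (Nat.factorial_pos n).ne'
    field_simp
  rw [hst, setIntegral_Ioi_scale hc, mul_left_comm, ← integral_const_mul, ← integral_const_mul,
    ← integral_const_mul]
  refine setIntegral_congr_fun measurableSet_Ioi fun q _ => ?_
  have h1 := edge_shift_eq hn1 hX q
  have h2 := exp_neg_edge_shift hn1 hX q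
  have h3 : ∀ v : ℝ, ((X + (Real.sqrt (2 * n) * q : ℝ)) ^ 2 -
      ((Real.sqrt (2 * n) * q) ^ 2 * (1 - (2 * v - 1) ^ 2) : ℝ)) ^ N =
      (n : ℂ) ^ n / Complex.exp (-edgeShift y γ q n) ^ n * selfDualFactor y γ q v n ^ N := by
    intro v
    have e1 : (X + (Real.sqrt (2 * n) * q : ℝ)) ^ 2 -
        ((Real.sqrt (2 * n) * q) ^ 2 * (1 - (2 * v - 1) ^ 2) : ℝ) =
        (n : ℂ) ^ 2 * ((1 + edgeShift y γ q n) ^ 2 -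
          (2 * q ^ 2 / n * (1 - (2 * v - 1) ^ 2) : ℝ)) := by
      rw [h1, mul_pow _ q, hcc]
      push_cast
      field_simp
    have e2 : Complex.exp (-(2 * edgeShift y γ q n)) ^ N = Complex.exp (-edgeShift y γ q n) ^ n := by
      rw [← Complex.exp_nat_mul, ← Complex.exp_nat_mul, hn]
      congr 1; push_cast; ring
    rw [e1, mul_pow, ← pow_mul, ← hn, selfDualFactor, mul_pow, e2]
    have e3 : Complex.exp (-edgeShift y γ q n) ^ n ≠ 0 := pow_ne_zero _ (Complex.exp_ne_zero _)
    field_simp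
  simp only [h3, intervalIntegral.integral_const_mul]
  have e3 : Complex.exp (-edgeShift y γ q n) ^ n ≠ 0 := pow_ne_zero _ (Complex.exp_ne_zero _)
  generalize (∫ v in (0 : ℝ)..1, selfDualFactor y γ q v n ^ N) = J
  generalize Complex.exp (-edgeShift y γ q n) ^ n = E at *
  push_cast at h2 ⊢
  field_simp
  linear_combination (Real.sqrt (2 * n) : ℂ) ^ 2 * q * J * h2

end EdgeLimits

/-! ### Edge limits of the three ensembles in integral form. -/

section EnsembleLimits

theorem tendsto_inv_stirlingSeq :
    Tendsto (fun n : ℕ => ((Stirling.stirlingSeq n : ℂ))⁻¹) atTop (𝓝 ((Real.sqrt Real.pi : ℂ)⁻¹)) := by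
  refine Tendsto.inv₀ ((Complex.continuous_ofReal.tendsto _).comp
    Stirling.tendsto_stirlingSeq_sqrt_pi) ?_
  rw [Ne, Complex.ofReal_eq_zero]
  exact (Real.sqrt_pos.2 Real.pi_pos).ne'

theorem stirlingSeq_ne_zero {n : ℕ} (hn : 1 ≤ n) : (Stirling.stirlingSeq n : ℂ) ≠ 0 := by
  obtain ⟨m, rfl⟩ := Nat.exists_eq_add_of_le' hn
  exact_mod_cast (Stirling.stirlingSeq'_pos m).ne'

theorem integral_exp_neg_mul_pow (n : ℕ) :
    ∫ s in Set.Ioi (0 : ℝ), (Real.exp (-s) : ℂ) * (s : ℂ) ^ n = n.factorial := by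
  have h := integral_pow_mul_exp_neg n
  rw [← Complex.ofReal_natCast, ← h, ← integral_complex_ofReal]
  refine setIntegral_congr_fun measurableSet_Ioi fun s _ => ?_
  push_cast; ring

theorem tendsto_charPair_ginibreMatrix (z v : ℕ → ℂ) (y γ : ℂ)
    (h : ∀ N : ℕ, z N * v N = N + (Real.sqrt (2 * N) : ℂ) * y + γ) :
    Tendsto (fun N : ℕ => Complex.exp (-(z N * v N)) *
      (charPair (ginibreMatrix N) (z N) (v N) / charPair (ginibreMatrix N) 0 0)) atTop
      (𝓝 ((Real.sqrt Real.pi : ℂ)⁻¹ *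
        ∫ q in Set.Ioi (0 : ℝ), Complex.exp (-(y + q) ^ 2))) := by
  have hlim := tendsto_inv_stirlingSeq.mul (tendsto_edge_integral y γ 0)
  simp only [pow_zero, one_mul] at hlim
  refine hlim.congr' ?_
  filter_upwards [eventually_ge_atTop 1] with N hN
  have hf : (N.factorial : ℂ) ≠ 0 := by exact_mod_cast (Nat.factorial_pos N).ne'
  have h1 := exp_mul_integral_pow hN (h N) 0
  simp only [pow_zero, one_mul] at h1
  rw [charPair_ginibreMatrix, charPair_ginibreMatrix]
  simp only [mul_zero, zero_add]
  rw [integral_exp_neg_mul_pow, ← mul_div_assoc, h1]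
  push_cast
  have := stirlingSeq_ne_zero hN
  field_simp

theorem integral_symmetric_rescale (x : ℂ) (N : ℕ) :
    ∫ s in Set.Ioi (0 : ℝ), ((s * Real.exp (-s) : ℝ) : ℂ) * (x + s / 2) ^ N =
      (1 / 2) ^ N * ∫ s in Set.Ioi (0 : ℝ), ((s ^ 1 * Real.exp (-s) : ℝ) : ℂ) * (2 * x + s) ^ N := by
  rw [← integral_const_mul]
  refine setIntegral_congr_fun measurableSet_Ioi fun s _ => ?_
  have : (x + s / 2 : ℂ) ^ N = (1 / 2) ^ N * (2 * x + s) ^ N := by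
    rw [← mul_pow]; congr 1; ring
  simp only [this, pow_one]
  ring

theorem tendsto_charPair_symmetricMatrix (z v : ℕ → ℂ) (y γ : ℂ)
    (h : ∀ N : ℕ, 2 * (z N * v N) = N + (Real.sqrt (2 * N) : ℂ) * y + γ) :
    Tendsto (fun N : ℕ => (Real.sqrt N : ℂ) * Complex.exp (-(2 * (z N * v N))) *
      (charPair (symmetricMatrix N) (z N) (v N) / charPair (symmetricMatrix N) 0 0)) atTop
      (𝓝 ((Real.sqrt 2 : ℂ) * ((Real.sqrt Real.pi : ℂ)⁻¹ *
        ∫ q in Set.Ioi (0 : ℝ), (q : ℂ) * Complex.exp (-(y + q) ^ 2)))) := by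
  -- The normalization is `(N + 1)!` up to the common factor `2 ^ (-N)`, one factor more than the
  -- `N!` from rescaling.
  have hq : Tendsto (fun N : ℕ => (N : ℂ) / (N + 1)) atTop (𝓝 1) :=
    tendsto_natCast_div_add_atTop 1
  have hlim := (hq.const_mul (Real.sqrt 2 : ℂ)).mul
    (tendsto_inv_stirlingSeq.mul (tendsto_edge_integral y γ 1))
  simp only [pow_one, mul_one] at hlim
  refine hlim.congr' ?_
  filter_upwards [eventually_ge_atTop 1] with N hN
  have hf : (N.factorial : ℂ) ≠ 0 := by exact_mod_cast (Nat.factorial_pos N).ne'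
  have hN1 : (N + 1 : ℂ) ≠ 0 := by exact_mod_cast N.succ_ne_zero
  have h1 := exp_mul_integral_pow hN (h N) 1
  have h0 : ∫ s in Set.Ioi (0 : ℝ), ((s ^ 1 * Real.exp (-s) : ℝ) : ℂ) * (2 * 0 + s) ^ N =
      (N + 1).factorial := by
    rw [← integral_exp_neg_mul_pow]
    refine setIntegral_congr_fun measurableSet_Ioi fun s _ => ?_
    push_cast; ring
  rw [charPair_symmetricMatrix, charPair_symmetricMatrix, integral_symmetric_rescale,
    integral_symmetric_rescale, mul_zero, h0,
    mul_div_mul_left _ _ (pow_ne_zero N (by norm_num : (1 / 2 : ℂ) ≠ 0)), mul_assoc (Real.sqrt N : ℂ),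
    ← mul_div_assoc (Complex.exp _), h1]
  have hs := stirlingSeq_ne_zero hN
  have hr : (Real.sqrt N : ℂ) * Real.sqrt (2 * N) = Real.sqrt 2 * N := by
    have : (N : ℂ) = (Real.sqrt N : ℂ) * Real.sqrt N := by
      rw [← Complex.ofReal_mul, Real.mul_self_sqrt (by positivity)]; simp
    rw [Real.sqrt_mul (by norm_num), Complex.ofReal_mul]
    linear_combination -(Real.sqrt 2 : ℂ) * this
  simp only [pow_one]
  generalize (∫ q in Set.Ioi (0 : ℝ), (q : ℂ) * _) = J
  rw [Nat.factorial_succ]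
  push_cast
  field_simp
  linear_combination -J * hr

theorem integral_selfDual_rescale (x : ℂ) (N : ℕ) :
    ∫ s in Set.Ioi (0 : ℝ), ((s * Real.exp (-s) : ℝ) : ℂ) * ∫ w in (0 : ℝ)..1,
        (x ^ 2 + x * s + (s * (2 * w - 1) / 2) ^ 2) ^ N =
      (1 / 4) ^ N * ∫ s in Set.Ioi (0 : ℝ), ((s * Real.exp (-s) : ℝ) : ℂ) * ∫ w in (0 : ℝ)..1,
        ((2 * x + s) ^ 2 - (s ^ 2 * (1 - (2 * w - 1) ^ 2) : ℝ)) ^ N := by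
  rw [← integral_const_mul]
  refine setIntegral_congr_fun measurableSet_Ioi fun s _ => ?_
  have : ∀ w : ℝ, (x ^ 2 + x * s + (s * (2 * w - 1) / 2) ^ 2 : ℂ) ^ N =
      (1 / 4) ^ N * ((2 * x + s) ^ 2 - (s ^ 2 * (1 - (2 * w - 1) ^ 2) : ℝ)) ^ N := by
    intro w
    rw [← mul_pow]; congr 1; push_cast; ring
  simp only [this, intervalIntegral.integral_const_mul]
  ring

theorem integral_selfDual_zero (N : ℕ) :
    ∫ s in Set.Ioi (0 : ℝ), ((s * Real.exp (-s) : ℝ) : ℂ) * ∫ w in (0 : ℝ)..1,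
        ((2 * 0 + s : ℂ) ^ 2 - (s ^ 2 * (1 - (2 * w - 1) ^ 2) : ℝ)) ^ N = (2 * N).factorial := by
  -- At `z v = 0` the integrand is `(s (2 w - 1)) ^ (2 N)`; this factor reduces `(2 N + 1)!` to `(2
  -- N)!`.
  have hw : ∫ w in (0 : ℝ)..1, (2 * (w : ℂ) - 1) ^ (2 * N) = 1 / (2 * N + 1) := by
    have h1 : ∀ w : ℝ, (2 * (w : ℂ) - 1) ^ (2 * N) = (((2 * w - 1) ^ (2 * N) : ℝ) : ℂ) := by
      intro w; push_cast; rfl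
    have h2 : ∫ w in (0 : ℝ)..1, (2 * w - 1) ^ (2 * N) = 1 / (2 * N + 1) := by
      rw [intervalIntegral.integral_comp_mul_sub (fun w => w ^ (2 * N)) two_ne_zero, integral_pow]
      norm_num
      rw [Odd.neg_one_pow ⟨N, rfl⟩]
      field_simp
      norm_num
    simp only [h1]
    rw [intervalIntegral.integral_ofReal, h2]
    push_cast; rfl
  have h : ∀ s : ℝ, ((s * Real.exp (-s) : ℝ) : ℂ) * ∫ w in (0 : ℝ)..1,
        ((2 * 0 + s : ℂ) ^ 2 - (s ^ 2 * (1 - (2 * w - 1) ^ 2) : ℝ)) ^ N =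
      1 / (2 * N + 1) * ((Real.exp (-s) : ℂ) * (s : ℂ) ^ (2 * N + 1)) := by
    intro s
    have h1 : ∀ w : ℝ, ((2 * 0 + s : ℂ) ^ 2 - (s ^ 2 * (1 - (2 * w - 1) ^ 2) : ℝ)) ^ N =
        (s : ℂ) ^ (2 * N) * (2 * (w : ℂ) - 1) ^ (2 * N) := by
      intro w
      rw [pow_mul, pow_mul, ← mul_pow]
      congr 1
      push_cast; ring
    simp only [h1, intervalIntegral.integral_const_mul, hw]
    push_cast; ring
  simp only [h]
  rw [integral_const_mul, integral_exp_neg_mul_pow, Nat.factorial_succ]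
  have : (2 * N + 1 : ℂ) ≠ 0 := by exact_mod_cast (2 * N).succ_ne_zero
  push_cast
  field_simp

theorem charPair_selfDualMatrix_zero (N : ℕ) :
    charPair (selfDualMatrix N) 0 0 = (1 / 4) ^ N * (2 * N).factorial := by
  obtain ⟨ε, hε, -, h⟩ := exists_charPair_selfDualMatrix N 0 0
  rw [mul_zero, integral_selfDual_rescale, integral_selfDual_zero] at h
  rcases hε with rfl | rfl
  · rw [h, one_mul]
  · obtain ⟨r, hr, hr'⟩ := charPair_zero_nonneg (selfDualMatrix N)
    rw [hr'] at h
    have h2 : r = -((1 / 4) ^ N * (2 * N).factorial) := by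
      apply Complex.ofReal_injective
      rw [h]; push_cast; ring
    have h3 : 0 < (1 / 4 : ℝ) ^ N * (2 * N).factorial := by
      have := Nat.factorial_pos (2 * N)
      positivity
    linarith

theorem tendsto_charPair_selfDualMatrix (z v : ℕ → ℂ) (y γ : ℂ)
    (h : ∀ N : ℕ, 2 * (z N * v N) =
      (2 * N : ℕ) + (Real.sqrt (2 * (2 * N : ℕ)) : ℂ) * y + γ) :
    Tendsto (fun N : ℕ => 1 / (Real.sqrt (2 * N) : ℂ) * Complex.exp (-(2 * (z N * v N))) *
      (charPair (selfDualMatrix N) (z N) (v N) / charPair (selfDualMatrix N) 0 0)) atTop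
      (𝓝 ((Real.sqrt 2 : ℂ) * ((Real.sqrt Real.pi : ℂ)⁻¹ *
        ∫ q in Set.Ioi (0 : ℝ), (q : ℂ) * ∫ w in (0 : ℝ)..1,
          Complex.exp (-(y + q) ^ 2 - (q ^ 2 * (1 - (2 * w - 1) ^ 2) : ℝ))))) := by
  have h2 : Tendsto (fun N : ℕ => 2 * N) atTop atTop :=
    tendsto_id.const_mul_atTop' two_pos
  have hlim := ((tendsto_inv_stirlingSeq.comp h2).mul (tendsto_selfDual_integral y γ)).const_mul
    (Real.sqrt 2 : ℂ)
  refine hlim.congr' ?_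
  -- Eventually `z v ≠ 0`, which removes the sign ambiguity in the dual integral.
  have hne : ∀ᶠ n : ℕ in atTop, 1 + edgeShift y γ 0 n ≠ 0 := by
    have h := (tendsto_mul_one_add_mul_exp_neg (tendsto_sqrt_mul_edgeShift y γ 0)).1.const_add 1
    rw [add_zero] at h
    exact h.eventually_ne one_ne_zero
  filter_upwards [eventually_ge_atTop 1, h2.eventually hne] with N hN hN2
  have hX := h N
  have hzv : z N * v N ≠ 0 := by
    intro h0
    have h3 := edge_shift_eq (by omega) hX 0
    rw [h0] at h3
    simp only [mul_zero, Complex.ofReal_zero, add_zero] at h3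
    have h4 : ((2 * N : ℕ) : ℂ) ≠ 0 := by exact_mod_cast (by omega : 2 * N ≠ 0)
    exact mul_ne_zero h4 hN2 h3.symm
  obtain ⟨ε, -, hε, hc⟩ := exists_charPair_selfDualMatrix N (z N) (v N)
  rw [hε hzv, one_mul, integral_selfDual_rescale] at hc
  have hf : ((2 * N).factorial : ℂ) ≠ 0 := by exact_mod_cast (Nat.factorial_pos _).ne'
  have h1 := exp_mul_integral_selfDual hN hX
  rw [hc, charPair_selfDualMatrix_zero,
    mul_div_mul_left _ _ (pow_ne_zero N (by norm_num : (1 / 4 : ℂ) ≠ 0)), ← mul_div_assoc,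
    mul_assoc (1 / (Real.sqrt (2 * N) : ℂ)), h1]
  have hs := stirlingSeq_ne_zero (n := 2 * N) (by omega)
  have hr0 : (Real.sqrt (2 * N) : ℂ) ≠ 0 := by
    rw [Ne, Complex.ofReal_eq_zero, Real.sqrt_eq_zero (by positivity)]
    have : (1 : ℝ) ≤ N := by exact_mod_cast hN
    linarith
  have hr : Real.sqrt (2 * (2 * N : ℕ)) = Real.sqrt 2 * Real.sqrt (2 * N) := by
    rw [Real.sqrt_mul (by norm_num)]; push_cast; rfl
  rw [hr]
  simp only [Function.comp_apply]
  push_cast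
  field_simp

end EnsembleLimits

/-! ### Calculus of half-line Gaussian integrals. -/

section HalfLineGaussians

theorem norm_exp_neg_sq_le (y : ℂ) (q : ℝ) :
    ‖Complex.exp (-(y + q) ^ 2)‖ ≤ Real.exp (‖y‖ ^ 2 + ‖y‖ + 1) * Real.exp (-q) := by
  rw [Complex.norm_exp, ← Real.exp_add]
  refine Real.exp_le_exp.2 ?_
  have h1 : y.im ^ 2 ≤ ‖y‖ ^ 2 := sq_le_sq' (abs_le.1 (Complex.abs_im_le_norm y)).1
    (abs_le.1 (Complex.abs_im_le_norm y)).2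
  have h2 := (abs_le.1 (Complex.abs_re_le_norm y)).1
  simp only [pow_two, Complex.neg_re, Complex.mul_re, Complex.add_re, Complex.add_im,
    Complex.ofReal_re, Complex.ofReal_im, add_zero] at *
  nlinarith [sq_nonneg (y.re + q - 1 / 2)]

theorem integrableOn_one_add_pow_mul_exp_neg (k : ℕ) :
    IntegrableOn (fun q : ℝ => (1 + q) ^ k * Real.exp (-q)) (Set.Ioi 0) := by
  have h := ((integrableOn_pow_mul_exp_neg 0).add (integrableOn_pow_mul_exp_neg k)).const_mul
    (2 ^ (k - 1))
  refine Integrable.mono' h (by fun_prop) ?_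
  filter_upwards [ae_restrict_mem measurableSet_Ioi] with q hq
  have hq0 : (0 : ℝ) < q := hq
  rw [Real.norm_of_nonneg (by positivity)]
  have h1 := add_pow_le zero_le_one hq0.le k
  calc (1 + q) ^ k * Real.exp (-q) ≤ (2 ^ (k - 1) * (1 ^ k + q ^ k)) * Real.exp (-q) :=
        mul_le_mul_of_nonneg_right h1 (Real.exp_pos _).le
    _ = _ := by simp; ring

theorem norm_exp_neg_sq_mul_le {f : ℝ → ℂ} {C : ℝ} {k : ℕ} (hf : ∀ q, 0 ≤ q → ‖f q‖ ≤ C * (1 + q) ^ k)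
    (y : ℂ) {q : ℝ} (hq : 0 ≤ q) : ‖Complex.exp (-(y + q) ^ 2) * f q‖ ≤
      (Real.exp (‖y‖ ^ 2 + ‖y‖ + 1) * C) * ((1 + q) ^ k * Real.exp (-q)) := by
  rw [norm_mul]
  calc _ ≤ (Real.exp (‖y‖ ^ 2 + ‖y‖ + 1) * Real.exp (-q)) * (C * (1 + q) ^ k) :=
        mul_le_mul (norm_exp_neg_sq_le y q) (hf q hq) (norm_nonneg _) (by positivity)
    _ = _ := by ring

theorem integrableOn_exp_neg_sq_mul {f : ℝ → ℂ} (hc : Continuous f) {C : ℝ} {k : ℕ}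
    (hf : ∀ q, 0 ≤ q → ‖f q‖ ≤ C * (1 + q) ^ k) (y : ℂ) :
    IntegrableOn (fun q : ℝ => Complex.exp (-(y + q) ^ 2) * f q) (Set.Ioi 0) := by
  refine Integrable.mono' ((integrableOn_one_add_pow_mul_exp_neg k).const_mul
    (Real.exp (‖y‖ ^ 2 + ‖y‖ + 1) * C)) (Continuous.aestronglyMeasurable (by fun_prop)) ?_
  filter_upwards [ae_restrict_mem measurableSet_Ioi] with q hq
  exact norm_exp_neg_sq_mul_le hf y (Set.mem_Ioi.1 hq).le

theorem tendsto_exp_neg_sq_mul {f : ℝ → ℂ} {C : ℝ} {k : ℕ}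
    (hf : ∀ q, 0 ≤ q → ‖f q‖ ≤ C * (1 + q) ^ k) (y : ℂ) :
    Tendsto (fun q : ℝ => Complex.exp (-(y + q) ^ 2) * f q) atTop (𝓝 0) := by
  have h1 : Tendsto (fun q : ℝ => (1 + q) ^ k * Real.exp (-(1 + q))) atTop (𝓝 0) :=
    (Real.tendsto_pow_mul_exp_neg_atTop_nhds_zero k).comp (tendsto_atTop_add_const_left _ 1 tendsto_id)
  have h2 := h1.const_mul ((Real.exp (‖y‖ ^ 2 + ‖y‖ + 1) * C) * Real.exp 1)
  rw [mul_zero] at h2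
  refine squeeze_zero_norm' ?_ h2
  filter_upwards [eventually_ge_atTop 0] with q hq
  refine (norm_exp_neg_sq_mul_le hf y hq).trans (le_of_eq ?_)
  rw [show Real.exp (-q) = Real.exp 1 * Real.exp (-(1 + q)) by rw [← Real.exp_add]; congr 1; ring]
  ring

theorem integral_deriv_exp_neg_sq_mul {f f' : ℝ → ℂ} (hd : ∀ q, HasDerivAt f (f' q) q)
    (hc' : Continuous f') {C C' : ℝ} {k k' : ℕ}
    (hf : ∀ q, 0 ≤ q → ‖f q‖ ≤ C * (1 + q) ^ k) (hf' : ∀ q, 0 ≤ q → ‖f' q‖ ≤ C' * (1 + q) ^ k')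
    (y : ℂ) :
    ∫ q in Set.Ioi (0 : ℝ), Complex.exp (-(y + q) ^ 2) * (-(2 * (y + q)) * f q) =
      -(Complex.exp (-y ^ 2) * f 0) - ∫ q in Set.Ioi (0 : ℝ), Complex.exp (-(y + q) ^ 2) * f' q := by
  have hc : Continuous f := continuous_iff_continuousAt.2 fun q => (hd q).continuousAt
  have hC : 0 ≤ C := by have := (norm_nonneg _).trans (hf 0 le_rfl); simpa using this
  have hb : ∀ q : ℝ, 0 ≤ q → ‖-(2 * (y + q)) * f q‖ ≤ (2 * (‖y‖ + 1) * C) * (1 + q) ^ (k + 1) := by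
    intro q hq
    have h1 : ‖-(2 * (y + q))‖ ≤ 2 * (‖y‖ + 1) * (1 + q) := by
      rw [norm_neg, norm_mul, Complex.norm_ofNat]
      have : ‖y + q‖ ≤ ‖y‖ + q := (norm_add_le _ _).trans (by
        rw [Complex.norm_real, Real.norm_of_nonneg hq])
      nlinarith [norm_nonneg y, mul_nonneg (norm_nonneg y) hq]
    rw [norm_mul]
    calc _ ≤ (2 * (‖y‖ + 1) * (1 + q)) * (C * (1 + q) ^ k) :=
          mul_le_mul h1 (hf q hq) (norm_nonneg _) (by positivity)
      _ = _ := by ring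
  have hi1 := integrableOn_exp_neg_sq_mul (f := fun q => -(2 * (y + q)) * f q) (by fun_prop) hb y
  have hi2 := integrableOn_exp_neg_sq_mul hc' hf' y
  have hderiv : ∀ q : ℝ, HasDerivAt (fun q : ℝ => Complex.exp (-(y + q) ^ 2) * f q)
      (Complex.exp (-(y + q) ^ 2) * (-(2 * (y + q)) * f q) + Complex.exp (-(y + q) ^ 2) * f' q) q := by
    intro q
    have h1 : HasDerivAt (fun q : ℝ => -(y + q) ^ 2) (-(2 * (y + q))) q := by
      have h := (((Complex.ofRealCLM.hasDerivAt (x := q)).const_add y).pow 2).neg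
      refine h.congr_deriv ?_
      simp
    refine (h1.cexp.mul (hd q)).congr_deriv ?_
    ring
  have h := integral_Ioi_of_hasDerivAt_of_tendsto (a := 0) (hderiv 0).continuousAt.continuousWithinAt
    (fun q _ => hderiv q) (hi1.add hi2) (tendsto_exp_neg_sq_mul hf y)
  rw [integral_add hi1 hi2] at h
  rw [eq_sub_iff_add_eq, h]
  simp

/-- Differentiation in `y` and in `q` produces the same factor `-2 (y + q)`. Combined with the
integration by parts above, this gives differential equations in `y`. -/
theorem hasDerivAt_integral_exp_neg_sq_mul {f : ℝ → ℂ} (hc : Continuous f) {C : ℝ} {k : ℕ}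
    (hf : ∀ q, 0 ≤ q → ‖f q‖ ≤ C * (1 + q) ^ k) (y : ℂ) :
    HasDerivAt (fun y : ℂ => ∫ q in Set.Ioi (0 : ℝ), Complex.exp (-(y + q) ^ 2) * f q)
      (∫ q in Set.Ioi (0 : ℝ), Complex.exp (-(y + q) ^ 2) * (-(2 * (y + q)) * f q)) y := by
  have hC : 0 ≤ C := by have := (norm_nonneg _).trans (hf 0 le_rfl); simpa using this
  set R := ‖y‖ + 1 with hR
  refine (hasDerivAt_integral_of_dominated_loc_of_deriv_le (𝕜 := ℂ)
    (μ := volume.restrict (Set.Ioi 0)) (F := fun y q => Complex.exp (-(y + (q : ℂ)) ^ 2) * f q)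
    (F' := fun y q => Complex.exp (-(y + (q : ℂ)) ^ 2) * (-(2 * (y + q)) * f q)) (Metric.ball_mem_nhds y one_pos)
    (bound := fun q => (Real.exp (R ^ 2 + R + 1) * (2 * (R + 1) * C)) *
      ((1 + q) ^ (k + 1) * Real.exp (-q))) ?_
    (integrableOn_exp_neg_sq_mul hc hf y) ?_ ?_
    ((integrableOn_one_add_pow_mul_exp_neg (k + 1)).const_mul _) ?_).2
  · exact .of_forall fun x => Continuous.aestronglyMeasurable (by fun_prop)
  · exact Continuous.aestronglyMeasurable (by fun_prop)
  · filter_upwards [ae_restrict_mem measurableSet_Ioi] with q hq x hx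
    have hq0 : 0 ≤ q := (Set.mem_Ioi.1 hq).le
    have hx' : ‖x‖ ≤ R := by
      have := norm_le_norm_add_norm_sub' x y
      rw [mem_ball_iff_norm] at hx
      linarith
    have h1 : ‖-(2 * (x + q))‖ ≤ 2 * (R + 1) * (1 + q) := by
      rw [norm_neg, norm_mul, Complex.norm_ofNat]
      have : ‖x + q‖ ≤ ‖x‖ + q := (norm_add_le _ _).trans (by
        rw [Complex.norm_real, Real.norm_of_nonneg hq0])
      nlinarith [norm_nonneg x, mul_nonneg (norm_nonneg x) hq0, mul_le_mul_of_nonneg_right hx' hq0]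
    have h2 : ‖Complex.exp (-(x + q) ^ 2)‖ ≤ Real.exp (R ^ 2 + R + 1) * Real.exp (-q) := by
      refine (norm_exp_neg_sq_le x q).trans (mul_le_mul_of_nonneg_right ?_ (Real.exp_pos _).le)
      refine Real.exp_le_exp.2 ?_
      nlinarith [norm_nonneg x]
    rw [norm_mul, norm_mul]
    calc _ ≤ (Real.exp (R ^ 2 + R + 1) * Real.exp (-q)) *
          ((2 * (R + 1) * (1 + q)) * (C * (1 + q) ^ k)) :=
          mul_le_mul h2 (mul_le_mul h1 (hf q hq0) (norm_nonneg _) (by positivity)) (by positivity)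
            (by positivity)
      _ = _ := by ring
  · refine .of_forall fun q x _ => ?_
    have h1 : HasDerivAt (fun x : ℂ => -(x + q) ^ 2) (-(2 * (x + q))) x := by
      refine (((hasDerivAt_id x).add_const (q : ℂ)).pow 2).neg.congr_deriv ?_
      simp
    refine (h1.cexp.mul_const (f q)).congr_deriv ?_
    ring

/-- The unnormalized complementary error function. -/
noncomputable def gaussTail (y : ℂ) : ℂ := ∫ q in Set.Ioi (0 : ℝ), Complex.exp (-(y + q) ^ 2)

theorem erfcC_eq (y : ℂ) : erfcC y = 2 / (Real.sqrt Real.pi : ℂ) * gaussTail y := rfl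

theorem integral_mul_exp_neg_sq (y : ℂ) :
    ∫ q in Set.Ioi (0 : ℝ), Complex.exp (-(y + q) ^ 2) * (-(2 * (y + q)) * 1) =
      -Complex.exp (-y ^ 2) := by
  have h := integral_deriv_exp_neg_sq_mul (f := fun _ => 1) (f' := fun _ => 0)
    (fun q => hasDerivAt_const q 1) continuous_const (C := 1) (C' := 0) (k := 0) (k' := 0)
    (by simp) (by simp) y
  simpa using h

theorem hasDerivAt_gaussTail (y : ℂ) : HasDerivAt gaussTail (-Complex.exp (-y ^ 2)) y := by
  have h := hasDerivAt_integral_exp_neg_sq_mul (f := fun _ => 1) continuous_const (C := 1) (k := 0)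
    (by simp) y
  rw [integral_mul_exp_neg_sq] at h
  simp only [mul_one] at h
  exact h

theorem edgeA_eq (y : ℂ) : edgeA y = (Real.sqrt Real.pi : ℂ)⁻¹ * gaussTail y := by
  rw [edgeA, erfcC_eq]; ring

theorem integral_id_mul_exp_neg_sq (y : ℂ) :
    ∫ q in Set.Ioi (0 : ℝ), (q : ℂ) * Complex.exp (-(y + q) ^ 2) =
      Complex.exp (-y ^ 2) / 2 - y * gaussTail y := by
  have h := integral_mul_exp_neg_sq y
  have hi0 := integrableOn_exp_neg_sq_mul (f := fun _ => 1) continuous_const (C := 1) (k := 0)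
    (by simp) y
  have hi1 := integrableOn_exp_neg_sq_mul (f := fun q => (q : ℂ)) (by fun_prop) (C := 1) (k := 1)
    (fun q hq => by rw [Complex.norm_real, Real.norm_of_nonneg hq]; linarith) y
  have e : ∀ q : ℝ, Complex.exp (-(y + q) ^ 2) * (-(2 * (y + q)) * 1) =
      (-(2 * y)) * (Complex.exp (-(y + q) ^ 2) * 1) + (-2) * (Complex.exp (-(y + q) ^ 2) * q) := by
    intro q; ring
  simp only [e] at h
  rw [integral_add (hi0.const_mul _) (hi1.const_mul _), integral_const_mul, integral_const_mul] at h
  have h1 : ∫ q in Set.Ioi (0 : ℝ), Complex.exp (-(y + q) ^ 2) * 1 = gaussTail y := by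
    simp only [mul_one]; rfl
  simp only [h1, mul_comm (Complex.exp _) (Complex.ofReal _)] at h
  linear_combination (-1 / 2) * h

theorem edgeAI_eq (y : ℂ) : edgeAI y = (Real.sqrt 2 : ℂ) * ((Real.sqrt Real.pi : ℂ)⁻¹ *
    ∫ q in Set.Ioi (0 : ℝ), (q : ℂ) * Complex.exp (-(y + q) ^ 2)) := by
  rw [integral_id_mul_exp_neg_sq, edgeAI, erfcC_eq, Real.sqrt_mul (by norm_num), Complex.ofReal_mul]
  have h2 : (Real.sqrt 2 : ℂ) ^ 2 = 2 := by
    rw [← Complex.ofReal_pow, Real.sq_sqrt (by norm_num)]; simp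
  have h20 : (Real.sqrt 2 : ℂ) ≠ 0 := by simp
  have hp : (Real.sqrt Real.pi : ℂ) ≠ 0 := by
    rw [Ne, Complex.ofReal_eq_zero]; exact (Real.sqrt_pos.2 Real.pi_pos).ne'
  field_simp
  rw [h2]

end HalfLineGaussians

/-! ### Dawson's function and the class AII† limit. -/

section SelfDualEdge

theorem mul_integral_comp_even {f : ℝ → ℝ} (a : ℝ) (hf : ∀ x, f (-x) = f x)
    (hi : IntervalIntegrable f volume 0 a) :
    a * ∫ w in (0 : ℝ)..1, f (a * (2 * w - 1)) = ∫ x in (0 : ℝ)..a, f x := by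
  have h1 := intervalIntegral.mul_integral_comp_mul_sub (a := 0) (b := 1) (f := f) (2 * a) a
  have h2 : ∫ x in (-a)..0, f x = ∫ x in (0 : ℝ)..a, f x := by
    have := intervalIntegral.integral_comp_neg f (a := 0) (b := a)
    simp only [hf, neg_zero] at this
    exact this.symm
  have hi2 : IntervalIntegrable f volume (-a) 0 := by
    have h := hi.symm.comp_sub_left 0
    simpa [hf] using h
  have h3 : ∀ w : ℝ, 2 * a * w - a = a * (2 * w - 1) := fun w => by ring
  simp only [h3] at h1
  rw [show a * (2 * 0 - 1) = -a by ring, show a * (2 * 1 - 1) = a by ring,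
    ← intervalIntegral.integral_add_adjacent_intervals hi2 hi, h2] at h1
  linarith

/-- Dawson's function. -/
noncomputable def dawson (q : ℝ) : ℝ := Real.exp (-q ^ 2) * ∫ p in (0 : ℝ)..q, Real.exp (p ^ 2)

theorem hasDerivAt_dawson (q : ℝ) : HasDerivAt dawson (1 - 2 * q * dawson q) q := by
  have h1 : HasDerivAt (fun q => ∫ p in (0 : ℝ)..q, Real.exp (p ^ 2)) (Real.exp (q ^ 2)) q :=
    intervalIntegral.integral_hasDerivAt_right (Continuous.intervalIntegrable (by fun_prop) _ _)
      (Continuous.stronglyMeasurableAtFilter (by fun_prop) _ _) (by fun_prop)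
  have h2 : HasDerivAt (fun q : ℝ => Real.exp (-q ^ 2)) (Real.exp (-q ^ 2) * (-(2 * q))) q := by
    refine ((hasDerivAt_pow 2 q).neg.exp).congr_deriv ?_
    simp
  refine (h2.mul h1).congr_deriv ?_
  have h3 : Real.exp (-q ^ 2) * Real.exp (q ^ 2) = 1 := by rw [← Real.exp_add]; simp
  rw [dawson, h3]
  ring

theorem continuous_dawson : Continuous dawson :=
  continuous_iff_continuousAt.2 fun q => (hasDerivAt_dawson q).continuousAt

theorem dawson_zero : dawson 0 = 0 := by simp [dawson]

theorem dawson_nonneg {q : ℝ} (hq : 0 ≤ q) : 0 ≤ dawson q :=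
  mul_nonneg (Real.exp_pos _).le (intervalIntegral.integral_nonneg hq fun _ _ => (Real.exp_pos _).le)

theorem dawson_le {q : ℝ} (hq : 0 ≤ q) : dawson q ≤ q := by
  have h : ∫ p in (0 : ℝ)..q, Real.exp (p ^ 2) ≤ ∫ _ in (0 : ℝ)..q, Real.exp (q ^ 2) := by
    refine intervalIntegral.integral_mono_on hq (Continuous.intervalIntegrable (by fun_prop) _ _)
      (by simp) fun p hp => ?_
    exact Real.exp_le_exp.2 (by nlinarith [hp.1, hp.2])
  rw [intervalIntegral.integral_const, smul_eq_mul, sub_zero] at h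
  calc dawson q ≤ Real.exp (-q ^ 2) * (q * Real.exp (q ^ 2)) :=
        mul_le_mul_of_nonneg_left h (Real.exp_pos _).le
    _ = q * (Real.exp (-q ^ 2) * Real.exp (q ^ 2)) := by ring
    _ = q := by rw [← Real.exp_add]; simp

theorem norm_dawson_le (q : ℝ) (hq : 0 ≤ q) : ‖(dawson q : ℂ)‖ ≤ 1 * (1 + q) ^ 1 := by
  rw [Complex.norm_real, Real.norm_of_nonneg (dawson_nonneg hq)]
  linarith [dawson_le hq]

/-- Substitute `p = q (2 w - 1)` and use that `exp (p²)` is even. -/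
theorem dawson_eq_integral (q : ℝ) :
    dawson q = q * ∫ w in (0 : ℝ)..1, Real.exp (-(q ^ 2 * (1 - (2 * w - 1) ^ 2))) := by
  rw [dawson, ← mul_integral_comp_even q (fun x => by rw [neg_sq])
    (Continuous.intervalIntegrable (by fun_prop) _ _), mul_left_comm,
    ← intervalIntegral.integral_const_mul]
  congr 1
  refine intervalIntegral.integral_congr fun w _ => ?_
  rw [← Real.exp_add]
  congr 1; ring

theorem mul_integral_exp_eq_dawson (y : ℂ) (q : ℝ) :
    (q : ℂ) * ∫ w in (0 : ℝ)..1, Complex.exp (-(y + q) ^ 2 - (q ^ 2 * (1 - (2 * w - 1) ^ 2) : ℝ)) =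
      Complex.exp (-(y + q) ^ 2) * dawson q := by
  have h : ∀ w : ℝ, Complex.exp (-(y + q) ^ 2 - (q ^ 2 * (1 - (2 * w - 1) ^ 2) : ℝ)) =
      Complex.exp (-(y + q) ^ 2) * (Real.exp (-(q ^ 2 * (1 - (2 * w - 1) ^ 2))) : ℂ) := by
    intro w
    rw [Complex.ofReal_exp, ← Complex.exp_add]
    congr 1; push_cast; ring
  simp only [h]
  rw [intervalIntegral.integral_const_mul, intervalIntegral.integral_ofReal, dawson_eq_integral]
  push_cast
  ring

/-- The Gaussian average of Dawson's function. -/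
noncomputable def dawsonTail (y : ℂ) : ℂ :=
  ∫ q in Set.Ioi (0 : ℝ), Complex.exp (-(y + q) ^ 2) * dawson q

/-- Differentiating under the integral and integrating by parts with `D' = 1 - 2 q D` give two
formulas for the derivative. The integral weighted by `q D` enters them with opposite signs, and
averaging eliminates it. -/
theorem hasDerivAt_dawsonTail (y : ℂ) :
    HasDerivAt dawsonTail (-(y * dawsonTail y) - gaussTail y / 2) y := by
  have hc : Continuous fun q : ℝ => (dawson q : ℂ) :=
    Complex.continuous_ofReal.comp continuous_dawson
  have hm : ∀ q : ℝ, HasDerivAt (fun q : ℝ => (dawson q : ℂ)) (1 - 2 * q * dawson q) q := by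
    intro q
    refine (hasDerivAt_dawson q).ofReal_comp.congr_deriv ?_
    push_cast; rfl
  have hb : ∀ q : ℝ, 0 ≤ q → ‖(q * dawson q : ℂ)‖ ≤ 1 * (1 + q) ^ 2 := by
    intro q hq
    rw [norm_mul, Complex.norm_real, Complex.norm_real, Real.norm_of_nonneg hq,
      Real.norm_of_nonneg (dawson_nonneg hq)]
    nlinarith [dawson_le hq, dawson_nonneg hq]
  have hb' : ∀ q : ℝ, 0 ≤ q → ‖(1 - 2 * q * dawson q : ℂ)‖ ≤ 3 * (1 + q) ^ 2 := by
    intro q hq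
    have h1 : ‖(1 - 2 * q * dawson q : ℂ)‖ ≤ 1 + 2 * ‖(q * dawson q : ℂ)‖ := by
      refine (norm_sub_le _ _).trans ?_
      rw [mul_assoc, norm_mul 2, norm_one, Complex.norm_ofNat]
    nlinarith [hb q hq]
  have hd := hasDerivAt_integral_exp_neg_sq_mul hc norm_dawson_le y
  have hp := integral_deriv_exp_neg_sq_mul hm (by fun_prop) norm_dawson_le hb' y
  have i0 := integrableOn_exp_neg_sq_mul (f := fun _ => 1) continuous_const (C := 1) (k := 0)
    (by simp) y
  have i1 := integrableOn_exp_neg_sq_mul hc norm_dawson_le y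
  have i2 := integrableOn_exp_neg_sq_mul (f := fun q : ℝ => (q * dawson q : ℂ)) (by fun_prop) hb y
  have e1 : ∫ q in Set.Ioi (0 : ℝ), Complex.exp (-(y + q) ^ 2) * (-(2 * (y + q)) * dawson q) =
      (-(2 * y)) * dawsonTail y +
        (-2) * ∫ q in Set.Ioi (0 : ℝ), Complex.exp (-(y + q) ^ 2) * (q * dawson q) := by
    rw [dawsonTail, ← integral_const_mul, ← integral_const_mul, ← integral_add (i1.const_mul _)
      (i2.const_mul _)]
    refine integral_congr_ae (.of_forall fun q => ?_)
    simp only; ring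
  have e2 : ∫ q in Set.Ioi (0 : ℝ), Complex.exp (-(y + q) ^ 2) * (1 - 2 * q * dawson q) =
      gaussTail y + (-2) * ∫ q in Set.Ioi (0 : ℝ), Complex.exp (-(y + q) ^ 2) * (q * dawson q) := by
    have : gaussTail y = ∫ q in Set.Ioi (0 : ℝ), Complex.exp (-(y + q) ^ 2) * 1 := by
      simp only [mul_one]; rfl
    rw [this, ← integral_const_mul, ← integral_add i0 (i2.const_mul _)]
    refine integral_congr_ae (.of_forall fun q => ?_)
    simp only; ring
  refine HasDerivAt.congr_deriv (f := dawsonTail) hd ?_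
  rw [e2, dawson_zero] at hp
  rw [e1] at hp ⊢
  push_cast at hp
  linear_combination (1 / 2) * hp

theorem hasDerivAt_exp_mul_dawsonTail (y : ℂ) :
    HasDerivAt (fun y => Complex.exp (y ^ 2 / 2) * dawsonTail y)
      (-(Complex.exp (y ^ 2 / 2) * gaussTail y / 2)) y := by
  have h1 : HasDerivAt (fun y : ℂ => Complex.exp (y ^ 2 / 2)) (Complex.exp (y ^ 2 / 2) * y) y := by
    refine (((hasDerivAt_pow 2 y).div_const 2).cexp).congr_deriv ?_
    simp
  refine (h1.mul (hasDerivAt_dawsonTail y)).congr_deriv ?_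
  ring

theorem hasDerivAt_intervalIntegral_of_continuousOn {F F' : ℂ → ℝ → ℂ} {b : ℝ} (hb : 0 ≤ b)
    (hF : ∀ x, ContinuousOn (F x) (Set.Icc 0 b))
    (hF' : ContinuousOn (fun p : ℂ × ℝ => F' p.1 p.2) (Set.univ ×ˢ Set.Icc 0 b))
    (hd : ∀ x, ∀ t ∈ Set.Icc 0 b, HasDerivAt (fun x => F x t) (F' x t) x) (x : ℂ) :
    HasDerivAt (fun x => ∫ t in (0 : ℝ)..b, F x t) (∫ t in (0 : ℝ)..b, F' x t) x := by
  obtain ⟨C, hC⟩ := ((isCompact_closedBall x 1).prod (isCompact_Icc (a := (0 : ℝ)) (b := b))).exists_bound_of_continuousOn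
    (hF'.mono (Set.prod_mono (Set.subset_univ _) subset_rfl))
  have hsub : Set.uIoc 0 b ⊆ Set.Icc 0 b := by
    rw [Set.uIoc_of_le hb]; exact Set.Ioc_subset_Icc_self
  have hm : ∀ f : ℝ → ℂ, ContinuousOn f (Set.Icc 0 b) →
      AEStronglyMeasurable f (volume.restrict (Set.uIoc 0 b)) := fun f hf =>
    (hf.mono hsub).aestronglyMeasurable measurableSet_uIoc
  have hF'x : ContinuousOn (F' x) (Set.Icc 0 b) :=
    hF'.comp (f := fun t : ℝ => (x, t)) (by fun_prop) fun t ht => ⟨trivial, ht⟩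
  refine (intervalIntegral.hasDerivAt_integral_of_dominated_loc_of_deriv_le (𝕜 := ℂ) (F := F)
    (F' := F') (Metric.closedBall_mem_nhds x one_pos) (bound := fun _ => C)
    (.of_forall fun x => hm _ (hF x)) ?_ (hm _ hF'x) ?_ (by simp) ?_).2
  · exact ContinuousOn.intervalIntegrable (by rw [Set.uIcc_of_le hb]; exact hF x)
  · exact .of_forall fun t ht z hz => hC (z, t) ⟨hz, hsub ht⟩
  · exact .of_forall fun t ht z _ => hd z t (hsub ht)

end SelfDualEdge

/-! ### The closed form in class AII†. -/

section OwenIdentity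

theorem hasDerivAt_erfiC (z : ℂ) :
    HasDerivAt erfiC (2 / (Real.sqrt Real.pi : ℂ) * Complex.exp (z ^ 2)) z := by
  have hd : ∀ (x : ℂ) (t : ℝ), HasDerivAt (fun x : ℂ => x * Complex.exp ((t * x) ^ 2))
      ((1 + 2 * (t * x) ^ 2) * Complex.exp ((t * x) ^ 2)) x := by
    intro x t
    have h1 : HasDerivAt (fun x : ℂ => (t * x) ^ 2) (2 * (t * x) * t) x := by
      refine (((hasDerivAt_id x).const_mul (t : ℂ)).pow 2).congr_deriv ?_
      simp
    refine ((hasDerivAt_id x).mul h1.cexp).congr_deriv ?_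
    simp only [id]; ring
  have h := hasDerivAt_intervalIntegral_of_continuousOn (b := 1) zero_le_one
    (F := fun x t => x * Complex.exp ((t * x) ^ 2))
    (F' := fun x t => (1 + 2 * (t * x) ^ 2) * Complex.exp ((t * x) ^ 2))
    (fun x => Continuous.continuousOn (by fun_prop)) (Continuous.continuousOn (by fun_prop))
    (fun x t _ => hd x t) z
  have h2 : ∫ t in (0 : ℝ)..1, (1 + 2 * (t * z) ^ 2) * Complex.exp ((t * z) ^ 2) =
      Complex.exp (z ^ 2) := by
    have h3 : ∀ t : ℝ, HasDerivAt (fun t : ℝ => (t : ℂ) * Complex.exp ((t * z) ^ 2))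
        ((1 + 2 * (t * z) ^ 2) * Complex.exp ((t * z) ^ 2)) t := by
      intro t
      have h1 : HasDerivAt (fun t : ℂ => (t * z) ^ 2) (2 * (t * z) * z) (t : ℂ) := by
        refine (((hasDerivAt_id (t : ℂ)).mul_const z).pow 2).congr_deriv ?_
        simp
      have h4 := ((hasDerivAt_id (t : ℂ)).mul h1.cexp).comp_ofReal
      refine h4.congr_deriv ?_
      simp only [id]; ring
    rw [intervalIntegral.integral_eq_sub_of_hasDerivAt (fun t _ => h3 t)
      (Continuous.intervalIntegrable (by fun_prop) _ _)]
    simp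
  rw [h2] at h
  exact h.const_mul _

theorem integral_exp_sq_eq_erfiC (y : ℂ) {b : ℝ} (hb : b ≠ 0) :
    y * ∫ u in (0 : ℝ)..b, Complex.exp (y ^ 2 * u ^ 2) =
      (Real.sqrt Real.pi : ℂ) / 2 * erfiC (y * b) := by
  have hp : (Real.sqrt Real.pi : ℂ) ≠ 0 := by
    rw [Ne, Complex.ofReal_eq_zero]; exact (Real.sqrt_pos.2 Real.pi_pos).ne'
  have h := intervalIntegral.integral_comp_mul_left
    (fun u : ℝ => Complex.exp (y ^ 2 * u ^ 2)) hb (a := 0) (b := 1)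
  rw [mul_zero, mul_one, Complex.real_smul] at h
  have hbc : (b : ℂ) ≠ 0 := by exact_mod_cast hb
  have h2 : ∫ u in (0 : ℝ)..b, Complex.exp (y ^ 2 * u ^ 2) =
      b * ∫ s in (0 : ℝ)..1, Complex.exp ((s * (y * b)) ^ 2) := by
    have h3 : ∀ s : ℝ, Complex.exp ((s * (y * b)) ^ 2) =
        Complex.exp (y ^ 2 * ((b * s : ℝ) : ℂ) ^ 2) := by
      intro s; congr 1; push_cast; ring
    simp only [h3]
    rw [h, Complex.ofReal_inv, mul_inv_cancel_left₀ hbc]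
  rw [h2, erfiC, intervalIntegral.integral_const_mul]
  field_simp

/-- Differentiation in `y` cancels the denominator `1 - u²` and leaves an erfi integral. -/
theorem hasDerivAt_owenTI {b : ℝ} (hb : 0 < b) (hb1 : b < 1) (y : ℂ) :
    HasDerivAt (fun y : ℂ => owenTI ((Real.sqrt 2 : ℂ) * y) b)
      (-(Complex.I / (2 * (Real.sqrt Real.pi : ℂ))) * Complex.exp (-y ^ 2) * erfiC (y * b)) y := by
  have h2 : (Real.sqrt 2 : ℂ) ^ 2 = 2 := by
    rw [← Complex.ofReal_pow, Real.sq_sqrt (by norm_num)]; simp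
  have hne : ∀ t ∈ Set.Icc 0 b, (1 - (t : ℂ) ^ 2) ≠ 0 := by
    intro t ht h0
    have h1 : (1 - t ^ 2 : ℝ) = 0 := by
      apply Complex.ofReal_injective; push_cast; exact h0
    nlinarith [ht.1, ht.2]
  have hd : ∀ (x : ℂ), ∀ t ∈ Set.Icc 0 b, HasDerivAt
      (fun x : ℂ => Complex.exp (-(((Real.sqrt 2 : ℂ) * x) ^ 2 * (1 - (t : ℂ) ^ 2)) / 2) / (1 - (t : ℂ) ^ 2))
      (-(2 * x) * (Complex.exp (-x ^ 2) * Complex.exp (x ^ 2 * t ^ 2))) x := by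
    intro x t ht
    have h1 : HasDerivAt (fun x : ℂ => -(((Real.sqrt 2 : ℂ) * x) ^ 2 * (1 - (t : ℂ) ^ 2)) / 2)
        (-(2 * x) * (1 - (t : ℂ) ^ 2)) x := by
      have h0 : (fun x : ℂ => -(((Real.sqrt 2 : ℂ) * x) ^ 2 * (1 - (t : ℂ) ^ 2)) / 2) =
          fun x => -(1 - (t : ℂ) ^ 2) * x ^ 2 := by
        funext x; rw [mul_pow, h2]; ring
      rw [h0]
      refine ((hasDerivAt_pow 2 x).const_mul _).congr_deriv ?_
      push_cast; ring
    refine (h1.cexp.div_const _).congr_deriv ?_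
    rw [← Complex.exp_add, mul_pow, h2]
    have := hne t ht
    rw [show -(2 * x ^ 2 * (1 - (t : ℂ) ^ 2)) / 2 = -x ^ 2 + x ^ 2 * t ^ 2 by ring]
    field_simp
  have h := hasDerivAt_intervalIntegral_of_continuousOn hb.le
    (F := fun x t => Complex.exp (-(((Real.sqrt 2 : ℂ) * x) ^ 2 * (1 - (t : ℂ) ^ 2)) / 2) /
      (1 - (t : ℂ) ^ 2))
    (F' := fun x t => -(2 * x) * (Complex.exp (-x ^ 2) * Complex.exp (x ^ 2 * t ^ 2)))
    (fun x => ContinuousOn.div (by fun_prop) (by fun_prop) hne)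
    (Continuous.continuousOn (by fun_prop)) hd y
  have hp : (Real.sqrt Real.pi : ℂ) ≠ 0 := by
    rw [Ne, Complex.ofReal_eq_zero]; exact (Real.sqrt_pos.2 Real.pi_pos).ne'
  have hpp : (Real.pi : ℂ) = (Real.sqrt Real.pi : ℂ) * Real.sqrt Real.pi := by
    rw [← Complex.ofReal_mul, Real.mul_self_sqrt Real.pi_pos.le]
  refine (h.const_mul (Complex.I / (2 * Real.pi))).congr_deriv ?_
  rw [intervalIntegral.integral_const_mul, intervalIntegral.integral_const_mul]
  have he := integral_exp_sq_eq_erfiC y hb.ne'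
  generalize (∫ u in (0 : ℝ)..b, Complex.exp (y ^ 2 * u ^ 2)) = J at *
  rw [hpp]
  field_simp
  linear_combination (-2 : ℂ) * he

/-- Exchanging the integrals, the Gaussian one over `q` yields `1 / (2 (2 - t²))` with `t = 2 w -
1`; then `t = √2 u` gives Owen's integrand at `x = 0`. -/
theorem dawsonTail_zero : dawsonTail 0 = ((1 / (2 * Real.sqrt 2) *
    ∫ u in (0 : ℝ)..(1 / Real.sqrt 2), 1 / (1 - u ^ 2) : ℝ) : ℂ) := by
  have hs2 : Real.sqrt 2 ^ 2 = 2 := Real.sq_sqrt (by norm_num)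
  have hs0 : 0 < Real.sqrt 2 := by positivity
  -- the double integral
  have h1 : dawsonTail 0 = ∫ q in Set.Ioi (0 : ℝ), ∫ w in (0 : ℝ)..1,
      (q : ℂ) * Complex.exp (-((2 - (2 * w - 1) ^ 2 : ℝ) : ℂ) * q ^ 2) := by
    refine setIntegral_congr_fun measurableSet_Ioi fun q _ => ?_
    rw [← mul_integral_exp_eq_dawson, ← intervalIntegral.integral_const_mul]
    refine intervalIntegral.integral_congr fun w _ => ?_
    congr 2; push_cast; ring
  have hint : Integrable (Function.uncurry fun (w : ℝ) (q : ℝ) =>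
      (q : ℂ) * Complex.exp (-((2 - (2 * w - 1) ^ 2 : ℝ) : ℂ) * q ^ 2))
      ((volume.restrict (Set.uIoc 0 1)).prod (volume.restrict (Set.Ioi 0))) := by
    have : IsFiniteMeasure (volume.restrict (Set.uIoc (0 : ℝ) 1)) := by
      rw [Set.uIoc_of_le zero_le_one]; infer_instance
    have hg : Integrable (fun q : ℝ => q * Real.exp (-1 * q ^ 2)) (volume.restrict (Set.Ioi 0)) :=
      (integrable_mul_exp_neg_mul_sq one_pos).integrableOn
    have hg2 : Integrable (fun p : ℝ × ℝ => (1 : ℝ) * (p.2 * Real.exp (-1 * p.2 ^ 2)))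
      ((volume.restrict (Set.uIoc 0 1)).prod (volume.restrict (Set.Ioi 0))) :=
      Integrable.mul_prod (f := fun _ => (1 : ℝ)) (integrable_const _) hg
    refine hg2.mono' (Continuous.aestronglyMeasurable (by unfold Function.uncurry; fun_prop)) ?_
    rw [Measure.prod_restrict]
    filter_upwards [ae_restrict_mem (measurableSet_uIoc.prod measurableSet_Ioi)] with p hp
    obtain ⟨hw, hq⟩ := hp
    rw [Set.uIoc_of_le zero_le_one] at hw
    have hq0 : (0 : ℝ) < p.2 := hq
    simp only [Function.uncurry]
    rw [norm_mul, Complex.norm_real, Real.norm_of_nonneg hq0.le, one_mul, Complex.norm_exp]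
    refine mul_le_mul_of_nonneg_left (Real.exp_le_exp.2 ?_) hq0.le
    rw [← Complex.ofReal_pow, ← Complex.ofReal_neg, ← Complex.ofReal_mul, Complex.ofReal_re]
    have : (2 * p.1 - 1) ^ 2 ≤ 1 := by nlinarith [hw.1, hw.2]
    nlinarith [sq_nonneg p.2]
  have h2 : ∀ w ∈ Set.uIcc (0 : ℝ) 1, ∫ q in Set.Ioi (0 : ℝ), (q : ℂ) *
      Complex.exp (-((2 - (2 * w - 1) ^ 2 : ℝ) : ℂ) * q ^ 2) =
      ((1 * (1 / (2 * (2 - (1 * (2 * w - 1)) ^ 2))) : ℝ) : ℂ) := by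
    intro w hw
    rw [Set.uIcc_of_le zero_le_one] at hw
    rw [integral_mul_cexp_neg_mul_sq]
    · push_cast; simp
    · rw [Complex.ofReal_re]; nlinarith [hw.1, hw.2]
  rw [h1, ← intervalIntegral_integral_swap hint, intervalIntegral.integral_congr h2,
    intervalIntegral.integral_ofReal, intervalIntegral.integral_const_mul]
  congr 1
  rw [mul_integral_comp_even (f := fun t => 1 / (2 * (2 - t ^ 2))) 1 (fun x => by rw [neg_sq])]
  · have h3 := intervalIntegral.integral_comp_mul_left (fun t => 1 / (2 * (2 - t ^ 2))) hs0.ne'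
      (a := 0) (b := 1 / Real.sqrt 2)
    rw [mul_zero, mul_one_div_cancel hs0.ne', smul_eq_mul] at h3
    have h4 : ∀ u : ℝ, 1 / (2 * (2 - (Real.sqrt 2 * u) ^ 2)) = 1 / 4 * (1 / (1 - u ^ 2)) := by
      intro u
      rw [mul_pow, hs2, one_div_mul_one_div, show 2 * (2 - 2 * u ^ 2) = 4 * (1 - u ^ 2) by ring]
    simp only [h4] at h3
    rw [intervalIntegral.integral_const_mul] at h3
    generalize (∫ u in (0 : ℝ)..(1 / Real.sqrt 2), 1 / (1 - u ^ 2)) = J at *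
    have h5 : ∫ t in (0 : ℝ)..1, 1 / (2 * (2 - t ^ 2)) = Real.sqrt 2 * (1 / 4 * J) := by
      rw [h3]; field_simp
    rw [h5]
    field_simp
    rw [hs2]; ring
  · refine ContinuousOn.intervalIntegrable (ContinuousOn.div (by fun_prop) (by fun_prop) ?_)
    intro t ht
    rw [Set.uIcc_of_le zero_le_one] at ht
    nlinarith [ht.1, ht.2]

theorem edgeAII_eq (y : ℂ) :
    edgeAII y = (Real.sqrt 2 : ℂ) * ((Real.sqrt Real.pi : ℂ)⁻¹ * dawsonTail y) := by
  have hs0 : 0 < Real.sqrt 2 := by positivity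
  have hb : 0 < 1 / Real.sqrt 2 := by positivity
  have hb1 : 1 / Real.sqrt 2 < 1 := by
    rw [div_lt_one hs0]; exact Real.lt_sqrt_of_sq_lt (by norm_num)
  have hs2 : (Real.sqrt 2 : ℂ) ^ 2 = 2 := by
    rw [← Complex.ofReal_pow, Real.sq_sqrt (by norm_num)]; simp
  have hsc : (Real.sqrt 2 : ℂ) ≠ 0 := by simp
  have hp : (Real.sqrt Real.pi : ℂ) ≠ 0 := by
    rw [Ne, Complex.ofReal_eq_zero]; exact (Real.sqrt_pos.2 Real.pi_pos).ne'
  have hpp : (Real.pi : ℂ) = (Real.sqrt Real.pi : ℂ) * Real.sqrt Real.pi := by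
    rw [← Complex.ofReal_mul, Real.mul_self_sqrt Real.pi_pos.le]
  set B : ℂ → ℂ := fun y => -((Real.sqrt Real.pi : ℂ) / 4) * erfcC y * erfiC (y / (Real.sqrt 2 : ℂ))
    - Complex.I * (Real.sqrt Real.pi : ℂ) * owenTI ((Real.sqrt 2 : ℂ) * y) (1 / Real.sqrt 2) with hB
  set G : ℂ → ℂ := fun y => (Real.sqrt 2 : ℂ) * ((Real.sqrt Real.pi : ℂ)⁻¹ *
    (Complex.exp (y ^ 2 / 2) * dawsonTail y)) with hG
  have hGd : ∀ y, HasDerivAt G ((Real.sqrt 2 : ℂ) * ((Real.sqrt Real.pi : ℂ)⁻¹ *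
      (-(Complex.exp (y ^ 2 / 2) * gaussTail y / 2)))) y := fun y =>
    ((hasDerivAt_exp_mul_dawsonTail y).const_mul _).const_mul _
  -- The derivative of Owen's function cancels the term where erfc is differentiated; the term where
  -- erfi is differentiated is the derivative of `G`.
  have hBd : ∀ y, HasDerivAt B ((Real.sqrt 2 : ℂ) * ((Real.sqrt Real.pi : ℂ)⁻¹ *
      (-(Complex.exp (y ^ 2 / 2) * gaussTail y / 2)))) y := by
    intro y
    have h1 : HasDerivAt erfcC (2 / (Real.sqrt Real.pi : ℂ) * -Complex.exp (-y ^ 2)) y :=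
      (hasDerivAt_gaussTail y).const_mul _
    have h2 : HasDerivAt (fun y : ℂ => erfiC (y / (Real.sqrt 2 : ℂ)))
        (2 / (Real.sqrt Real.pi : ℂ) * Complex.exp ((y / (Real.sqrt 2 : ℂ)) ^ 2) *
          (1 / (Real.sqrt 2 : ℂ))) y :=
      (hasDerivAt_erfiC _).comp y ((hasDerivAt_id y).div_const _)
    have h3 := (hasDerivAt_owenTI hb hb1 y).const_mul (Complex.I * (Real.sqrt Real.pi : ℂ))
    refine (((h1.const_mul (-((Real.sqrt Real.pi : ℂ) / 4))).mul h2).sub h3).congr_deriv ?_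
    have e1 : y * ((1 / Real.sqrt 2 : ℝ) : ℂ) = y / (Real.sqrt 2 : ℂ) := by push_cast; ring
    rw [e1, div_pow, hs2, erfcC_eq]
    generalize erfiC (y / (Real.sqrt 2 : ℂ)) = e
    generalize Complex.exp (y ^ 2 / 2) = e2
    generalize Complex.exp (-y ^ 2) = e3
    generalize gaussTail y = g
    field_simp
    linear_combination (4 * (Real.sqrt Real.pi : ℂ) * e3 * e * (Real.sqrt 2 : ℂ)) * Complex.I_sq +
      4 * (e2 * g) * hs2
  have h0 : B 0 = G 0 := by
    have h1 : erfiC 0 = 0 := by simp [erfiC]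
    have h2 : owenTI 0 (1 / Real.sqrt 2) = Complex.I / (2 * Real.pi) *
        ((∫ u in (0 : ℝ)..(1 / Real.sqrt 2), 1 / (1 - u ^ 2) : ℝ) : ℂ) := by
      rw [owenTI, ← intervalIntegral.integral_ofReal]
      congr 1
      refine intervalIntegral.integral_congr fun u _ => ?_
      simp
    simp only [hB, hG, zero_div, h1, mul_zero, h2, dawsonTail_zero]
    generalize (∫ u in (0 : ℝ)..(1 / Real.sqrt 2), 1 / (1 - u ^ 2)) = J
    rw [hpp]
    push_cast
    simp only [ne_eq, OfNat.ofNat_ne_zero, not_false_eq_true, zero_pow, zero_div, Complex.exp_zero]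
    field_simp
    linear_combination -(J : ℂ) * Complex.I_sq
  have hBG : B y = G y := by
    have hd : ∀ y, HasDerivAt (fun y => B y - G y) 0 y := fun y =>
      ((hBd y).sub (hGd y)).congr_deriv (sub_self _)
    have h := is_const_of_deriv_eq_zero (fun y => (hd y).differentiableAt)
      (fun y => (hd y).deriv) y 0
    simp only [h0, sub_self] at h
    exact sub_eq_zero.1 h
  have hE : Complex.exp (y ^ 2 / 2) * Complex.exp (-y ^ 2 / 2) = 1 := by
    rw [← Complex.exp_add, show y ^ 2 / 2 + -y ^ 2 / 2 = 0 by ring, Complex.exp_zero]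
  have hA : edgeAII y = B y * Complex.exp (-y ^ 2 / 2) := rfl
  rw [hA, hBG]
  simp only [hG]
  linear_combination (Real.sqrt 2 : ℂ) * ((Real.sqrt Real.pi : ℂ)⁻¹ * dawsonTail y) * hE

end OwenIdentity

/-! ### Asymptotics as `y → +∞`. -/

section RightTails

/-- Laplace asymptotics of half-line Gaussian integrals with a power-law weight at the origin. -/
theorem tendsto_pow_mul_integral_exp_neg_sq {f : ℝ → ℂ} {k : ℕ} (hc : Continuous f)
    (hf : ∀ q, 0 ≤ q → ‖f q‖ ≤ q ^ k)
    (hlim : Tendsto (fun q : ℝ => f q / (q : ℂ) ^ k) (𝓝[>] 0) (𝓝 1)) :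
    Tendsto (fun y : ℝ => (y : ℂ) ^ (k + 1) * (Real.exp (y ^ 2) : ℂ) *
      ∫ q in Set.Ioi (0 : ℝ), Complex.exp (-(y + q) ^ 2) * f q) atTop
      (𝓝 (k.factorial / 2 ^ (k + 1))) := by
  have hval : ∫ t in Set.Ioi (0 : ℝ), ((t ^ k * Real.exp (-(2 * t)) : ℝ) : ℂ) =
      k.factorial / 2 ^ (k + 1) := by
    have h := setIntegral_Ioi_scale two_pos (fun s : ℝ => ((s ^ k * Real.exp (-s) : ℝ) : ℂ))
    rw [integral_complex_ofReal, integral_pow_mul_exp_neg] at h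
    have h2 : ∀ t : ℝ, (((2 * t) ^ k * Real.exp (-(2 * t)) : ℝ) : ℂ) =
        2 ^ k * ((t ^ k * Real.exp (-(2 * t)) : ℝ) : ℂ) := by
      intro t; push_cast; ring
    simp only [h2] at h
    rw [integral_const_mul] at h
    rw [eq_div_iff (pow_ne_zero _ two_ne_zero)]
    push_cast at h ⊢
    rw [h]; ring
  rw [← hval]
  -- With `q = t / y` the exponent is `-y² - 2 t - (t / y)²`, and the weight is only seen near `0`.
  have hmain : Tendsto (fun y : ℝ => ∫ t in Set.Ioi (0 : ℝ),
      (Real.exp (-(2 * t) - (t / y) ^ 2) : ℂ) * ((y : ℂ) ^ k * f (t / y))) atTop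
      (𝓝 (∫ t in Set.Ioi (0 : ℝ), ((t ^ k * Real.exp (-(2 * t)) : ℝ) : ℂ))) := by
    refine tendsto_integral_filter_of_dominated_convergence
      (fun t => t ^ k * Real.exp (-t)) ?_ ?_ (integrableOn_pow_mul_exp_neg k) ?_
    · exact .of_forall fun y => Continuous.aestronglyMeasurable (by fun_prop)
    · filter_upwards [eventually_gt_atTop 0] with y hy
      filter_upwards [ae_restrict_mem measurableSet_Ioi] with t ht
      have ht0 : (0 : ℝ) < t := ht
      rw [norm_mul, norm_mul, norm_pow, Complex.norm_real, Complex.norm_real,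
        Real.norm_of_nonneg hy.le, Real.norm_of_nonneg (Real.exp_pos _).le, mul_comm]
      have h1 : y ^ k * ‖f (t / y)‖ ≤ t ^ k := by
        refine (mul_le_mul_of_nonneg_left (hf _ (div_pos ht0 hy).le) (by positivity)).trans ?_
        rw [← mul_pow, mul_div_cancel₀ _ hy.ne']
      refine mul_le_mul h1 (Real.exp_le_exp.2 ?_) (Real.exp_pos _).le (by positivity)
      nlinarith [sq_nonneg (t / y)]
    · filter_upwards [ae_restrict_mem measurableSet_Ioi] with t ht
      have ht0 : (0 : ℝ) < t := ht
      have hty : Tendsto (fun y : ℝ => t / y) atTop (𝓝[>] 0) := by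
        refine tendsto_nhdsWithin_iff.2 ⟨tendsto_const_nhds.div_atTop tendsto_id, ?_⟩
        filter_upwards [eventually_gt_atTop 0] with y hy
        exact div_pos ht0 hy
      have h1 : Tendsto (fun y : ℝ => (Real.exp (-(2 * t) - (t / y) ^ 2) : ℂ)) atTop
          (𝓝 (Real.exp (-(2 * t)) : ℂ)) := by
        have hcont : Continuous fun x : ℝ => (Real.exp (-(2 * t) - x ^ 2) : ℂ) := by fun_prop
        have h := (hcont.tendsto 0).comp (hty.mono_right nhdsWithin_le_nhds)
        simpa [Function.comp_def] using h
      have h2 := h1.mul ((hlim.comp hty).const_mul ((t : ℂ) ^ k))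
      rw [mul_one] at h2
      have h3 : ((t ^ k * Real.exp (-(2 * t)) : ℝ) : ℂ) = (Real.exp (-(2 * t)) : ℂ) * (t : ℂ) ^ k := by
        push_cast; ring
      rw [h3]
      refine h2.congr' ?_
      filter_upwards [eventually_gt_atTop 0] with y hy
      have hy0 : (y : ℂ) ≠ 0 := by exact_mod_cast hy.ne'
      have ht0' : (t : ℂ) ≠ 0 := by exact_mod_cast ht0.ne'
      simp only [Function.comp_apply]
      push_cast
      field_simp
      rw [div_pow]
      field_simp
  refine hmain.congr' ?_
  filter_upwards [eventually_gt_atTop 0] with y hy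
  have hy0 : (y : ℂ) ≠ 0 := by exact_mod_cast hy.ne'
  rw [setIntegral_Ioi_scale (inv_pos.2 hy) (fun q : ℝ => Complex.exp (-(y + q) ^ 2) * f q),
    ← mul_assoc, ← integral_const_mul]
  refine setIntegral_congr_fun measurableSet_Ioi fun t _ => ?_
  have h1 : (Real.exp (y ^ 2) : ℂ) * Complex.exp (-(y + (y⁻¹ * t : ℝ)) ^ 2) =
      (Real.exp (-(2 * t) - (t / y) ^ 2) : ℂ) := by
    rw [Complex.ofReal_exp, Complex.ofReal_exp, ← Complex.exp_add]
    congr 1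
    push_cast
    field_simp
    ring
  rw [← h1, show t / y = y⁻¹ * t by ring]
  simp only [pow_succ, Complex.ofReal_inv]
  field_simp

theorem isEquivalent_tail {F : ℝ → ℂ} {k : ℕ} {L : ℂ} {a : ℝ} (ha : a ≠ 0)
    (hF : Tendsto (fun y : ℝ => (y : ℂ) ^ k * (Real.exp (y ^ 2) : ℂ) * F y) atTop (𝓝 L))
    (hL : L = a) : F ~[atTop] fun y : ℝ => ((a / y ^ k * Real.exp (-y ^ 2) : ℝ) : ℂ) := by
  have hac : (a : ℂ) ≠ 0 := by exact_mod_cast ha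
  refine (isEquivalent_iff_tendsto_one ?_).2 ?_
  · filter_upwards [eventually_gt_atTop 0] with y hy
    exact_mod_cast mul_ne_zero (div_ne_zero ha (by positivity)) (Real.exp_pos _).ne'
  · have h := hF.div_const (a : ℂ)
    rw [hL, div_self hac] at h
    refine h.congr' ?_
    filter_upwards [eventually_gt_atTop 0] with y hy
    have hy0 : (y : ℂ) ≠ 0 := by exact_mod_cast hy.ne'
    have he : (Real.exp (-y ^ 2) : ℂ) * Real.exp (y ^ 2) = 1 := by
      rw [← Complex.ofReal_mul, ← Real.exp_add]; simp
    have he0 : (Real.exp (-y ^ 2) : ℂ) ≠ 0 := by exact_mod_cast (Real.exp_pos _).ne'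
    rw [Pi.div_apply, Complex.ofReal_mul, Complex.ofReal_div, Complex.ofReal_pow]
    rw [eq_div_iff (mul_ne_zero (div_ne_zero hac (pow_ne_zero _ hy0)) he0)]
    calc _ = (y : ℂ) ^ k / y ^ k * (a / a) * (Real.exp (-y ^ 2) * Real.exp (y ^ 2)) * F y := by ring
      _ = F y := by
        rw [he, div_self hac, div_self (pow_ne_zero _ hy0)]; ring

theorem sqrt_pi_ne_zero : (Real.sqrt Real.pi : ℂ) ≠ 0 := by
  rw [Ne, Complex.ofReal_eq_zero]; exact (Real.sqrt_pos.2 Real.pi_pos).ne'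

theorem edgeA_isEquivalent_atTop : (fun y : ℝ => edgeA y) ~[atTop]
    fun y : ℝ => ((1 / (2 * Real.sqrt Real.pi * y) * Real.exp (-y ^ 2) : ℝ) : ℂ) := by
  have hp := Real.sqrt_pos.2 Real.pi_pos
  have h := (tendsto_pow_mul_integral_exp_neg_sq (f := fun _ => 1) (k := 0) continuous_const
    (by simp) (by simp)).const_mul ((Real.sqrt Real.pi : ℂ)⁻¹)
  have h2 := isEquivalent_tail (F := fun y : ℝ => edgeA y) (k := 1) (a := 1 / (2 * Real.sqrt Real.pi))
    (by positivity) (h.congr fun y => by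
      rw [edgeA_eq, gaussTail]; simp only [mul_one]; ring) (by
      simp)
  refine h2.congr_right (.of_forall fun y => ?_)
  simp only
  congr 2
  rw [pow_one, div_div]

theorem sqrt_eight_pi : Real.sqrt (8 * Real.pi) = 2 * Real.sqrt 2 * Real.sqrt Real.pi := by
  rw [show (8 : ℝ) * Real.pi = 2 ^ 2 * (2 * Real.pi) by ring, Real.sqrt_mul (by norm_num),
    Real.sqrt_sq (by norm_num), Real.sqrt_mul (by norm_num), mul_assoc]

/-- Both `q` and Dawson's function are `q + o(q)` at `0`, so classes AI† and AII† share their right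
tail. -/
theorem isEquivalent_of_weight_id {F : ℝ → ℂ} {f : ℝ → ℂ} (hc : Continuous f)
    (hf : ∀ q, 0 ≤ q → ‖f q‖ ≤ q ^ 1)
    (hlim : Tendsto (fun q : ℝ => f q / (q : ℂ) ^ 1) (𝓝[>] 0) (𝓝 1))
    (hF : ∀ y : ℝ, F y = (Real.sqrt 2 : ℂ) * ((Real.sqrt Real.pi : ℂ)⁻¹ *
      ∫ q in Set.Ioi (0 : ℝ), Complex.exp (-(y + q) ^ 2) * f q)) :
    F ~[atTop] fun y : ℝ =>
      ((1 / (Real.sqrt (8 * Real.pi) * y ^ 2) * Real.exp (-y ^ 2) : ℝ) : ℂ) := by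
  have hp := Real.sqrt_pos.2 Real.pi_pos
  have hs2 : (Real.sqrt 2 : ℂ) ^ 2 = 2 := by
    rw [← Complex.ofReal_pow, Real.sq_sqrt (by norm_num)]; simp
  have hs0 : (Real.sqrt 2 : ℂ) ≠ 0 := by simp
  have h := ((tendsto_pow_mul_integral_exp_neg_sq hc hf hlim).const_mul
    ((Real.sqrt Real.pi : ℂ)⁻¹)).const_mul (Real.sqrt 2 : ℂ)
  have h2 := isEquivalent_tail (F := F) (k := 2) (a := 1 / Real.sqrt (8 * Real.pi))
    (by positivity) (h.congr fun y => by rw [hF]; ring) (by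
      have := sqrt_pi_ne_zero
      rw [sqrt_eight_pi]
      push_cast
      field_simp
      rw [hs2]; norm_num)
  refine h2.congr_right (.of_forall fun y => ?_)
  simp only
  congr 2
  rw [div_div]

theorem edgeAI_isEquivalent_atTop : (fun y : ℝ => edgeAI y) ~[atTop]
    fun y : ℝ => ((1 / (Real.sqrt (8 * Real.pi) * y ^ 2) * Real.exp (-y ^ 2) : ℝ) : ℂ) := by
  refine isEquivalent_of_weight_id (f := fun q => (q : ℂ)) (by fun_prop) (fun q hq => ?_) ?_
    fun y => ?_
  · rw [Complex.norm_real, Real.norm_of_nonneg hq, pow_one]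
  · refine tendsto_const_nhds.congr' ?_
    filter_upwards [self_mem_nhdsWithin] with q hq
    have : (q : ℂ) ≠ 0 := by exact_mod_cast (Set.mem_Ioi.1 hq).ne'
    rw [pow_one, div_self this]
  · simp only [edgeAI_eq, mul_comm (Complex.exp _)]

theorem edgeAII_isEquivalent_atTop : (fun y : ℝ => edgeAII y) ~[atTop]
    fun y : ℝ => ((1 / (Real.sqrt (8 * Real.pi) * y ^ 2) * Real.exp (-y ^ 2) : ℝ) : ℂ) := by
  refine isEquivalent_of_weight_id (f := fun q => (dawson q : ℂ))
    (Complex.continuous_ofReal.comp continuous_dawson) (fun q hq => ?_) ?_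
    fun y => edgeAII_eq y
  · rw [Complex.norm_real, Real.norm_of_nonneg (dawson_nonneg hq), pow_one]
    exact dawson_le hq
  · have h := (hasDerivAt_dawson 0).tendsto_slope.mono_left
      (nhdsWithin_mono (0 : ℝ) (s := Set.Ioi 0) fun q hq => (Set.mem_Ioi.1 hq).ne')
    rw [mul_zero, zero_mul, sub_zero] at h
    have h2 := (Complex.continuous_ofReal.tendsto 1).comp h
    rw [Complex.ofReal_one] at h2
    refine h2.congr fun q => ?_
    simp [slope_def_field, dawson_zero]

end RightTails

/-! ### Asymptotics as `y → -∞` by reflection. -/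

section LeftTails

/-- The sum has derivative zero, and at `0` it is twice the half-line Gaussian integral. -/
theorem gaussTail_add_neg (y : ℂ) : gaussTail y + gaussTail (-y) = (Real.sqrt Real.pi : ℂ) := by
  have hd : ∀ y, HasDerivAt (fun y => gaussTail y + gaussTail (-y)) 0 y := by
    intro y
    have h1 := hasDerivAt_gaussTail y
    have h2 := (hasDerivAt_gaussTail (-y)).comp y (hasDerivAt_neg y)
    refine (h1.add h2).congr_deriv ?_
    rw [neg_sq]; ring
  have h := is_const_of_deriv_eq_zero (fun y => (hd y).differentiableAt)
    (fun y => (hd y).deriv) y 0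
  simp only [neg_zero] at h
  rw [h]
  have h0 : gaussTail 0 = ((Real.sqrt (Real.pi / 1) / 2 : ℝ) : ℂ) := by
    rw [← integral_gaussian_Ioi 1, ← integral_complex_ofReal, gaussTail]
    refine integral_congr_ae (.of_forall fun q => ?_)
    simp
  rw [h0, div_one]
  push_cast; ring

theorem edgeA_isEquivalent_atBot : (fun y : ℝ => edgeA y - 1) ~[atBot]
    fun y : ℝ => ((1 / (2 * Real.sqrt Real.pi * y) * Real.exp (-y ^ 2) : ℝ) : ℂ) := by
  have h := (edgeA_isEquivalent_atTop.comp_tendsto tendsto_neg_atBot_atTop).neg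
  refine (h.congr_left (.of_forall fun y => ?_)).congr_right (.of_forall fun y => ?_)
  · have h1 := gaussTail_add_neg y
    have := sqrt_pi_ne_zero
    simp only [Function.comp_apply, edgeA_eq, Complex.ofReal_neg]
    field_simp
    linear_combination -h1
  · simp only [Function.comp_apply]
    rw [← Complex.ofReal_neg]
    congr 1
    rw [neg_sq, mul_neg, div_neg, neg_mul, neg_neg]

theorem edgeAI_isEquivalent_atBot :
    (fun y : ℝ => edgeAI y - ((-(Real.sqrt 2 * y) : ℝ) : ℂ)) ~[atBot]
    fun y : ℝ => ((1 / (Real.sqrt (8 * Real.pi) * y ^ 2) * Real.exp (-y ^ 2) : ℝ) : ℂ) := by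
  have h := edgeAI_isEquivalent_atTop.comp_tendsto tendsto_neg_atBot_atTop
  refine (h.congr_left (.of_forall fun y => ?_)).congr_right (.of_forall fun y => ?_)
  · have h1 := gaussTail_add_neg y
    have := sqrt_pi_ne_zero
    simp only [Function.comp_apply, edgeAI_eq, integral_id_mul_exp_neg_sq, Complex.ofReal_neg,
      neg_sq, Complex.ofReal_mul]
    field_simp
    linear_combination (2 * (y : ℂ)) * h1
  · simp only [Function.comp_apply, neg_sq]

end LeftTails

/-! ### The algebraic left tail in class AII†. -/

section SelfDualLeftTail

theorem norm_gaussTail_le {y : ℝ} (hy : 1 ≤ y) : ‖gaussTail y‖ ≤ Real.exp (-y ^ 2) := by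
  have h1 : IntegrableOn (fun q : ℝ => Real.exp (-y ^ 2) * (q ^ 0 * Real.exp (-q))) (Set.Ioi 0) :=
    (integrableOn_pow_mul_exp_neg 0).const_mul _
  have h2 : ‖gaussTail y‖ ≤ ∫ q in Set.Ioi (0 : ℝ), Real.exp (-y ^ 2) * (q ^ 0 * Real.exp (-q)) := by
    refine norm_integral_le_of_norm_le h1 ?_
    filter_upwards [ae_restrict_mem measurableSet_Ioi] with q hq
    have hq0 : (0 : ℝ) < q := hq
    rw [Complex.norm_exp, pow_zero, one_mul, ← Real.exp_add]
    refine Real.exp_le_exp.2 ?_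
    rw [← Complex.ofReal_add, ← Complex.ofReal_pow, ← Complex.ofReal_neg, Complex.ofReal_re]
    nlinarith
  rw [integral_const_mul, integral_pow_mul_exp_neg] at h2
  simpa using h2

/-- The remainder in the expansion of the Gaussian average of Dawson's function. -/
noncomputable def dawsonRemainder (y : ℝ) : ℂ :=
  2 / (Real.sqrt Real.pi : ℂ) * (Real.exp (y ^ 2 / 2) * dawsonTail (-y)) -
    ((Real.exp (y ^ 2 / 2) * (1 / y + 1 / y ^ 3) : ℝ) : ℂ)

/-- The derivative of `exp (y² / 2) (1 / y + 1 / y³)` is `exp (y² / 2) (1 - 3 / y⁴)`. Its leading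
part cancels the constant `√π` in `gaussTail (-y) = √π - gaussTail y`. -/
theorem hasDerivAt_dawsonRemainder {y : ℝ} (hy : 0 < y) : HasDerivAt dawsonRemainder
    (-(Real.exp (y ^ 2 / 2) * gaussTail y / (Real.sqrt Real.pi : ℂ)) +
      ((3 * Real.exp (y ^ 2 / 2) / y ^ 4 : ℝ) : ℂ)) y := by
  have hp := sqrt_pi_ne_zero
  have h1 : HasDerivAt (fun y : ℝ => (Real.exp (y ^ 2 / 2) : ℂ) * dawsonTail (-y))
      (Real.exp (y ^ 2 / 2) * gaussTail (-y) / 2) y := by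
    have h := ((hasDerivAt_exp_mul_dawsonTail (-(y : ℂ))).comp (y : ℂ) (hasDerivAt_neg _)).comp_ofReal
    have he : ∀ y : ℝ, Complex.exp ((-(y : ℂ)) ^ 2 / 2) = (Real.exp (y ^ 2 / 2) : ℂ) := by
      intro y; rw [neg_sq]; push_cast; rfl
    simp only [Function.comp_def, he] at h
    refine h.congr_deriv ?_
    ring
  have h2 : HasDerivAt (fun y : ℝ => Real.exp (y ^ 2 / 2) * (1 / y + 1 / y ^ 3))
      (Real.exp (y ^ 2 / 2) - 3 * Real.exp (y ^ 2 / 2) / y ^ 4) y := by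
    have e1 : HasDerivAt (fun y : ℝ => Real.exp (y ^ 2 / 2)) (Real.exp (y ^ 2 / 2) * y) y := by
      refine ((hasDerivAt_pow 2 y).div_const 2).exp.congr_deriv ?_
      simp
    have e2 : HasDerivAt (fun y : ℝ => 1 / y + 1 / y ^ 3) (-1 / y ^ 2 - 3 / y ^ 4) y := by
      have a1 := (hasDerivAt_const y (1 : ℝ)).div (hasDerivAt_id y) hy.ne'
      have a2 := (hasDerivAt_const y (1 : ℝ)).div (hasDerivAt_pow 3 y) (by positivity)
      refine (a1.add a2).congr_deriv ?_
      simp only [id]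
      field_simp
      norm_num
      ring
    refine (e1.mul e2).congr_deriv ?_
    field_simp
    ring
  refine ((h1.const_mul (2 / (Real.sqrt Real.pi : ℂ))).sub h2.ofReal_comp).congr_deriv ?_
  have h3 := gaussTail_add_neg y
  push_cast
  field_simp
  linear_combination h3

/-- The derivative is at most `5 exp (x² / 2) / x⁴`: `3` from the truncation and `2` from the
Gaussian tail. The constant `10` makes the derivative of the bound at least as large once `x² ≥ 10`,
which `x ≥ 4` ensures. -/
theorem norm_dawsonRemainder_le {y : ℝ} (hy : 4 ≤ y) : ‖dawsonRemainder y‖ ≤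
    ‖dawsonRemainder 4‖ + 10 * (Real.exp (y ^ 2 / 2) / y ^ 5) := by
  have hpi : 1 ≤ Real.sqrt Real.pi := Real.one_le_sqrt.2 (by linarith [Real.pi_gt_three])
  have hB : ∀ x : ℝ, 0 < x → HasDerivAt
      (fun x : ℝ => ‖dawsonRemainder 4‖ + 10 * (Real.exp (x ^ 2 / 2) / x ^ 5))
      (10 * (Real.exp (x ^ 2 / 2) * (1 / x ^ 4 - 5 / x ^ 6))) x := by
    intro x hx
    have e1 : HasDerivAt (fun y : ℝ => Real.exp (y ^ 2 / 2)) (Real.exp (x ^ 2 / 2) * x) x := by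
      refine ((hasDerivAt_pow 2 x).div_const 2).exp.congr_deriv ?_
      simp
    refine (((e1.div (hasDerivAt_pow 5 x) (by positivity)).const_mul 10).const_add _).congr_deriv ?_
    field_simp
    norm_num
    ring
  refine image_norm_le_of_norm_deriv_right_le_deriv_boundary' (a := 4) (b := y)
    (f := dawsonRemainder)
    (f' := fun y : ℝ => -(Real.exp (y ^ 2 / 2) * gaussTail y / (Real.sqrt Real.pi : ℂ)) +
      ((3 * Real.exp (y ^ 2 / 2) / y ^ 4 : ℝ) : ℂ))
    (B := fun x : ℝ => ‖dawsonRemainder 4‖ + 10 * (Real.exp (x ^ 2 / 2) / x ^ 5))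
    (B' := fun x => 10 * (Real.exp (x ^ 2 / 2) * (1 / x ^ 4 - 5 / x ^ 6))) ?_ ?_ ?_ ?_ ?_ ?_
    ⟨hy, le_rfl⟩
  · intro x hx
    exact (hasDerivAt_dawsonRemainder (by linarith [hx.1])).continuousAt.continuousWithinAt
  · intro x hx
    exact (hasDerivAt_dawsonRemainder (by linarith [hx.1])).hasDerivWithinAt
  · simp only [le_add_iff_nonneg_right]; positivity
  · intro x hx
    exact (hB x (by linarith [hx.1])).continuousAt.continuousWithinAt
  · intro x hx
    exact (hB x (by linarith [hx.1])).hasDerivWithinAt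
  · intro x hx
    have hx4 : 4 ≤ x := hx.1
    have hx0 : 0 < x := by linarith
    set E := Real.exp (x ^ 2 / 2) with hE
    have hE0 : 0 < E := Real.exp_pos _
    have h1 : ‖-((E : ℂ) * gaussTail x / (Real.sqrt Real.pi : ℂ))‖ ≤ E * (2 / x ^ 4) := by
      rw [norm_neg, norm_div, norm_mul, Complex.norm_real, Complex.norm_real,
        Real.norm_of_nonneg hE0.le, Real.norm_of_nonneg (by positivity)]
      refine (div_le_self (by positivity) hpi).trans (mul_le_mul_of_nonneg_left ?_ hE0.le)
      refine (norm_gaussTail_le (by linarith)).trans ?_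
      rw [Real.exp_neg, ← one_div, div_le_div_iff₀ (Real.exp_pos _) (by positivity)]
      have := Real.quadratic_le_exp_of_nonneg (sq_nonneg x)
      nlinarith [sq_nonneg x]
    have h2 : ‖((3 * E / x ^ 4 : ℝ) : ℂ)‖ = E * (3 / x ^ 4) := by
      rw [Complex.norm_real, Real.norm_of_nonneg (by positivity)]; ring
    refine (norm_add_le _ _).trans ?_
    rw [h2]
    have h3 : 5 / x ^ 6 ≤ 1 / 2 * (1 / x ^ 4) := by
      rw [div_mul_div_comm, div_le_div_iff₀ (by positivity) (by positivity)]
      have : 10 ≤ x ^ 2 := by nlinarith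
      nlinarith [mul_le_mul_of_nonneg_right this (by positivity : 0 ≤ x ^ 4)]
    have h4 : E * (2 / x ^ 4) + E * (3 / x ^ 4) = 10 * (E * (1 / 2 * (1 / x ^ 4))) := by ring
    have h5 : 10 * (E * (1 / 2 * (1 / x ^ 4))) ≤ 10 * (E * (1 / x ^ 4 - 5 / x ^ 6)) := by
      gcongr; linarith
    linarith

theorem tendsto_pow_mul_exp_neg_sq_half (k : ℕ) :
    Tendsto (fun y : ℝ => y ^ k * Real.exp (-(y ^ 2 / 2))) atTop (𝓝 0) := by
  refine squeeze_zero' ?_ ?_ (Real.tendsto_pow_mul_exp_neg_atTop_nhds_zero k)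
  · filter_upwards [eventually_ge_atTop 0] with y hy
    positivity
  · filter_upwards [eventually_ge_atTop 2] with y hy
    refine mul_le_mul_of_nonneg_left (Real.exp_le_exp.2 ?_) (by positivity)
    nlinarith

theorem tendsto_dawsonRemainder :
    Tendsto (fun y : ℝ => ((y ^ 3 * Real.exp (-(y ^ 2 / 2)) : ℝ) : ℂ) * dawsonRemainder y) atTop
      (𝓝 0) := by
  have h1 : Tendsto (fun y : ℝ => ‖dawsonRemainder 4‖ * (y ^ 3 * Real.exp (-(y ^ 2 / 2))) +
      10 * (1 / y ^ 2)) atTop (𝓝 0) := by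
    have h2 : Tendsto (fun y : ℝ => 1 / y ^ 2) atTop (𝓝 0) :=
      tendsto_const_nhds.div_atTop (tendsto_pow_atTop two_ne_zero)
    simpa using ((tendsto_pow_mul_exp_neg_sq_half 3).const_mul ‖dawsonRemainder 4‖).add
      (h2.const_mul 10)
  refine squeeze_zero_norm' ?_ h1
  filter_upwards [eventually_ge_atTop 4] with y hy
  have hy0 : 0 < y := by linarith
  rw [norm_mul, Complex.norm_real, Real.norm_of_nonneg (by positivity)]
  refine (mul_le_mul_of_nonneg_left (norm_dawsonRemainder_le hy) (by positivity)).trans (le_of_eq ?_)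
  have he : Real.exp (-(y ^ 2 / 2)) * Real.exp (y ^ 2 / 2) = 1 := by rw [← Real.exp_add]; simp
  have h3 : y ^ 3 * Real.exp (-(y ^ 2 / 2)) * (10 * (Real.exp (y ^ 2 / 2) / y ^ 5)) =
      10 * (y ^ 3 / y ^ 5) * (Real.exp (-(y ^ 2 / 2)) * Real.exp (y ^ 2 / 2)) := by ring
  rw [mul_add, h3, he]
  field_simp

theorem edgeAII_isEquivalent_atBot :
    (fun y : ℝ => edgeAII y - ((-(1 / (Real.sqrt 2 * y)) : ℝ) : ℂ)) ~[atBot]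
      fun y : ℝ => ((-(1 / (Real.sqrt 2 * y ^ 3)) : ℝ) : ℂ) := by
  have hs0 : 0 < Real.sqrt 2 := by positivity
  have hs2 : (Real.sqrt 2 : ℂ) ^ 2 = 2 := by
    rw [← Complex.ofReal_pow, Real.sq_sqrt (by norm_num)]; simp
  have hsc : (Real.sqrt 2 : ℂ) ≠ 0 := by simp
  have hp := sqrt_pi_ne_zero
  have h : (fun y : ℝ => edgeAII ((-y : ℝ) : ℂ) - ((-(1 / (Real.sqrt 2 * (-y))) : ℝ) : ℂ)) ~[atTop]
      fun y : ℝ => ((-(1 / (Real.sqrt 2 * (-y) ^ 3)) : ℝ) : ℂ) := by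
    refine (isEquivalent_iff_tendsto_one ?_).2 ?_
    · filter_upwards [eventually_gt_atTop 0] with y hy
      have : (-y) ^ 3 ≠ 0 := pow_ne_zero _ (neg_ne_zero.2 hy.ne')
      exact_mod_cast neg_ne_zero.2 (one_div_ne_zero (mul_ne_zero hs0.ne' this))
    -- The quotient to be shown to tend to `1` is exactly `1 + y³ exp (-y² / 2) * dawsonRemainder
    -- y`.
    · have h1 := tendsto_dawsonRemainder.const_add 1
      rw [add_zero] at h1
      refine h1.congr' ?_
      filter_upwards [eventually_gt_atTop 0] with y hy
      have hy0 : (y : ℂ) ≠ 0 := by exact_mod_cast hy.ne'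
      have he : (Real.exp (-(y ^ 2 / 2)) : ℂ) * Real.exp (y ^ 2 / 2) = 1 := by
        rw [← Complex.ofReal_mul, ← Real.exp_add]; simp
      rw [Pi.div_apply, edgeAII_eq, dawsonRemainder]
      generalize Real.exp (-(y ^ 2 / 2)) = a at *
      generalize Real.exp (y ^ 2 / 2) = b at *
      push_cast
      generalize dawsonTail (-y) = J
      have hden : (-(1 / ((Real.sqrt 2 : ℂ) * (-y) ^ 3))) = 1 / ((Real.sqrt 2 : ℂ) * y ^ 3) := by
        rw [Odd.neg_pow (by decide), mul_neg, div_neg, neg_neg]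
      have hnum : (-(1 / ((Real.sqrt 2 : ℂ) * (-y)))) = 1 / ((Real.sqrt 2 : ℂ) * y) := by
        rw [mul_neg, div_neg, neg_neg]
      have hR : ((Real.sqrt 2 : ℂ) * ((Real.sqrt Real.pi : ℂ)⁻¹ * J) - 1 / ((Real.sqrt 2 : ℂ) * y)) /
          (1 / ((Real.sqrt 2 : ℂ) * y ^ 3)) = 2 * y ^ 3 * (Real.sqrt Real.pi : ℂ)⁻¹ * J - y ^ 2 := by
        rw [← hs2]
        field_simp
      have hr : (y : ℂ) ^ 3 * (1 / y + 1 / y ^ 3) = y ^ 2 + 1 := by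
        field_simp
      rw [hden, hnum, hR, div_eq_mul_inv 2]
      linear_combination (2 * y ^ 3 * (Real.sqrt Real.pi : ℂ)⁻¹ * J - y ^ 2 - 1) * he - a * b * hr
  have h2 := h.comp_tendsto tendsto_neg_atBot_atTop
  simpa only [Function.comp_def, neg_neg] using h2

end SelfDualLeftTail

theorem theorem1 :
    -- the product of the two spectral parameters near an edge point
    (∀ (d : ℕ) (s : ℝ) (z₀ χ η : ℂ), ‖z₀‖ = 1 →
      edgePoint d s z₀ χ * edgePoint d s (conj z₀) (conj η) =
        (s : ℂ) ^ 2 * (d + (Real.sqrt (2 * d) : ℂ) * edgeVar z₀ χ η + χ * conj η)) ∧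
    -- class A, with d_N = N and s = 1
    (∀ z₀ χ η : ℂ, ‖z₀‖ = 1 →
      Tendsto (fun N : ℕ =>
        let z := edgePoint N 1 z₀ χ
        let v := edgePoint N 1 (conj z₀) (conj η)
        Complex.exp (-(z * v)) *
          (charPair (ginibreMatrix N) z v / charPair (ginibreMatrix N) 0 0))
        atTop (𝓝 (edgeA (edgeVar z₀ χ η)))) ∧
    -- class AI-dagger, with d_N = N and s = 1 / √2
    (∀ z₀ χ η : ℂ, ‖z₀‖ = 1 →
      Tendsto (fun N : ℕ =>
        let z := edgePoint N (1 / Real.sqrt 2) z₀ χ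
        let v := edgePoint N (1 / Real.sqrt 2) (conj z₀) (conj η)
        (Real.sqrt N : ℂ) * Complex.exp (-(2 * (z * v))) *
          (charPair (symmetricMatrix N) z v / charPair (symmetricMatrix N) 0 0))
        atTop (𝓝 (edgeAI (edgeVar z₀ χ η)))) ∧
    -- class AII-dagger, with d_N = 2 N and s = 1 / √2
    (∀ z₀ χ η : ℂ, ‖z₀‖ = 1 →
      Tendsto (fun N : ℕ =>
        let z := edgePoint (2 * N) (1 / Real.sqrt 2) z₀ χ
        let v := edgePoint (2 * N) (1 / Real.sqrt 2) (conj z₀) (conj η)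
        1 / (Real.sqrt (2 * N) : ℂ) * Complex.exp (-(2 * (z * v))) *
          (charPair (selfDualMatrix N) z v / charPair (selfDualMatrix N) 0 0))
        atTop (𝓝 (edgeAII (edgeVar z₀ χ η)))) ∧
    -- right and left tails in class A
    ((fun y : ℝ => edgeA y) ~[atTop]
      fun y : ℝ => ((1 / (2 * Real.sqrt Real.pi * y) * Real.exp (-y ^ 2) : ℝ) : ℂ)) ∧
    ((fun y : ℝ => edgeA y - 1) ~[atBot]
      fun y : ℝ => ((1 / (2 * Real.sqrt Real.pi * y) * Real.exp (-y ^ 2) : ℝ) : ℂ)) ∧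
    -- right and left tails in class AI-dagger
    ((fun y : ℝ => edgeAI y) ~[atTop]
      fun y : ℝ => ((1 / (Real.sqrt (8 * Real.pi) * y ^ 2) * Real.exp (-y ^ 2) : ℝ) : ℂ)) ∧
    ((fun y : ℝ => edgeAI y - ((-(Real.sqrt 2 * y) : ℝ) : ℂ)) ~[atBot]
      fun y : ℝ => ((1 / (Real.sqrt (8 * Real.pi) * y ^ 2) * Real.exp (-y ^ 2) : ℝ) : ℂ)) ∧
    -- right and left tails in class AII-dagger
    ((fun y : ℝ => edgeAII y) ~[atTop]
      fun y : ℝ => ((1 / (Real.sqrt (8 * Real.pi) * y ^ 2) * Real.exp (-y ^ 2) : ℝ) : ℂ)) ∧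
    ((fun y : ℝ => edgeAII y - ((-(1 / (Real.sqrt 2 * y)) : ℝ) : ℂ)) ~[atBot]
      fun y : ℝ => ((-(1 / (Real.sqrt 2 * y ^ 3)) : ℝ) : ℂ)) := by
  have hs : ((1 / Real.sqrt 2 : ℝ) : ℂ) ^ 2 = 1 / 2 := by
    rw [← Complex.ofReal_pow, div_pow, Real.sq_sqrt (by norm_num)]; simp
  refine ⟨edgePoint_mul_edgePoint, fun z₀ χ η hz => ?_, fun z₀ χ η hz => ?_, fun z₀ χ η hz => ?_,
    edgeA_isEquivalent_atTop, edgeA_isEquivalent_atBot, edgeAI_isEquivalent_atTop,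
    edgeAI_isEquivalent_atBot, edgeAII_isEquivalent_atTop, edgeAII_isEquivalent_atBot⟩
  · rw [edgeA_eq]
    refine tendsto_charPair_ginibreMatrix (fun N => edgePoint N 1 z₀ χ)
      (fun N => edgePoint N 1 (conj z₀) (conj η)) _ (χ * conj η) fun N => ?_
    rw [edgePoint_mul_edgePoint _ _ _ _ _ hz]
    simp
  · rw [edgeAI_eq]
    refine tendsto_charPair_symmetricMatrix (fun N => edgePoint N (1 / Real.sqrt 2) z₀ χ)
      (fun N => edgePoint N (1 / Real.sqrt 2) (conj z₀) (conj η)) _ (χ * conj η) fun N => ?_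
    rw [edgePoint_mul_edgePoint _ _ _ _ _ hz, hs]
    ring
  · have h := tendsto_charPair_selfDualMatrix
      (fun N => edgePoint (2 * N) (1 / Real.sqrt 2) z₀ χ)
      (fun N => edgePoint (2 * N) (1 / Real.sqrt 2) (conj z₀) (conj η)) (edgeVar z₀ χ η)
      (χ * conj η) fun N => by
        rw [edgePoint_mul_edgePoint _ _ _ _ _ hz, hs]
        ring
    simp only [mul_integral_exp_eq_dawson] at h
    rw [edgeAII_eq]
    exact h
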